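/- **Theorem (tractability of constrained MAP).** *Computation.* "Tractable" means: computed by a program of a real-number machine in time polynomial in the size of the input. The machine works on finite binary trees with real leaves. Comparison of reals, field arithmetic and tests take one step; an operation that moves a tree costs the size of that tree; the machine may in addition have an arbitrary fixed collection of basic functions from finite lists of reals to $\mathbb R$ (e.g. real roots of polynomials, $\exp$, $\log$), each call costing the size of its argument. The same machine is used in the hypotheses and in the conclusion. *Tractable MAP conditions.* Let $\Omega$ be a family of univariate and bivariate real functions given by finite descriptions (trees). Fix which bounds are admitted: either (a) only non-strict bounds, or (b) non-strict and strict bounds. An admissible interval $I(x)$ is given by a lower and an upper bound, each of them infinite or affine in $x$; in case (a) the finite bounds belong to the interval, so that with two finite bounds $I(x)=[l(x),u(x)]$, and in case (b) each finite bound may belong to it or not. Assume that the following are tractable: 0. evaluating members of $\Omega$ at points, and rewriting a univariate $f\in\Omega$ as a bivariate member $(x,y)\mapsto f(x)$ or $(x,y)\mapsto f(y)$ of $\Omega$; 1. *products*: from a non-empty finite list of univariate (bivariate) members, computing their product, which belongs to $\Omega$; 2. *symbolic (arg)suprema*: from a bivariate $f\in\Omega$ and an admissible interval $I$, computing a univariate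 $m\in\Omega$ with $m(x)=\sup_{y\in I(x)}f(x,y)$ for every $x$ at which this supremum exists as a real number; and, given also $x$, computing a point of $\operatorname{argmax}_{y\in I(x)}f(x,y)$ if there is one; likewise with the roles of the two variables of $f$ exchanged; 3. *pointwise maxima*: from a non-empty finite list of univariate members, computing their pointwise maximum, which belongs to $\Omega$. *Problems.* A constrained MAP problem over real variables $X_1,\dots,X_n$ consists of a formula $\Delta$ in conjunctive normal form, whose literals are atoms $\sum_i a_iX_i\le b$, $\sum_i a_iX_i=b$ or their negations and in each of whose clauses at most two variables appear; and of an unnormalized density $$p(\mathbf x)=\prod_{i}p_i(x_i)\prod_{\{i,j\}\in\mathcal E_p}p_{ij}(x_i,x_j)$$ with non-negative factors $p_i,p_{ij}\in\Omega$. In case (a), $\Delta$ contains no negated atoms. The global graph has the variables as vertices, and joins two variables if they appear in a common clause of $\Delta$ or are a pair in $\mathcal E_p$. *Claim.* There is one program that, for every $d$, solves all constrained MAP problems whose global graph has treewidth at most one (is a forest) and components of diameter at most $d$, in time bounded by a polynomial, depending on $d$, in the size of the problem. That is: if $\Delta$ is unsatisfiable, the program reports this. Otherwise it outputs a number $v$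 and a point $\mathbf x^*\models\Delta$, such that $v=\sup_{\mathbf x\models\Delta}p(\mathbf x)$ whenever this supremum is finite. Moreover $$v=p(\mathbf x^*)=\max_{\mathbf x\models\Delta}p(\mathbf x),\qquad \mathbf x^*\in\operatorname*{argmax}_{\mathbf x\models\Delta}p(\mathbf x)$$ if at least one of the following holds: (A) for every bivariate $f\in\Omega$ and every admissible interval, the suprema in 2. are attained wherever the interval is non-empty (the symbolic argsup is defined); (B) $\sup_{\mathbf x\models\Delta}p(\mathbf x)$ is finite, and every assignment of values to a subset (possibly empty) of the variables for which the supremum of $p$ over the compatible points of $\Delta$ equals $\sup_{\mathbf x\models\Delta}p(\mathbf x)$ extends to a maximizer. -/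

import Mathlib

open Polynomial

noncomputable section

/-! ### The model of computation

A real random-access-style machine on structured data: values are finite binary trees whose leaves are
`nil` or a real number, arithmetic and comparison of reals are exact and take one step, and every
operation that moves a tree costs the size of that tree (so an output is never larger than the time
that was needed to produce it).  On top of field arithmetic the machine may have further basic real functions
(roots of polynomials, `exp`, `log`, ...), given by `prim`; `ι = Empty` is the case without any. -/

/-- Values: binary trees with real leaves. -/
inductive Val : Type
  | nil : Val
  | real (r : ℝ) : Val
  | pair (a b : Val) : Val

namespace Val

/-- Number of nodes. -/
def size : Val → ℕ
  | nil => 1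
  | real _ => 1
  | pair a b => a.size + b.size + 1

def fst : Val → Val
  | pair a _ => a
  | _ => nil

def snd : Val → Val
  | pair _ b => b
  | _ => nil

/-- The real leaves from left to right. -/
def leaves : Val → List ℝ
  | nil => []
  | real r => [r]
  | pair a b => a.leaves ++ b.leaves

/-- Truth values: `nil` is false, everything else counts as true. -/
def ofBool : Bool → Val
  | true => real 1
  | false => nil

def isPair : Val → Val
  | pair _ _ => ofBool true
  | _ => ofBool false

def ofList : List Val → Val
  | [] => nil
  | a :: L => pair a (ofList L)

/-- The list of coordinates of a vector. -/
def ofVec {n : ℕ} (x : Fin n → ℝ) : Val :=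
  ofList (List.ofFn fun i => real (x i))

end Val

/-- Elementary operations on a pair of reals. -/
inductive ArithOp : Type
  | add | sub | mul | div | le

open Classical in
def ArithOp.apply : ArithOp → Val → Val
  | add, .pair (.real a) (.real b) => .real (a + b)
  | sub, .pair (.real a) (.real b) => .real (a - b)
  | mul, .pair (.real a) (.real b) => .real (a * b)
  | div, .pair (.real a) (.real b) => .real (a / b)
  | le, .pair (.real a) (.real b) => Val.ofBool (decide (a ≤ b))
  | _, _ => .nil

/-- Programs.  Each program maps one value to one value. -/
inductive Prog (ι : Type) : Type
  | skip : Prog ι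
  | nil : Prog ι
  | zero : Prog ι
  | one : Prog ι
  | fst : Prog ι
  | snd : Prog ι
  | isPair : Prog ι
  | arith (o : ArithOp) : Prog ι
  | prim (i : ι) : Prog ι
  | pair (p q : Prog ι) : Prog ι
  | seq (p q : Prog ι) : Prog ι
  | cond (c p q : Prog ι) : Prog ι
  | loop (c p : Prog ι) : Prog ι

/-- `Runs prim p v w t`: on input `v` the program `p` halts with output `w` after `t` steps. -/
inductive Runs {ι : Type} (prim : ι → List ℝ → ℝ) : Prog ι → Val → Val → ℕ → Prop
  | skip (v : Val) : Runs prim .skip v v v.size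
  | nil (v : Val) : Runs prim .nil v .nil 1
  | zero (v : Val) : Runs prim .zero v (.real 0) 1
  | one (v : Val) : Runs prim .one v (.real 1) 1
  | fst (v : Val) : Runs prim .fst v v.fst v.fst.size
  | snd (v : Val) : Runs prim .snd v v.snd v.snd.size
  | isPair (v : Val) : Runs prim .isPair v v.isPair 1
  | arith (o : ArithOp) (v : Val) : Runs prim (.arith o) v (o.apply v) 1
  | prim (i : ι) (v : Val) : Runs prim (.prim i) v (.real (prim i v.leaves)) v.size
  | pair {p q : Prog ι} {v a b : Val} {s t : ℕ} :
      Runs prim p v a s → Runs prim q v b t → Runs prim (.pair p q) v (.pair a b) (s + t + 1)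
  | seq {p q : Prog ι} {v a b : Val} {s t : ℕ} :
      Runs prim p v a s → Runs prim q a b t → Runs prim (.seq p q) v b (s + t + 1)
  | condTrue {c p q : Prog ι} {v a b : Val} {s t : ℕ} :
      Runs prim c v a s → a ≠ .nil → Runs prim p v b t → Runs prim (.cond c p q) v b (s + t + 1)
  | condFalse {c p q : Prog ι} {v b : Val} {s t : ℕ} :
      Runs prim c v .nil s → Runs prim q v b t → Runs prim (.cond c p q) v b (s + t + 1)
  | loopStop {c p : Prog ι} {v : Val} {s : ℕ} :
      Runs prim c v .nil s → Runs prim (.loop c p) v v (s + v.size)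
  | loopStep {c p : Prog ι} {v a b w : Val} {s t r : ℕ} :
      Runs prim c v a s → a ≠ .nil → Runs prim p v b t → Runs prim (.loop c p) b w r →
      Runs prim (.loop c p) v w (s + t + r + 1)

/-- Some program solves in polynomial time the problem with inputs `a : α`, given to the machine as
`enc a`, and with correct outputs `spec a`. -/
def Tractable {ι : Type} (prim : ι → List ℝ → ℝ) {α : Type}
    (enc : α → Val) (spec : α → Val → Prop) : Prop :=
  ∃ (p : Prog ι) (q : ℕ[X]), ∀ a : α, ∃ (w : Val) (t : ℕ),
    Runs prim p (enc a) w t ∧ t ≤ q.eval (enc a).size ∧ spec a w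

/-! ### Function families and the tractable MAP conditions -/

/-- A family of univariate and bivariate real functions together with the finite descriptions
by which a machine handles its members. -/
structure FunFamily where
  Uni : Type
  Bi : Type
  uniCode : Uni → Val
  biCode : Bi → Val
  uni : Uni → ℝ → ℝ
  bi : Bi → ℝ → ℝ → ℝ

/-- A bound on one variable in terms of another one: absent (infinite), or `a * x + b`, where `strict`
tells whether the bound itself is excluded. -/
inductive AffBound : Type
  | infinite : AffBound
  | affine (strict : Bool) (a b : ℝ) : AffBound

namespace AffBound

def code : AffBound → Val
  | infinite => .nil
  | affine s a b => .pair (Val.ofBool s) (.pair (.real a) (.real b))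

/-- The `y` that respect the bound, read as a lower bound, at `x`. -/
def above : AffBound → ℝ → Set ℝ
  | infinite, _ => Set.univ
  | affine false a b, x => Set.Ici (a * x + b)
  | affine true a b, x => Set.Ioi (a * x + b)

/-- The `y` that respect the bound, read as an upper bound, at `x`. -/
def below : AffBound → ℝ → Set ℝ
  | infinite, _ => Set.univ
  | affine false a b, x => Set.Iic (a * x + b)
  | affine true a b, x => Set.Iio (a * x + b)

def IsStrict : AffBound → Prop
  | infinite => False
  | affine s _ _ => s = true

end AffBound

/-- A pair of bounds `l`, `u`; strict bounds occur only if `strict = true`. -/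
structure AffInterval (strict : Bool) where
  l : AffBound
  u : AffBound
  l_ok : l.IsStrict → strict = true
  u_ok : u.IsStrict → strict = true

namespace AffInterval

variable {strict : Bool}

def code (I : AffInterval strict) : Val := .pair I.l.code I.u.code

/-- The interval at `x`; for non-strict finite bounds it is `[l x, u x]`. -/
def toSet (I : AffInterval strict) (x : ℝ) : Set ℝ := I.l.above x ∩ I.u.below x

end AffInterval

/-- `y` is a maximiser of `f` on `S`. -/
def IsArgmaxOn {α : Type} (f : α → ℝ) (S : Set α) (y : α) : Prop :=
  y ∈ S ∧ ∀ z ∈ S, f z ≤ f y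

/-- The tractable MAP conditions.  A supremum is claimed where it exists as a real number, a maximiser where
there is one. -/
structure TractableMAP {ι : Type} (prim : ι → List ℝ → ℝ) (F : FunFamily) (strict : Bool) : Prop where
  /-- members can be evaluated -/
  evalUni : Tractable prim
    (fun a : F.Uni × ℝ => .pair (F.uniCode a.1) (.real a.2))
    (fun a w => w = .real (F.uni a.1 a.2))
  evalBi : Tractable prim
    (fun a : F.Bi × ℝ × ℝ => .pair (F.biCode a.1) (.pair (.real a.2.1) (.real a.2.2)))
    (fun a w => w = .real (F.bi a.1 a.2.1 a.2.2))
  /-- a univariate member, as a function of either one of two variables, counts as a bivariate one -/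
  liftFst : Tractable prim F.uniCode
    (fun f w => ∃ g : F.Bi, w = F.biCode g ∧ ∀ x y, F.bi g x y = F.uni f x)
  liftSnd : Tractable prim F.uniCode
    (fun f w => ∃ g : F.Bi, w = F.biCode g ∧ ∀ x y, F.bi g x y = F.uni f y)
  /-- (i) products -/
  prodUni : Tractable prim
    (fun L : {L : List F.Uni // L ≠ []} => Val.ofList (L.1.map F.uniCode))
    (fun L w => ∃ g : F.Uni, w = F.uniCode g ∧ ∀ x, F.uni g x = (L.1.map fun f => F.uni f x).prod)
  prodBi : Tractable prim
    (fun L : {L : List F.Bi // L ≠ []} => Val.ofList (L.1.map F.biCode))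
    (fun L w => ∃ g : F.Bi, w = F.biCode g ∧
      ∀ x y, F.bi g x y = (L.1.map fun f => F.bi f x y).prod)
  /-- (ii) symbolic suprema, over the second and over the first variable -/
  supSnd : Tractable prim
    (fun a : F.Bi × AffInterval strict => .pair (F.biCode a.1) a.2.code)
    (fun a w => ∃ m : F.Uni, w = F.uniCode m ∧
      ∀ x s, IsLUB ((fun y => F.bi a.1 x y) '' a.2.toSet x) s → F.uni m x = s)
  supFst : Tractable prim
    (fun a : F.Bi × AffInterval strict => .pair (F.biCode a.1) a.2.code)
    (fun a w => ∃ m : F.Uni, w = F.uniCode m ∧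
      ∀ y s, IsLUB ((fun x => F.bi a.1 x y) '' a.2.toSet y) s → F.uni m y = s)
  /-- (ii) the points where these suprema are attained -/
  argsupSnd : Tractable prim
    (fun a : F.Bi × AffInterval strict × ℝ =>
      .pair (F.biCode a.1) (.pair a.2.1.code (.real a.2.2)))
    (fun a w => ∃ r : ℝ, w = .real r ∧
      ((∃ y, IsArgmaxOn (fun y => F.bi a.1 a.2.2 y) (a.2.1.toSet a.2.2) y) →
        IsArgmaxOn (fun y => F.bi a.1 a.2.2 y) (a.2.1.toSet a.2.2) r))
  argsupFst : Tractable prim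
    (fun a : F.Bi × AffInterval strict × ℝ =>
      .pair (F.biCode a.1) (.pair a.2.1.code (.real a.2.2)))
    (fun a w => ∃ r : ℝ, w = .real r ∧
      ((∃ x, IsArgmaxOn (fun x => F.bi a.1 x a.2.2) (a.2.1.toSet a.2.2) x) →
        IsArgmaxOn (fun x => F.bi a.1 x a.2.2) (a.2.1.toSet a.2.2) r))
  /-- (iii) pointwise maxima -/
  maxUni : Tractable prim
    (fun L : {L : List F.Uni // L ≠ []} => Val.ofList (L.1.map F.uniCode))
    (fun L w => ∃ g : F.Uni, w = F.uniCode g ∧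
      ∀ x, IsGreatest {r | ∃ f ∈ L.1, r = F.uni f x} (F.uni g x))

/-- Every supremum of a member over a non-empty interval is attained. -/
def FunFamily.AttainsSup (F : FunFamily) (strict : Bool) : Prop :=
  ∀ (f : F.Bi) (I : AffInterval strict) (x : ℝ), (I.toSet x).Nonempty →
    (∃ y, IsArgmaxOn (fun y => F.bi f x y) (I.toSet x) y) ∧
    (∃ y, IsArgmaxOn (fun y => F.bi f y x) (I.toSet x) y)

/-! ### Linear real arithmetic constraints in conjunctive normal form -/

inductive LinRel : Type
  | le | eq

/-- The atom `∑ i, coeff i * X i ⋈ bound`. -/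
structure LinAtom (n : ℕ) where
  coeff : Fin n → ℝ
  rel : LinRel
  bound : ℝ

def LinAtom.Holds {n : ℕ} (A : LinAtom n) (x : Fin n → ℝ) : Prop :=
  match A.rel with
  | .le => ∑ i, A.coeff i * x i ≤ A.bound
  | .eq => ∑ i, A.coeff i * x i = A.bound

/-- An atom or (`positive = false`) a negated atom. -/
structure LinLit (n : ℕ) where
  atom : LinAtom n
  positive : Bool

def LinLit.Holds {n : ℕ} (l : LinLit n) (x : Fin n → ℝ) : Prop :=
  match l.positive with
  | true => l.atom.Holds x
  | false => ¬ l.atom.Holds x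

def LinLit.code {n : ℕ} (l : LinLit n) : Val :=
  .pair (Val.ofBool l.positive)
    (.pair (Val.ofBool (match l.atom.rel with | .le => false | .eq => true))
      (.pair (Val.ofVec l.atom.coeff) (.real l.atom.bound)))

/-- A clause is the disjunction of its literals. -/
abbrev LinClause (n : ℕ) := List (LinLit n)

/-- The variables that appear in a clause. -/
def LinClause.vars {n : ℕ} (C : LinClause n) : Set (Fin n) :=
  {i | ∃ l ∈ C, l.atom.coeff i ≠ 0}

/-! ### Treewidth -/

/-- `G` has a tree decomposition with bags of at most `k + 1` vertices. -/
def TreewidthAtMost {V : Type} (G : SimpleGraph V) (k : ℕ) : Prop :=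
  ∃ (N : Type) (T : SimpleGraph N) (bag : N → Set V),
    Finite N ∧ T.IsTree ∧
    (∀ v, ∃ t, v ∈ bag t) ∧
    (∀ u v, G.Adj u v → ∃ t, u ∈ bag t ∧ v ∈ bag t) ∧
    (∀ v, (T.induce {t | v ∈ bag t}).Preconnected) ∧
    (∀ t, (bag t).encard ≤ k + 1)

/-! ### Constrained MAP problems -/

/-- A constrained MAP problem: a conjunction of at most bivariate clauses, and a density that is the
product of one univariate factor for each variable and of bivariate factors for a set of pairs `i < j`; all
factors are non-negative members of the family. -/
structure MapProblem (F : FunFamily) where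
  n : ℕ
  clauses : List (LinClause n)
  clauses_bivariate : ∀ C ∈ clauses, (LinClause.vars C).encard ≤ 2
  unary : Fin n → F.Uni
  pairs : List ((Fin n × Fin n) × F.Bi)
  pairs_lt : ∀ e ∈ pairs, e.1.1 < e.1.2
  pairs_nodup : (pairs.map Prod.fst).Nodup
  unary_nonneg : ∀ i x, 0 ≤ F.uni (unary i) x
  pairs_nonneg : ∀ e ∈ pairs, ∀ x y, 0 ≤ F.bi e.2 x y

namespace MapProblem

variable {F : FunFamily}

/-- The assignments that satisfy the constraint. -/
def feasible (P : MapProblem F) : Set (Fin P.n → ℝ) :=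
  {x | ∀ C ∈ P.clauses, ∃ l ∈ C, l.Holds x}

/-- The (unnormalised) density. -/
def density (P : MapProblem F) (x : Fin P.n → ℝ) : ℝ :=
  (∏ i, F.uni (P.unary i) (x i)) * (P.pairs.map fun e => F.bi e.2 (x e.1.1) (x e.1.2)).prod

/-- The global graph: variables are adjacent if they share a clause or a bivariate factor. -/
def globalGraph (P : MapProblem F) : SimpleGraph (Fin P.n) :=
  SimpleGraph.fromRel fun i j =>
    (∃ C ∈ P.clauses, i ∈ LinClause.vars C ∧ j ∈ LinClause.vars C) ∨
    (∃ e ∈ P.pairs, e.1 = (i, j))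

/-- Each connected component of the global graph has diameter at most `d`. -/
def DiameterAtMost (P : MapProblem F) (d : ℕ) : Prop :=
  ∀ i j, P.globalGraph.Reachable i j → P.globalGraph.dist i j ≤ d

/-- The constraint has no strict literal (no negated atom). -/
def NonStrict (P : MapProblem F) : Prop :=
  ∀ C ∈ P.clauses, ∀ l ∈ C, l.positive = true

/-- The supremum is finite, and every partial assignment (the values `z` on a set `S` of variables) whose
conditional supremum equals the global supremum extends to a maximiser.  For `S = ∅` this says that the
maximum is attained. -/
def OptimaExtend (P : MapProblem F) : Prop :=
  ∃ s : ℝ, IsLUB (P.density '' P.feasible) s ∧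
    ∀ (S : Set (Fin P.n)) (z : Fin P.n → ℝ),
      IsLUB (P.density '' {x ∈ P.feasible | ∀ i ∈ S, x i = z i}) s →
      ∃ x ∈ P.feasible, (∀ i ∈ S, x i = z i) ∧ P.density x = s

/-- The problem as an input of a machine. -/
def code (P : MapProblem F) : Val :=
  .pair (.real P.n)
    (.pair (Val.ofList (P.clauses.map fun C => Val.ofList (C.map LinLit.code)))
      (.pair (Val.ofList (List.ofFn fun i => F.uniCode (P.unary i)))
        (Val.ofList (P.pairs.map fun e =>
          .pair (.pair (.real ((e.1.1 : ℕ) : ℝ)) (.real ((e.1.2 : ℕ) : ℝ))) (F.biCode e.2)))))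

/-- The output `w` solves `P`: it is `nil` if the constraint is unsatisfiable; otherwise it is a pair of a number
`v`, the supremum of the density under the constraint if this is finite, and of a feasible point. -/
def Solution (P : MapProblem F) (w : Val) : Prop :=
  (P.feasible = ∅ → w = .nil) ∧
  (P.feasible.Nonempty → ∃ (v : ℝ) (x : Fin P.n → ℝ),
    w = .pair (.real v) (Val.ofVec x) ∧
    (∀ s, IsLUB (P.density '' P.feasible) s → v = s) ∧
    x ∈ P.feasible)

/-- The point in the output `w` is an exact maximiser, and the number is the maximum. -/
def ExactSolution (P : MapProblem F) (w : Val) : Prop :=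
  P.feasible.Nonempty → ∃ x : Fin P.n → ℝ,
    w = .pair (.real (P.density x)) (Val.ofVec x) ∧ IsArgmaxOn P.density P.feasible x

end MapProblem

end

/-!
A problem whose global graph is a forest is solved by message passing.  In every round all leaves are eliminated
at once: a leaf `y` with neighbour `x` is replaced by the function `x ↦ sup_y` of the product of everything that
concerns `y`, the supremum being taken over the values of `y` that are feasible for `x`.  A forest of diameter at
most `d` is used up after `d + 2` rounds (`State.act_eq_nil`), and then the value is a product of constants.  The
values of the variables are chosen in the opposite order, each one as a best choice given the value of its
neighbour.  Since the number of rounds does not depend on the problem, it suffices that one round takes polynomial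
time (`PolyTime.stateRound`, `PolyTime.loop`), although its output may be polynomially larger than its input.

*Elimination of one leaf.*  A message is kept as a list of members of the family on intervals, and stands for
the maximum of the members that are active at a point.  The literals and the ends of these intervals give finitely
many lines in the plane of `y` and `x`.  Between the abscissas of their crossings, the lines do
not change their order, so the plane falls into cells, on the lines and between consecutive ones, on each of
which the feasibility and the active members are constant (`Leaf.pieces_sound`, `Leaf.pieces_complete`).  On a
cell the weight is one member of the family, formed by products and pointwise maxima, and the symbolic supremum
applies to it.
When only non-strict bounds are admitted, closed cells are used instead: without negated literals, both
feasibility and activity are inherited by limits (`SignCompat`).  No pointwise maximum of the resulting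
functions is taken here, as they live on different intervals; it is taken locally in the next round.

*Infinite suprema.*  The symbolic supremum is meaningful only where the supremum is a real number.  So the true
messages are functions with values in `[0, ∞]` on a domain of feasible points, and the listed members are
required to represent them only where they are finite (`Msg.Valid`).  This is enough, because a product in
`[0, ∞]` that is finite although one factor is infinite has a factor zero, and that zero is represented exactly
(`ExactApprox.mul`).  Domains are kept apart from values, so that feasibility is decided exactly and the
chosen point is feasible in any case.

*Exactness.*  A round replaces the totals by their suprema over the values of the leaves (`State.total_round`).
The chosen values keep the total if the suprema in the messages are attained at the values chosen before
(`State.assignLeaves_total`).  Under the first hypothesis, all messages are finite and attained, by induction on the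
rounds (`Leaf.message_attained`).  Under the second one, the values chosen so far always form an optimal partial
assignment; it extends to a maximiser, and since the product of the messages is then attained, finite and
non-zero, every single one is attained (`State.messages_attained`).
-/

noncomputable section

/-! ### Typed polynomial-time functions -/

theorem Polynomial.eval_nat_mono (q : ℕ[X]) : Monotone fun n : ℕ => q.eval n := by
  induction q using Polynomial.induction_on' with
  | add p q hp hq =>
    intro a b h
    simpa using add_le_add (hp h) (hq h)
  | monomial n c =>
    intro a b h
    simpa using Nat.mul_le_mul_left c (Nat.pow_le_pow_left h n)

theorem Val.size_pos (v : Val) : 0 < v.size := by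
  cases v <;> simp [Val.size]

theorem Val.size_ofBool (b : Bool) : (Val.ofBool b).size = 1 := by
  cases b <;> rfl

theorem Val.size_fst_le (v : Val) : v.fst.size ≤ v.size := by
  cases v <;> simp [Val.fst, Val.size]; omega

theorem Val.size_snd_le (v : Val) : v.snd.size ≤ v.size := by
  cases v <;> simp [Val.snd, Val.size]; omega

theorem ArithOp.size_apply (o : ArithOp) (v : Val) : (o.apply v).size = 1 := by
  unfold ArithOp.apply
  split <;> first | rfl | exact Val.size_ofBool _

/-- An output is never larger than the time needed to produce it. -/
theorem Runs.size_le {ι : Type} {prim : ι → List ℝ → ℝ} {p : Prog ι} {v w : Val} {t : ℕ}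
    (h : Runs prim p v w t) : w.size ≤ t := by
  induction h with
  | arith o v => exact (ArithOp.size_apply o v).le
  | isPair v => cases v <;> simp [Val.isPair, Val.size_ofBool]
  | prim i v => exact v.size_pos
  | skip | fst | snd => exact le_rfl
  | nil | zero | one => exact le_rfl
  | loopStop _ _ => omega
  | pair | seq | condTrue | condFalse | loopStep => (try simp only [Val.size] at *); omega

/-- An encoding of a type by values.  It need not be injective: objects may carry data that the machine
does not see. -/
class Enc (α : Type) where
  enc : α → Val

open Enc (enc)

/-- The input size of a typed object. -/
def esize {α : Type} [Enc α] (a : α) : ℕ := (enc a).size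

instance : Enc ℝ := ⟨.real⟩
instance : Enc ℕ := ⟨fun n => .real n⟩
instance : Enc Bool := ⟨Val.ofBool⟩
instance {α : Type} [Enc α] : Enc (List α) := ⟨fun l => Val.ofList (l.map enc)⟩
instance {α β : Type} [Enc α] [Enc β] : Enc (α × β) := ⟨fun a => .pair (enc a.1) (enc a.2)⟩

variable {ι : Type}
variable {α β γ δ σ : Type} [Enc α] [Enc β] [Enc γ] [Enc δ] [Enc σ]

theorem esize_pos (a : α) : 0 < esize a := Val.size_pos _
@[simp] theorem esize_real (a : ℝ) : esize a = 1 := rfl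
@[simp] theorem esize_nat (a : ℕ) : esize a = 1 := rfl
@[simp] theorem esize_prod (a : α × β) : esize a = esize a.1 + esize a.2 + 1 := rfl
@[simp] theorem esize_nil : esize ([] : List α) = 1 := rfl
@[simp] theorem esize_cons (a : α) (l : List α) : esize (a :: l) = esize a + esize l + 1 := rfl

theorem esize_append (l m : List α) : esize (l ++ m) + 1 = esize l + esize m := by
  induction l with
  | nil => simp; omega
  | cons a l ih => simp only [List.cons_append, esize_cons]; omega

theorem esize_reverse (l : List α) : esize l.reverse = esize l := by
  induction l with
  | nil => rfl
  | cons a l ih =>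
    have := esize_append l.reverse [a]
    simp only [List.reverse_cons, esize_cons, esize_nil] at *
    omega

theorem length_le_esize (l : List α) : l.length ≤ esize l := by
  induction l with
  | nil => simp
  | cons a l ih => simp; omega

theorem esize_le_of_mem {l : List α} {a : α} (h : a ∈ l) : esize a ≤ esize l := by
  induction l with
  | nil => cases h
  | cons b l ih =>
    rcases List.mem_cons.1 h with rfl | h
    · simp; omega
    · have := ih h; simp; omega

theorem esize_le_of_forall {l : List α} {B : ℕ} (h : ∀ a ∈ l, esize a ≤ B) :
    esize l ≤ l.length * (B + 1) + 1 := by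
  induction l with
  | nil => simp
  | cons b l ih =>
    have := ih fun a ha => h a (by simp [ha])
    have := h b (by simp)
    simp only [esize_cons, List.length_cons, Nat.add_mul, one_mul]
    omega

theorem esize_append_right_le (l m : List α) : esize m ≤ esize (l ++ m) := by
  have := esize_append l m
  have := esize_pos l
  omega

theorem esize_le_of_prefix {l m : List α} (h : l <+: m) : esize l ≤ esize m := by
  obtain ⟨k, rfl⟩ := h
  have := esize_append l k
  have := esize_pos k
  omega

/-- The basic functions of a machine. -/
structure Machine (ι : Type) where
  prim : ι → List ℝ → ℝ

variable {M : Machine ι}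

/-- `f` is computed on encodings by a program in polynomial time. -/
@[fun_prop]
def PolyTime (M : Machine ι) (f : α → β) : Prop :=
  ∃ (p : Prog ι) (q : ℕ[X]), ∀ a, ∃ t, Runs M.prim p (enc a) (enc (f a)) t ∧ t ≤ q.eval (esize a)

/-- Constants that a program can write down. -/
class Literal (M : Machine ι) (c : β) : Prop where
  out : ∃ (p : Prog ι) (t : ℕ), ∀ v, Runs M.prim p v (enc c) t

namespace PolyTime

theorem esize_le {f : α → β} (hf : PolyTime M f) : ∃ q : ℕ[X], ∀ a, esize (f a) ≤ q.eval (esize a) := by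
  obtain ⟨p, q, h⟩ := hf
  refine ⟨q, fun a => ?_⟩
  obtain ⟨t, ht, htq⟩ := h a
  exact ht.size_le.trans htq

/-- Functions that do not change the encoding cost nothing but a copy. -/
theorem of_enc_eq {f : α → β} (h : ∀ a, enc (f a) = enc a) : PolyTime M f :=
  ⟨.skip, X, fun a => ⟨_, by rw [h]; exact Runs.skip _, by simp [esize]⟩⟩

@[fun_prop]
theorem id' : PolyTime M fun a : α => a := of_enc_eq fun _ => rfl

@[fun_prop]
theorem const (c : β) [h : Literal M c] : PolyTime M fun _ : α => c := by
  obtain ⟨p, t, h⟩ := h.out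
  exact ⟨p, C t, fun a => ⟨t, h _, by simp⟩⟩

@[fun_prop]
theorem comp {g : β → γ} {f : α → β} (hg : PolyTime M g) (hf : PolyTime M f) :
    PolyTime M fun a => g (f a) := by
  obtain ⟨p, q, hp⟩ := hf
  obtain ⟨p', q', hp'⟩ := hg
  refine ⟨.seq p p', q + q'.comp q + 1, fun a => ?_⟩
  obtain ⟨t, ht, htq⟩ := hp a
  obtain ⟨t', ht', htq'⟩ := hp' (f a)
  refine ⟨_, ht.seq ht', ?_⟩
  have := q'.eval_nat_mono (ht.size_le.trans htq)
  simp only [eval_add, eval_comp, eval_one]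
  simp only [esize] at *
  omega

@[fun_prop]
theorem prodMk {f : α → β} {g : α → γ} (hf : PolyTime M f) (hg : PolyTime M g) :
    PolyTime M fun a => (f a, g a) := by
  obtain ⟨p, q, hp⟩ := hf
  obtain ⟨p', q', hp'⟩ := hg
  refine ⟨.pair p p', q + q' + 1, fun a => ?_⟩
  obtain ⟨t, ht, htq⟩ := hp a
  obtain ⟨t', ht', htq'⟩ := hp' a
  exact ⟨_, ht.pair ht', by simp only [eval_add, eval_one]; omega⟩

@[fun_prop]
theorem prodFst {f : α → β × γ} (hf : PolyTime M f) : PolyTime M fun a => (f a).1 :=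
  comp (g := Prod.fst)
    ⟨.fst, X, fun a => ⟨_, Runs.fst _, by rw [eval_X]; exact Val.size_fst_le (enc a)⟩⟩ hf

@[fun_prop]
theorem prodSnd {f : α → β × γ} (hf : PolyTime M f) : PolyTime M fun a => (f a).2 :=
  comp (g := Prod.snd)
    ⟨.snd, X, fun a => ⟨_, Runs.snd _, by rw [eval_X]; exact Val.size_snd_le (enc a)⟩⟩ hf

@[fun_prop]
theorem boolCond {c : α → Bool} {f g : α → β} (hc : PolyTime M c) (hf : PolyTime M f)
    (hg : PolyTime M g) : PolyTime M fun a => bif c a then f a else g a := by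
  obtain ⟨p, q, hp⟩ := hc
  obtain ⟨p₁, q₁, hp₁⟩ := hf
  obtain ⟨p₂, q₂, hp₂⟩ := hg
  refine ⟨.cond p p₁ p₂, q + q₁ + q₂ + 1, fun a => ?_⟩
  obtain ⟨t, ht, htq⟩ := hp a
  obtain ⟨t₁, ht₁, htq₁⟩ := hp₁ a
  obtain ⟨t₂, ht₂, htq₂⟩ := hp₂ a
  simp only [eval_add, eval_one]
  cases h : c a
  · rw [h] at ht
    exact ⟨_, Runs.condFalse ht ht₂, by omega⟩
  · rw [h] at ht
    exact ⟨_, Runs.condTrue ht (by simp [enc, Val.ofBool]) ht₁, by omega⟩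

/-- Case distinction on the shape of a value: `g` sees the context and the value when it is a pair. -/
theorem pairCases {f : α → β} {g : α × σ → β} {l : α → δ} {r : α → β} (hl : PolyTime M l)
    (hf : PolyTime M f) (hg : PolyTime M g)
    (h : ∀ a, (Val.isPair (enc (l a)) = .nil ∧ enc (r a) = enc (f a)) ∨
      (Val.isPair (enc (l a)) ≠ .nil ∧ ∃ s : σ, enc (l a) = enc s ∧ enc (r a) = enc (g (a, s)))) :
    PolyTime M r := by
  obtain ⟨p, q, hp⟩ := hl
  obtain ⟨p₁, q₁, hp₁⟩ := hf
  obtain ⟨p₂, q₂, hp₂⟩ := hg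
  refine ⟨.cond (.seq p .isPair) (.seq (.pair .skip p) p₂) p₁,
    q + 2 + q₁ + (X + q + 1 + q₂.comp (X + q + 1)) + 2, fun a => ?_⟩
  obtain ⟨t, ht, htq⟩ := hp a
  obtain ⟨t₁, ht₁, htq₁⟩ := hp₁ a
  have hc := ht.seq (Runs.isPair _)
  simp only [eval_add, eval_one, eval_comp, eval_X, eval_ofNat]
  rcases h a with ⟨h1, h2⟩ | ⟨h1, s, h2, h3⟩
  · rw [h1] at hc
    rw [h2]
    exact ⟨_, Runs.condFalse hc ht₁, by omega⟩
  · obtain ⟨t₂, ht₂, htq₂⟩ := hp₂ (a, s)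
    rw [h3]
    have hr := ((Runs.skip (enc a)).pair ht).seq (show Runs M.prim p₂ (.pair (enc a) (enc (l a))) _ t₂ by
      rw [h2]; exact ht₂)
    refine ⟨_, Runs.condTrue hc h1 hr, ?_⟩
    have h4 : esize (a, s) ≤ esize a + q.eval (esize a) + 1 := by
      have := ht.size_le
      rw [h2] at this
      simp only [esize_prod]
      simp only [esize] at *
      omega
    have := q₂.eval_nat_mono h4
    simp only [esize] at *
    omega

@[fun_prop]
theorem listCons {f : α → β} {l : α → List β} (hf : PolyTime M f) (hl : PolyTime M l) :
    PolyTime M fun a => f a :: l a :=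
  comp (g := fun x : β × List β => x.1 :: x.2) (of_enc_eq fun _ => rfl) (prodMk hf hl)

theorem listCases {l : α → List β} {f : α → γ} {g : α → β → List β → γ}
    (hl : PolyTime M l) (hf : PolyTime M f)
    (hg : PolyTime M fun p : α × (β × List β) => g p.1 p.2.1 p.2.2) :
    PolyTime M fun a => match l a with | [] => f a | b :: t => g a b t := by
  refine pairCases hl hf hg fun a => ?_
  cases h : l a with
  | nil => exact .inl ⟨rfl, rfl⟩
  | cons b t => exact .inr ⟨by simp [enc, Val.ofList, Val.isPair, Val.ofBool], (b, t), rfl, rfl⟩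

/-- The cost of a loop whose states stay below the size `B`. -/
theorem runs_loop {c : σ → Bool} {f : σ → σ} {pc pf : Prog ι} {qc qf : ℕ[X]}
    (hc : ∀ s, ∃ t, Runs M.prim pc (enc s) (enc (c s)) t ∧ t ≤ qc.eval (esize s))
    (hf : ∀ s, ∃ t, Runs M.prim pf (enc s) (enc (f s)) t ∧ t ≤ qf.eval (esize s)) (B : ℕ) :
    ∀ k s, (∀ j < k, c (f^[j] s) = true) → c (f^[k] s) = false →
      (∀ j ≤ k, esize (f^[j] s) ≤ B) →
      ∃ t, Runs M.prim (.loop pc pf) (enc s) (enc (f^[k] s)) t ∧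
        t ≤ (k + 1) * (qc.eval B + qf.eval B + B + 1) := by
  intro k
  induction k with
  | zero =>
    intro s _ h2 h3
    obtain ⟨t, ht, htq⟩ := hc s
    rw [Function.iterate_zero, id] at h2 ⊢
    rw [h2] at ht
    have hs : esize s ≤ B := h3 0 le_rfl
    refine ⟨_, Runs.loopStop ht, ?_⟩
    have := qc.eval_nat_mono hs
    simp only [esize] at *
    omega
  | succ k ih =>
    intro s h1 h2 h3
    obtain ⟨t, ht, htq⟩ := hc s
    obtain ⟨t', ht', htq'⟩ := hf s
    have hs : esize s ≤ B := h3 0 (Nat.zero_le _)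
    have hcs : c s = true := h1 0 (Nat.succ_pos _)
    obtain ⟨r, hr, hrq⟩ := ih (f s) (fun j hj => h1 (j + 1) (by omega)) h2
      (fun j hj => h3 (j + 1) (by omega))
    rw [hcs] at ht
    refine ⟨_, Runs.loopStep ht (by simp [enc, Val.ofBool]) ht' hr, ?_⟩
    have := qc.eval_nat_mono hs
    have := qf.eval_nat_mono hs
    rw [Nat.add_mul (k + 1) 1]
    simp only at *
    omega

/-- Iteration until `c` fails takes polynomial time if the number of iterations is bounded by a constant;
the sizes of the states may grow by a polynomial in every iteration. -/
theorem loop {c : σ → Bool} {f : σ → σ} (hc : PolyTime M c) (hf : PolyTime M f) :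
    ∃ p : Prog ι, ∀ K : ℕ, ∃ q : ℕ[X], ∀ (s : σ) (k : ℕ), k ≤ K →
      (∀ j < k, c (f^[j] s) = true) → c (f^[k] s) = false →
      ∃ t, Runs M.prim p (enc s) (enc (f^[k] s)) t ∧ t ≤ q.eval (esize s) := by
  obtain ⟨pc, qc, hc⟩ := hc
  obtain ⟨pf, qf, hf⟩ := hf
  refine ⟨.loop pc pf, fun K => ?_⟩
  have key : ∀ K : ℕ, ∃ Q : ℕ[X], ∀ s : σ, ∀ j ≤ K, esize (f^[j] s) ≤ Q.eval (esize s) := by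
    intro K
    induction K with
    | zero => exact ⟨X, fun s j hj => by obtain rfl : j = 0 := by omega
                                         simp⟩
    | succ K ih =>
      obtain ⟨Q, hQ⟩ := ih
      refine ⟨Q + qf.comp Q, fun s j hj => ?_⟩
      simp only [eval_add, eval_comp]
      rcases Nat.lt_or_ge j (K + 1) with h | h
      · have := hQ s j (by omega)
        omega
      · obtain rfl : j = K + 1 := by omega
        rw [Function.iterate_succ_apply']
        obtain ⟨t, ht, htq⟩ := hf (f^[K] s)
        have h1 := ht.size_le
        have h2 := qf.eval_nat_mono (hQ s K le_rfl)
        simp only [esize] at *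
        omega
  obtain ⟨Q, hQ⟩ := key K
  refine ⟨((K + 1 : ℕ) : ℕ[X]) * (qc.comp Q + qf.comp Q + Q + 1), fun s k hk h1 h2 => ?_⟩
  obtain ⟨t, ht, htq⟩ := runs_loop hc hf (Q.eval (esize s)) k s h1 h2
    (fun j hj => hQ s j (hj.trans hk))
  refine ⟨t, ht, htq.trans ?_⟩
  simp only [eval_add, eval_comp, eval_mul, eval_one, eval_natCast]
  exact Nat.mul_le_mul_right _ (by push_cast; omega)

/-- Folds take polynomial time if the size of the accumulator is bounded by a polynomial. -/
theorem foldl {l : α → List β} {i : α → γ} {g : α → γ → β → γ} (hl : PolyTime M l)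
    (hi : PolyTime M i) (hg : PolyTime M fun p : (α × γ) × β => g p.1.1 p.1.2 p.2)
    (B : ℕ[X]) (hB : ∀ a l', l' <+: l a → esize (l'.foldl (g a) (i a)) ≤ B.eval (esize a)) :
    PolyTime M fun a => (l a).foldl (g a) (i a) := by
  let c : (α × List β) × γ → Bool := fun s => match s.1.2 with | [] => false | _ :: _ => true
  let f : (α × List β) × γ → (α × List β) × γ := fun s =>
    match s.1.2 with
    | [] => s
    | b :: t => ((s.1.1, t), g s.1.1 s.2 b)
  have hc : PolyTime M c :=
    pairCases (l := fun s : (α × List β) × γ => s.1.2) (f := fun _ => false)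
      (g := fun _ : ((α × List β) × γ) × (β × List β) => true) (by fun_prop)
      ⟨.nil, 1, fun a => ⟨_, Runs.nil _, by simp⟩⟩
      ⟨.one, 1, fun a => ⟨_, Runs.one _, by simp⟩⟩ fun s => by
        rcases s with ⟨⟨a, _ | ⟨b, t⟩⟩, e⟩
        · exact .inl ⟨rfl, rfl⟩
        · exact .inr ⟨by simp [enc, Val.ofList, Val.isPair, Val.ofBool], (b, t), rfl, rfl⟩
  have hf : PolyTime M f := by
    refine listCases (l := fun s : (α × List β) × γ => s.1.2) (f := fun s => s)
      (g := fun s b t => ((s.1.1, t), g s.1.1 s.2 b)) (by fun_prop) (by fun_prop) ?_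
    refine prodMk (by fun_prop) ?_
    exact comp hg (f := fun p : ((α × List β) × γ) × (β × List β) => ((p.1.1.1, p.1.2), p.2.1))
      (by fun_prop)
  obtain ⟨pc, qc, hc⟩ := hc
  obtain ⟨pf, qf, hf⟩ := hf
  have hinit : PolyTime M fun a => ((a, l a), i a) := by fun_prop
  obtain ⟨ql, hql⟩ := hl.esize_le
  have hloop : ∃ (p : Prog ι) (q : ℕ[X]), ∀ a, ∃ s : (α × List β) × γ, ∃ t,
      s.2 = (l a).foldl (g a) (i a) ∧
      Runs M.prim p (enc ((a, l a), i a)) (enc s) t ∧ t ≤ q.eval (esize a) := by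
    have hit : ∀ (a : α) (l₁ l₂ : List β) (e : γ),
        f^[l₁.length] ((a, l₁ ++ l₂), e) = ((a, l₂), l₁.foldl (g a) e) := by
      intro a l₁ l₂
      induction l₁ with
      | nil => intro e; rfl
      | cons b t ih => intro e; rw [List.length_cons, Function.iterate_succ_apply]; exact ih _
    have hit' : ∀ (a : α) (j : ℕ), j ≤ (l a).length →
        f^[j] ((a, l a), i a) = ((a, (l a).drop j), ((l a).take j).foldl (g a) (i a)) := by
      intro a j hj
      have := hit a ((l a).take j) ((l a).drop j) (i a)
      rwa [List.take_append_drop, List.length_take, min_eq_left hj] at this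
    refine ⟨.loop pc pf, (ql + 1) * (qc.comp (X + ql + B + 2) + qf.comp (X + ql + B + 2) +
      (X + ql + B + 2) + 1), fun a => ?_⟩
    have hend := hit' a (l a).length le_rfl
    simp only [List.drop_length, List.take_length] at hend
    have hsize : ∀ j ≤ (l a).length,
        esize (f^[j] ((a, l a), i a)) ≤ (X + ql + B + 2 : ℕ[X]).eval (esize a) := by
      intro j hj
      rw [hit' a j hj]
      have h1 := hB a ((l a).take j) (List.take_prefix _ _)
      have h2 : esize ((l a).drop j) ≤ esize (l a) := by
        conv_rhs => rw [← List.take_append_drop j (l a)]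
        exact esize_append_right_le _ _
      have h3 := hql a
      simp only [esize_prod, eval_add, eval_X, eval_ofNat]
      omega
    have hcond : ∀ j < (l a).length, c (f^[j] ((a, l a), i a)) = true := by
      intro j hj
      rw [hit' a j hj.le, List.drop_eq_getElem_cons hj]
    obtain ⟨t, ht, htq⟩ := runs_loop hc hf _ (l a).length _ hcond (by rw [hend]) hsize
    refine ⟨_, t, ?_, ht, htq.trans ?_⟩
    · rw [hend]
    · simp only [eval_add, eval_comp, eval_mul, eval_one, eval_X, eval_ofNat]
      exact Nat.mul_le_mul_right _ (by have := length_le_esize (l a); have := hql a; omega)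
  obtain ⟨p₁, q₁, h₁⟩ := hinit
  obtain ⟨p₂, q₂, h₂⟩ := hloop
  refine ⟨.seq p₁ (.seq p₂ .snd), q₁ + (q₂ + q₂ + 1) + 1, fun a => ?_⟩
  obtain ⟨t₁, ht₁, htq₁⟩ := h₁ a
  obtain ⟨s, t₂, hs, ht₂, htq₂⟩ := h₂ a
  beta_reduce
  rw [← hs]
  refine ⟨_, ht₁.seq (ht₂.seq (Runs.snd (enc s))), ?_⟩
  have h3 := (Val.size_snd_le (enc s)).trans ht₂.size_le
  simp only [eval_add, eval_one]
  omega

@[fun_prop]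
theorem listReverse {l : α → List β} (hl : PolyTime M l) :
    PolyTime M fun a => (l a).reverse := by
  refine comp (g := fun l : List β => l.reverse) ?_ hl
  have h : (fun l : List β => l.reverse) = fun l => l.foldl (fun acc b => b :: acc) [] := by
    funext l; simp
  rw [h]
  refine foldl (i := fun _ => []) (g := fun _ acc b => b :: acc) id'
    ⟨.nil, 1, fun a => ⟨_, Runs.nil _, by simp⟩⟩ (by fun_prop) X fun l l' h' => ?_
  have : l'.foldl (fun acc b => b :: acc) [] = l'.reverse := by
    simp
  rw [this, esize_reverse, eval_X]
  exact esize_le_of_prefix h'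

@[fun_prop]
theorem listAppend {l m : α → List β} (hl : PolyTime M l) (hm : PolyTime M m) :
    PolyTime M fun a => l a ++ m a := by
  have h0 : ∀ l m : List β, l.foldl (fun acc b => b :: acc) m = l.reverse ++ m := by
    intro l m; simp
  obtain ⟨ql, hql⟩ := hl.esize_le
  obtain ⟨qm, hqm⟩ := hm.esize_le
  have h := foldl (l := fun a => (l a).reverse) (i := m) (g := fun _ acc b => b :: acc)
    (M := M) (by fun_prop) hm (by fun_prop) (ql + qm) fun a l' h' => by
      have h1 := esize_le_of_prefix h'
      have h2 := esize_append l'.reverse (m a)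
      rw [esize_reverse] at h1 h2
      have := hql a
      have := hqm a
      rw [h0, eval_add]
      omega
  simpa [h0] using h

@[fun_prop]
theorem listMap {l : α → List β} {g : α → β → γ} (hl : PolyTime M l)
    (hg : PolyTime M fun p : α × β => g p.1 p.2) : PolyTime M fun a => (l a).map (g a) := by
  have h0 : ∀ (a : α) (l : List β),
      l.foldl (fun acc b => g a b :: acc) [] = (l.map (g a)).reverse := by
    intro a l
    rw [← List.foldl_map (f := g a) (g := fun acc c => c :: acc)]
    simp
  obtain ⟨ql, hql⟩ := hl.esize_le
  obtain ⟨qg, hqg⟩ := hg.esize_le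
  have h := foldl (l := fun a => l a) (i := fun _ => []) (g := fun a acc b => g a b :: acc)
    (M := M) hl ⟨.nil, 1, fun a => ⟨_, Runs.nil _, by simp⟩⟩
    (listCons (comp hg (f := fun p : (α × List γ) × β => (p.1.1, p.2)) (by fun_prop)) (by fun_prop))
    (ql * (qg.comp (X + ql + 1) + 1) + 1) fun a l' h' => by
      rw [h0, esize_reverse]
      refine (esize_le_of_forall (B := qg.eval (esize a + ql.eval (esize a) + 1)) ?_).trans ?_
      · intro c hc
        obtain ⟨b, hb, rfl⟩ := List.mem_map.1 hc
        refine (hqg (a, b)).trans (qg.eval_nat_mono ?_)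
        have := esize_le_of_mem (h'.subset hb)
        have := hql a
        simp only [esize_prod]
        omega
      · simp only [eval_add, eval_mul, eval_comp, eval_one, eval_X, List.length_map]
        refine Nat.add_le_add_right (Nat.mul_le_mul_right _ ?_) _
        exact h'.length_le.trans ((length_le_esize _).trans (hql a))
  have h2 := listReverse h
  simpa [h0] using h2

@[fun_prop]
theorem listFlatten {l : α → List (List β)} (hl : PolyTime M l) :
    PolyTime M fun a => (l a).flatten := by
  refine comp (g := fun l : List (List β) => l.flatten) ?_ hl
  have h0 : ∀ (l : List (List β)) (m : List β), l.foldl (fun acc b => acc ++ b) m = m ++ l.flatten := by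
    intro l
    induction l with
    | nil => simp
    | cons b l ih => intro m; simp [ih]
  have h1 : ∀ l : List (List β), esize l.flatten ≤ esize l := by
    intro l
    induction l with
    | nil => simp
    | cons b l ih =>
      have := esize_append b l.flatten
      simp only [List.flatten_cons, esize_cons]
      omega
  have h := foldl (l := fun l : List (List β) => l) (i := fun _ => [])
    (g := fun _ acc b => acc ++ b) (M := M) id'
    ⟨.nil, 1, fun a => ⟨_, Runs.nil _, by simp⟩⟩ (by fun_prop) X fun l l' h' => by
      rw [h0, List.nil_append, eval_X]
      exact (h1 l').trans (esize_le_of_prefix h')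
  simpa [h0] using h

@[fun_prop]
theorem listFlatMap {l : α → List β} {g : α → β → List γ} (hl : PolyTime M l)
    (hg : PolyTime M fun p : α × β => g p.1 p.2) :
    PolyTime M fun a => (l a).flatMap (g a) := by
  simp only [List.flatMap_def]
  exact listFlatten (listMap hl hg)

end PolyTime

/-! ### Arithmetic, Boolean and list operations -/

instance : Literal M (0 : ℝ) := ⟨.zero, 1, fun v => Runs.zero v⟩
instance : Literal M (1 : ℝ) := ⟨.one, 1, fun v => Runs.one v⟩
instance : Literal M (0 : ℕ) := ⟨.zero, 1, fun v => by
  simpa [enc] using Runs.zero (prim := M.prim) v⟩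
instance : Literal M ([] : List α) := ⟨.nil, 1, fun v => Runs.nil v⟩
instance (b : Bool) : Literal M b := by
  cases b
  exacts [⟨.nil, 1, fun v => Runs.nil v⟩, ⟨.one, 1, fun v => Runs.one v⟩]

/-- The test `a ≤ b` on reals. -/
def leB (a b : ℝ) : Bool := by classical exact decide (a ≤ b)
/-- The test `a < b` on reals. -/
def ltB (a b : ℝ) : Bool := !leB b a
/-- The test `a = b` on reals. -/
def eqB (a b : ℝ) : Bool := leB a b && leB b a
/-- The test `a = b` on naturals, which the machine sees as reals. -/
def eqN (a b : ℕ) : Bool := eqB a b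
/-- The test `a < b` on naturals, which the machine sees as reals. -/
def ltN (a b : ℕ) : Bool := ltB a b

@[simp] theorem leB_iff (a b : ℝ) : leB a b = true ↔ a ≤ b := by simp [leB]
@[simp] theorem ltB_iff (a b : ℝ) : ltB a b = true ↔ a < b := by simp [ltB, leB]
@[simp] theorem eqB_iff (a b : ℝ) : eqB a b = true ↔ a = b := by rw [eqB, Bool.and_eq_true, leB_iff, leB_iff, le_antisymm_iff]
@[simp] theorem eqN_iff (a b : ℕ) : eqN a b = true ↔ a = b := by simp [eqN]
@[simp] theorem ltN_iff (a b : ℕ) : ltN a b = true ↔ a < b := by simp [ltN]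

namespace PolyTime

theorem arith {f g : α → ℝ} (o : ArithOp) {h : α → β} (hf : PolyTime M f) (hg : PolyTime M g)
    (ho : ∀ a, o.apply (.pair (.real (f a)) (.real (g a))) = enc (h a)) : PolyTime M h := by
  obtain ⟨p, q, hp⟩ := prodMk hf hg
  refine ⟨.seq p (.arith o), q + 2, fun a => ?_⟩
  obtain ⟨t, ht, htq⟩ := hp a
  rw [← ho]
  exact ⟨_, ht.seq (Runs.arith o _), by simp only [eval_add, eval_ofNat]; omega⟩

@[fun_prop]
theorem realAdd {f g : α → ℝ} (hf : PolyTime M f) (hg : PolyTime M g) :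
    PolyTime M fun a => f a + g a := arith .add hf hg fun _ => rfl

@[fun_prop]
theorem realSub {f g : α → ℝ} (hf : PolyTime M f) (hg : PolyTime M g) :
    PolyTime M fun a => f a - g a := arith .sub hf hg fun _ => rfl

@[fun_prop]
theorem realMul {f g : α → ℝ} (hf : PolyTime M f) (hg : PolyTime M g) :
    PolyTime M fun a => f a * g a := arith .mul hf hg fun _ => rfl

@[fun_prop]
theorem realDiv {f g : α → ℝ} (hf : PolyTime M f) (hg : PolyTime M g) :
    PolyTime M fun a => f a / g a := arith .div hf hg fun _ => rfl

@[fun_prop]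
theorem realNeg {f : α → ℝ} (hf : PolyTime M f) : PolyTime M fun a => -f a := by
  simpa using realSub (f := fun _ => 0) (by fun_prop) hf

@[fun_prop]
theorem realLe {f g : α → ℝ} (hf : PolyTime M f) (hg : PolyTime M g) :
    PolyTime M fun a => leB (f a) (g a) := arith .le hf hg fun _ => rfl

@[fun_prop]
theorem natCast {f : α → ℕ} (hf : PolyTime M f) : PolyTime M fun a => (f a : ℝ) :=
  comp (g := fun n : ℕ => (n : ℝ)) (of_enc_eq fun _ => rfl) hf

@[fun_prop]
theorem natSucc {f : α → ℕ} (hf : PolyTime M f) : PolyTime M fun a => f a + 1 :=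
  arith .add (f := fun a => (f a : ℝ)) (g := fun _ => 1) (by fun_prop) (by fun_prop) fun _ => by
    simp [ArithOp.apply, enc]

@[fun_prop]
theorem boolNot {f : α → Bool} (hf : PolyTime M f) : PolyTime M fun a => !(f a) := by
  have := boolCond (f := fun _ => false) (g := fun _ => true) hf (by fun_prop) (by fun_prop)
  simpa using this

@[fun_prop]
theorem boolAnd {f g : α → Bool} (hf : PolyTime M f) (hg : PolyTime M g) :
    PolyTime M fun a => (f a && g a) := by
  have := boolCond (f := g) (g := fun _ => false) hf hg (by fun_prop)
  simpa using this

@[fun_prop]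
theorem boolOr {f g : α → Bool} (hf : PolyTime M f) (hg : PolyTime M g) :
    PolyTime M fun a => (f a || g a) := by
  have := boolCond (f := fun _ => true) (g := g) hf (by fun_prop) hg
  simpa using this

@[fun_prop]
theorem realLt {f g : α → ℝ} (hf : PolyTime M f) (hg : PolyTime M g) :
    PolyTime M fun a => ltB (f a) (g a) := by unfold ltB; fun_prop

@[fun_prop]
theorem realEq {f g : α → ℝ} (hf : PolyTime M f) (hg : PolyTime M g) :
    PolyTime M fun a => eqB (f a) (g a) := by unfold eqB; fun_prop

@[fun_prop]
theorem natLt {f g : α → ℕ} (hf : PolyTime M f) (hg : PolyTime M g) :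
    PolyTime M fun a => ltN (f a) (g a) := by unfold ltN; fun_prop

@[fun_prop]
theorem natEq {f g : α → ℕ} (hf : PolyTime M f) (hg : PolyTime M g) :
    PolyTime M fun a => eqN (f a) (g a) := by unfold eqN; fun_prop

@[fun_prop]
theorem listFilter {l : α → List β} {p : α → β → Bool} (hl : PolyTime M l)
    (hp : PolyTime M fun x : α × β => p x.1 x.2) : PolyTime M fun a => (l a).filter (p a) := by
  have h : ∀ a, (l a).filter (p a) = (l a).flatMap fun b => bif p a b then [b] else [] := by
    intro a
    induction l a with
    | nil => rfl
    | cons b t ih => cases h : p a b <;> simp [h, ih]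
  simp only [h]
  fun_prop

@[fun_prop]
theorem listIsEmpty {l : α → List β} (hl : PolyTime M l) : PolyTime M fun a => (l a).isEmpty :=
  listCases (f := fun _ => true) (g := fun _ _ _ => false) hl (by fun_prop) (by fun_prop)

@[fun_prop]
theorem listAny {l : α → List β} {p : α → β → Bool} (hl : PolyTime M l)
    (hp : PolyTime M fun x : α × β => p x.1 x.2) : PolyTime M fun a => (l a).any (p a) := by
  have h : ∀ a, (l a).any (p a) = !((l a).filter (p a)).isEmpty := by
    intro a
    rw [Bool.eq_iff_iff]
    simp
  simp only [h]
  fun_prop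

@[fun_prop]
theorem listAll {l : α → List β} {p : α → β → Bool} (hl : PolyTime M l)
    (hp : PolyTime M fun x : α × β => p x.1 x.2) : PolyTime M fun a => (l a).all (p a) := by
  have h : ∀ a, (l a).all (p a) = !(l a).any fun b => !p a b := by
    intro a
    rw [Bool.eq_iff_iff]
    simp
  simp only [h]
  fun_prop

@[fun_prop]
theorem listHeadD {l : α → List β} {d : α → β} (hl : PolyTime M l) (hd : PolyTime M d) :
    PolyTime M fun a => (l a).headD (d a) := by
  have h : ∀ a, (l a).headD (d a) = match l a with | [] => d a | b :: _ => b := by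
    intro a
    cases l a <;> rfl
  simp only [h]
  exact listCases (g := fun _ b _ => b) hl hd (by fun_prop)

/-- Folds whose accumulator has a bounded size. -/
theorem foldlConst {l : α → List β} {i : α → γ} {g : α → γ → β → γ} (hl : PolyTime M l)
    (hi : PolyTime M i) (hg : PolyTime M fun p : (α × γ) × β => g p.1.1 p.1.2 p.2)
    (B : ℕ) (hB : ∀ c : γ, esize c ≤ B) : PolyTime M fun a => (l a).foldl (g a) (i a) :=
  foldl hl hi hg (C B) fun _ _ _ => by simpa using hB _

@[fun_prop]
theorem listProd {l : α → List ℝ} (hl : PolyTime M l) : PolyTime M fun a => (l a).prod := by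
  simp only [List.prod_eq_foldl]
  exact foldlConst (i := fun _ => (1 : ℝ)) (g := fun _ a b => a * b) hl (by fun_prop) (by fun_prop) 1
    fun _ => le_rfl

end PolyTime

/-- The coefficient with number `k` of a vector, `0` beyond its length. -/
def coef (l : List ℝ) (k : ℕ) : ℝ := l.getD k 0

@[fun_prop]
theorem PolyTime.coef {l : α → List ℝ} {k : α → ℕ} (hl : PolyTime M l) (hk : PolyTime M k) :
    PolyTime M fun a => coef (l a) (k a) := by
  have h : ∀ (l : List ℝ) (c k : ℕ) (r : ℝ),
      l.foldl (fun (s : ℕ × ℝ) b => (s.1 + 1, bif eqN s.1 k then b else s.2)) (c, r) =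
        (c + l.length, if c ≤ k ∧ k < c + l.length then l.getD (k - c) 0 else r) := by
    intro l
    induction l with
    | nil => intro c k r; simp
    | cons b l ih =>
      intro c k r
      rw [List.foldl_cons, ih, List.length_cons]
      refine Prod.ext (by simp only; omega) ?_
      rcases lt_trichotomy c k with h | rfl | h
      · have h1 : k - c = (k - (c + 1)) + 1 := by omega
        have h2 : eqN c k = false := by rw [← Bool.not_eq_true, eqN_iff]; omega
        by_cases h3 : k < c + (l.length + 1)
        · rw [if_pos (by omega), if_pos (by omega), h1, List.getD_cons_succ]
        · rw [if_neg (by omega), if_neg (by omega)]; simp [h2]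
      · have h2 : eqN c c = true := by rw [eqN_iff]
        rw [if_neg (by omega), if_pos (by omega)]
        simp [h2]
      · have h2 : eqN c k = false := by rw [← Bool.not_eq_true, eqN_iff]; omega
        rw [if_neg (by omega), if_neg (by omega)]
        simp [h2]
  have h' : ∀ a, _root_.coef (l a) (k a) = ((l a).foldl
      (fun (s : ℕ × ℝ) b => (s.1 + 1, bif eqN s.1 (k a) then b else s.2)) (0, 0)).2 := by
    intro a
    rw [h]
    by_cases h1 : k a < (l a).length
    · simp [h1, _root_.coef]
    · rw [if_neg (by omega), _root_.coef, List.getD_eq_default _ _ (by omega)]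
  simp only [h']
  refine prodSnd (foldlConst (i := fun _ => ((0 : ℕ), (0 : ℝ)))
    (g := fun a (s : ℕ × ℝ) b => (s.1 + 1, bif eqN s.1 (k a) then b else s.2)) hl (by fun_prop)
    (by fun_prop) 3 fun c => by simp)

@[fun_prop]
theorem PolyTime.listIndices {l : α → List β} (hl : PolyTime M l) :
    PolyTime M fun a => List.range (l a).length := by
  have h : ∀ l : List β, l.foldl (fun (s : ℕ × List ℕ) _ => (s.1 + 1, s.1 :: s.2)) (0, []) =
      (l.length, (List.range l.length).reverse) := by
    intro l
    induction l using List.reverseRecOn with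
    | nil => rfl
    | append_singleton l b ih =>
      rw [List.foldl_append, ih]
      simp [List.range_succ]
  have h' : ∀ a, List.range (l a).length = ((l a).foldl
      (fun (s : ℕ × List ℕ) _ => (s.1 + 1, s.1 :: s.2)) (0, [])).2.reverse := by
    intro a
    simp [h]
  simp only [h']
  obtain ⟨q, hq⟩ := hl.esize_le
  refine listReverse (prodSnd (foldl (i := fun _ => ((0 : ℕ), ([] : List ℕ)))
    (g := fun _ (s : ℕ × List ℕ) _ => (s.1 + 1, s.1 :: s.2)) hl (by fun_prop)
    (by fun_prop) (q * 2 + 3) fun a l' hl' => ?_))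
  rw [h]
  simp only [esize_prod, esize_nat, esize_reverse, eval_add, eval_mul, eval_ofNat]
  have h1 := esize_le_of_forall (l := List.range l'.length) (B := 1) fun _ _ => le_rfl
  have h2 := hl'.length_le.trans ((length_le_esize _).trans (hq a))
  rw [List.length_range] at h1
  omega

/-- The value of the variable `k` in a list of assignments, `0` if there is none. -/
def lookupVar (k : ℕ) (l : List (ℕ × ℝ)) : ℝ := ((l.filter fun p => eqN p.1 k).map Prod.snd).headD 0

@[fun_prop]
theorem PolyTime.lookupVar {k : α → ℕ} {l : α → List (ℕ × ℝ)} (hk : PolyTime M k)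
    (hl : PolyTime M l) : PolyTime M fun a => lookupVar (k a) (l a) := by
  unfold _root_.lookupVar
  fun_prop

/-- The second component in a pair of a list whose first component is maximal; `d` for the empty list. -/
def bestOf (l : List (ℝ × ℝ)) (d : ℝ) : ℝ :=
  match l with
  | [] => d
  | c :: t => (t.foldl (fun b c => bif leB b.1 c.1 then c else b) c).2

@[fun_prop]
theorem PolyTime.bestOf {l : α → List (ℝ × ℝ)} {d : α → ℝ} (hl : PolyTime M l)
    (hd : PolyTime M d) : PolyTime M fun a => bestOf (l a) (d a) := by
  have h := listCases (f := d)
    (g := fun _ c t => (t.foldl (fun b c => bif leB b.1 c.1 then c else b) c).2) hl hd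
    (prodSnd (foldlConst (l := fun p : α × ((ℝ × ℝ) × List (ℝ × ℝ)) => p.2.2) (i := fun p => p.2.1)
      (g := fun _ b c => bif leB b.1 c.1 then c else b) (by fun_prop) (by fun_prop) (by fun_prop) 3
      fun _ => le_rfl))
  convert h using 2 with a
  unfold _root_.bestOf
  cases l a <;> rfl

theorem bestOf_spec (l : List (ℝ × ℝ)) (d : ℝ) (hl : l ≠ []) :
    ∃ c ∈ l, bestOf l d = c.2 ∧ ∀ c' ∈ l, c'.1 ≤ c.1 := by
  cases l with
  | nil => exact absurd rfl hl
  | cons c t =>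
    suffices h : ∀ (t : List (ℝ × ℝ)) (c : ℝ × ℝ),
        t.foldl (fun b c => bif leB b.1 c.1 then c else b) c ∈ c :: t ∧
        ∀ c' ∈ c :: t, c'.1 ≤ (t.foldl (fun b c => bif leB b.1 c.1 then c else b) c).1 from
      ⟨_, (h t c).1, rfl, (h t c).2⟩
    intro t
    induction t with
    | nil => intro c; simp
    | cons b t ih =>
      intro c
      rw [List.foldl_cons]
      by_cases h : c.1 ≤ b.1
      · rw [show leB c.1 b.1 = true by simpa using h, cond_true]
        refine ⟨List.mem_cons_of_mem _ (ih b).1, ?_⟩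
        rintro c' (_ | ⟨_, hc'⟩)
        · exact h.trans ((ih b).2 b (by simp))
        · exact (ih b).2 c' hc'
      · rw [show leB c.1 b.1 = false by rw [← Bool.not_eq_true]; simpa using h, cond_false]
        obtain ⟨h1, h2⟩ := ih c
        refine ⟨?_, ?_⟩
        · rcases List.mem_cons.1 h1 with h1 | h1
          · rw [h1]; simp
          · exact List.mem_cons_of_mem _ (List.mem_cons_of_mem _ h1)
        · rintro c' (_ | ⟨_, _ | ⟨_, hc'⟩⟩)
          · exact h2 c (by simp)
          · exact (not_le.1 h).le.trans (h2 c (by simp))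
          · exact h2 c' (List.mem_cons_of_mem _ hc')

/-! ### The operations of a tractable function family -/

variable {F : FunFamily} {strict : Bool}

instance : Enc F.Uni := ⟨F.uniCode⟩
instance : Enc F.Bi := ⟨F.biCode⟩
instance : Enc AffBound := ⟨AffBound.code⟩
instance : Enc (AffInterval strict) := ⟨AffInterval.code⟩
instance {p : α → Prop} : Enc {a // p a} := ⟨fun a => enc a.1⟩

/-- Case distinction on a bound. -/
def AffBound.elim (b : AffBound) (v : α) (f : Bool → ℝ → ℝ → α) : α :=
  match b with
  | .infinite => v
  | .affine s a b => f s a b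

instance : Literal M AffBound.infinite := ⟨.nil, 1, fun v => Runs.nil v⟩

namespace PolyTime

@[fun_prop]
theorem affBoundElim {b : α → AffBound} {v : α → β} {f : α → Bool → ℝ → ℝ → β}
    (hb : PolyTime M b) (hv : PolyTime M v)
    (hf : PolyTime M fun p : α × (Bool × ℝ × ℝ) => f p.1 p.2.1 p.2.2.1 p.2.2.2) :
    PolyTime M fun a => (b a).elim (v a) (f a) := by
  refine pairCases hb hv hf fun a => ?_
  cases h : b a with
  | infinite => exact .inl ⟨rfl, rfl⟩
  | affine s c d =>
    exact .inr ⟨by simp [enc, AffBound.code, Val.isPair, Val.ofBool], (s, c, d), rfl, rfl⟩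

@[fun_prop]
theorem affBoundAffine {s : α → Bool} {c d : α → ℝ} (hs : PolyTime M s) (hc : PolyTime M c)
    (hd : PolyTime M d) : PolyTime M fun a => AffBound.affine (s a) (c a) (d a) :=
  comp (g := fun x : Bool × ℝ × ℝ => AffBound.affine x.1 x.2.1 x.2.2) (of_enc_eq fun _ => rfl)
    (prodMk hs (prodMk hc hd))

@[fun_prop]
theorem affIntervalLower {I : α → AffInterval strict} (hI : PolyTime M I) :
    PolyTime M fun a => (I a).l :=
  prodFst (comp (g := fun I : AffInterval strict => (I.l, I.u)) (of_enc_eq fun _ => rfl) hI)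

@[fun_prop]
theorem affIntervalUpper {I : α → AffInterval strict} (hI : PolyTime M I) :
    PolyTime M fun a => (I a).u :=
  prodSnd (comp (g := fun I : AffInterval strict => (I.l, I.u)) (of_enc_eq fun _ => rfl) hI)

@[fun_prop]
theorem affIntervalMk {l u : α → AffBound} {hl : ∀ a, (l a).IsStrict → strict = true}
    {hu : ∀ a, (u a).IsStrict → strict = true} (h1 : PolyTime M l) (h2 : PolyTime M u) :
    PolyTime M fun a => (⟨l a, u a, hl a, hu a⟩ : AffInterval strict) := by
  obtain ⟨p, q, h⟩ := prodMk h1 h2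
  exact ⟨p, q, h⟩

@[fun_prop]
theorem subtypeVal {p : β → Prop} {f : α → {b // p b}} (hf : PolyTime M f) :
    PolyTime M fun a => (f a).1 :=
  comp (g := fun b : {b // p b} => b.1) (of_enc_eq fun _ => rfl) hf

@[fun_prop]
theorem subtypeMk {p : β → Prop} {f : α → β} {h : ∀ a, p (f a)} (hf : PolyTime M f) :
    PolyTime M fun a => (⟨f a, h a⟩ : {b // p b}) := by
  obtain ⟨p, q, h⟩ := hf
  exact ⟨p, q, h⟩

/-- A tractable problem on codes has a polynomial-time solution function. -/
theorem of_tractable {ea : α → Val} {R : α → β → Prop}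
    (h : Tractable M.prim ea fun a w => ∃ b : β, w = enc b ∧ R a b) (he : ∀ a, ea a = enc a) :
    ∃ f : α → β, PolyTime M f ∧ ∀ a, R a (f a) := by
  obtain ⟨p, q, h⟩ := h
  choose w t h1 h2 f h3 h4 using h
  refine ⟨f, ⟨p, q, fun a => ⟨t a, ?_, ?_⟩⟩, h4⟩
  · rw [← h3, ← he]; exact h1 a
  · rw [esize, ← he]; exact h2 a

/-- An operation on non-empty lists, made total with values in lists of length at most one. -/
theorem of_tractable_list {R : List α → β → Prop}
    (h : Tractable M.prim (fun L : {L : List α // L ≠ []} => Val.ofList (L.1.map enc))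
      fun L w => ∃ b : β, w = enc b ∧ R L.1 b) :
    ∃ f : List α → List β, PolyTime M f ∧ f [] = [] ∧ ∀ L, L ≠ [] → ∃ b, f L = [b] ∧ R L b := by
  obtain ⟨f, hf, hR⟩ := of_tractable (R := fun L : {L : List α // L ≠ []} => R L.1) h fun _ => rfl
  let g : List α → List β := fun L => match L with | [] => [] | a :: t => [f ⟨a :: t, by simp⟩]
  refine ⟨g, ?_, rfl, fun L hL => ?_⟩
  · have h1 : PolyTime M fun p : List α × (α × List α) =>
        (⟨p.2.1 :: p.2.2, by simp⟩ : {L : List α // L ≠ []}) := subtypeMk (by fun_prop)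
    have h2 := comp hf h1
    exact listCases (l := fun L : List α => L) (f := fun _ => [])
      (g := fun _ a t => [f ⟨a :: t, by simp⟩]) (by fun_prop) (by fun_prop) (by fun_prop)
  · cases L with
    | nil => exact absurd rfl hL
    | cons a t => exact ⟨_, rfl, hR ⟨a :: t, hL⟩⟩

end PolyTime

/-- The operations on members that the elimination of a variable `y` in favour of a neighbour `x` needs.
`ev f y x` is the value of a bivariate member; whether `y` is its first or its second variable is
left open, so that both cases are treated at once. -/
structure Toolkit (M : Machine ι) (F : FunFamily) (strict : Bool) where
  ev : F.Bi → ℝ → ℝ → ℝ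
  lift : F.Uni → F.Bi
  prodBi : List F.Bi → List F.Bi
  maxUni : List F.Uni → List F.Uni
  sup : F.Bi → AffInterval strict → F.Uni
  argsup : F.Bi → AffInterval strict → ℝ → ℝ
  polyTime_ev : PolyTime M fun a : F.Bi × ℝ × ℝ => ev a.1 a.2.1 a.2.2
  polyTime_uni : PolyTime M fun a : F.Uni × ℝ => F.uni a.1 a.2
  polyTime_lift : PolyTime M lift
  polyTime_prodBi : PolyTime M prodBi
  polyTime_maxUni : PolyTime M maxUni
  polyTime_sup : PolyTime M fun a : F.Bi × AffInterval strict => sup a.1 a.2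
  polyTime_argsup : PolyTime M fun a : F.Bi × AffInterval strict × ℝ => argsup a.1 a.2.1 a.2.2
  ev_lift : ∀ f y x, ev (lift f) y x = F.uni f y
  prodBi_nil : prodBi [] = []
  prodBi_spec : ∀ L, L ≠ [] → ∃ g, prodBi L = [g] ∧ ∀ y x, ev g y x = (L.map fun f => ev f y x).prod
  maxUni_nil : maxUni [] = []
  maxUni_spec : ∀ L, L ≠ [] → ∃ g, maxUni L = [g] ∧
    ∀ x, IsGreatest {r | ∃ f ∈ L, r = F.uni f x} (F.uni g x)
  sup_spec : ∀ f (I : AffInterval strict) x s,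
    IsLUB ((fun y => ev f y x) '' I.toSet x) s → F.uni (sup f I) x = s
  argsup_spec : ∀ f (I : AffInterval strict) x,
    (∃ y, IsArgmaxOn (fun y => ev f y x) (I.toSet x) y) →
      IsArgmaxOn (fun y => ev f y x) (I.toSet x) (argsup f I x)

namespace TractableMAP

/-- The operations for eliminating the first variable of bivariate members. -/
theorem exists_toolkit_fst (h : TractableMAP M.prim F strict) :
    ∃ K : Toolkit M F strict, ∀ f y x, K.ev f y x = F.bi f y x := by
  obtain ⟨eu, heu, heu'⟩ := PolyTime.of_tractable (M := M) (α := F.Uni × ℝ) (β := ℝ)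
    (R := fun a r => r = F.uni a.1 a.2) (by simpa [enc] using h.evalUni) fun _ => rfl
  obtain ⟨eb, heb, heb'⟩ := PolyTime.of_tractable (M := M) (α := F.Bi × ℝ × ℝ) (β := ℝ)
    (R := fun a r => r = F.bi a.1 a.2.1 a.2.2) (by simpa [enc] using h.evalBi) fun _ => rfl
  obtain ⟨lift, hl, hl'⟩ := PolyTime.of_tractable (M := M) h.liftFst fun _ => rfl
  obtain ⟨pb, hp, hp0, hp'⟩ := PolyTime.of_tractable_list (M := M) (α := F.Bi)
    (R := fun L g => ∀ x y, F.bi g x y = (L.map fun f => F.bi f x y).prod) h.prodBi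
  obtain ⟨mu, hm, hm0, hm'⟩ := PolyTime.of_tractable_list (M := M) (α := F.Uni)
    (R := fun L g => ∀ x, IsGreatest {r | ∃ f ∈ L, r = F.uni f x} (F.uni g x)) h.maxUni
  obtain ⟨sup, hs, hs'⟩ := PolyTime.of_tractable (M := M) h.supFst fun _ => rfl
  obtain ⟨arg, ha, ha'⟩ := PolyTime.of_tractable (M := M)
    (α := F.Bi × AffInterval strict × ℝ) (β := ℝ) h.argsupFst fun _ => rfl
  obtain rfl := funext heu'
  obtain rfl := funext heb'
  exact ⟨{ ev := F.bi, lift := lift, prodBi := pb, maxUni := mu, sup := fun f I => sup (f, I)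
           argsup := fun f I x => arg (f, I, x), polyTime_ev := heb, polyTime_uni := heu
           polyTime_lift := hl, polyTime_prodBi := hp, polyTime_maxUni := hm, polyTime_sup := hs
           polyTime_argsup := ha, ev_lift := hl', prodBi_nil := hp0, prodBi_spec := hp'
           maxUni_nil := hm0, maxUni_spec := hm', sup_spec := fun f I => hs' (f, I)
           argsup_spec := fun f I x => ha' (f, I, x) }, fun _ _ _ => rfl⟩

/-- The same family with the variables of bivariate members exchanged. -/
theorem swap (h : TractableMAP M.prim F strict) :
    TractableMAP M.prim { F with bi := fun f x y => F.bi f y x } strict where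
  evalUni := h.evalUni
  evalBi := by
    obtain ⟨eb, heb, heb'⟩ := PolyTime.of_tractable (M := M) (α := F.Bi × ℝ × ℝ) (β := ℝ)
      (R := fun a r => r = F.bi a.1 a.2.1 a.2.2) (by simpa [enc] using h.evalBi) fun _ => rfl
    obtain ⟨p, q, hp⟩ := PolyTime.comp heb
      (f := fun a : F.Bi × ℝ × ℝ => (a.1, a.2.2, a.2.1)) (by fun_prop)
    refine ⟨p, q, fun a => ?_⟩
    obtain ⟨t, ht, htq⟩ := hp a
    exact ⟨_, t, ht, htq, congrArg Val.real (heb' (a.1, a.2.2, a.2.1))⟩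
  liftFst := by
    obtain ⟨p, q, hp⟩ := h.liftSnd
    refine ⟨p, q, fun f => ?_⟩
    obtain ⟨w, t, h1, h2, g, h3, h4⟩ := hp f
    exact ⟨w, t, h1, h2, g, h3, fun x y => h4 y x⟩
  liftSnd := by
    obtain ⟨p, q, hp⟩ := h.liftFst
    refine ⟨p, q, fun f => ?_⟩
    obtain ⟨w, t, h1, h2, g, h3, h4⟩ := hp f
    exact ⟨w, t, h1, h2, g, h3, fun x y => h4 y x⟩
  prodUni := h.prodUni
  prodBi := by
    obtain ⟨p, q, hp⟩ := h.prodBi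
    refine ⟨p, q, fun f => ?_⟩
    obtain ⟨w, t, h1, h2, g, h3, h4⟩ := hp f
    exact ⟨w, t, h1, h2, g, h3, fun x y => h4 y x⟩
  supSnd := h.supFst
  supFst := h.supSnd
  argsupSnd := h.argsupFst
  argsupFst := h.argsupSnd
  maxUni := h.maxUni

/-- The operations for eliminating the second variable of bivariate members. -/
theorem exists_toolkit_snd (h : TractableMAP M.prim F strict) :
    ∃ K : Toolkit M F strict, ∀ f y x, K.ev f y x = F.bi f x y := by
  obtain ⟨K, hK⟩ := h.swap.exists_toolkit_fst
  exact ⟨{ K with ev := K.ev }, hK⟩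

end TractableMAP

namespace PolyTime

@[fun_prop]
theorem toolkitEv (K : Toolkit M F strict) {f : α → F.Bi} {y x : α → ℝ} (hf : PolyTime M f)
    (hy : PolyTime M y) (hx : PolyTime M x) : PolyTime M fun a => K.ev (f a) (y a) (x a) :=
  comp K.polyTime_ev (prodMk hf (prodMk hy hx))

theorem toolkitUni (K : Toolkit M F strict) {f : α → F.Uni} {x : α → ℝ} (hf : PolyTime M f)
    (hx : PolyTime M x) : PolyTime M fun a => F.uni (f a) (x a) :=
  comp K.polyTime_uni (prodMk hf hx)

@[fun_prop]
theorem toolkitLift (K : Toolkit M F strict) {f : α → F.Uni} (hf : PolyTime M f) :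
    PolyTime M fun a => K.lift (f a) := comp K.polyTime_lift hf

@[fun_prop]
theorem toolkitProdBi (K : Toolkit M F strict) {L : α → List F.Bi} (hL : PolyTime M L) :
    PolyTime M fun a => K.prodBi (L a) := comp K.polyTime_prodBi hL

@[fun_prop]
theorem toolkitMaxUni (K : Toolkit M F strict) {L : α → List F.Uni} (hL : PolyTime M L) :
    PolyTime M fun a => K.maxUni (L a) := comp K.polyTime_maxUni hL

@[fun_prop]
theorem toolkitSup (K : Toolkit M F strict) {f : α → F.Bi} {I : α → AffInterval strict}
    (hf : PolyTime M f) (hI : PolyTime M I) : PolyTime M fun a => K.sup (f a) (I a) :=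
  comp K.polyTime_sup (prodMk hf hI)

@[fun_prop]
theorem toolkitArgsup (K : Toolkit M F strict) {f : α → F.Bi} {I : α → AffInterval strict}
    {x : α → ℝ} (hf : PolyTime M f) (hI : PolyTime M I) (hx : PolyTime M x) :
    PolyTime M fun a => K.argsup (f a) (I a) (x a) :=
  comp K.polyTime_argsup (prodMk hf (prodMk hI hx))

end PolyTime

/-! ### Cells of an arrangement of lines -/

/-- The sign of `v` is compatible with the sign of `u`: equal to it if `strict`, and otherwise at least in
the closure, so that non-strict inequalities carry over from `u` to `v`. -/
def SignCompat (strict : Bool) (u v : ℝ) : Prop :=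
  (u ≤ 0 → v ≤ 0) ∧ (0 ≤ u → 0 ≤ v) ∧ (strict = true → (v ≤ 0 → u ≤ 0) ∧ (0 ≤ v → 0 ≤ u))

namespace SignCompat

theorem refl (u : ℝ) : SignCompat strict u u :=
  ⟨id, id, fun _ => ⟨id, id⟩⟩

theorem of_pos {u v : ℝ} (hu : 0 < u) (hv : 0 ≤ v) (hs : strict = true → 0 < v) :
    SignCompat strict u v :=
  ⟨fun h => absurd h hu.not_ge, fun _ => hv, fun h => ⟨fun h' => absurd h' (hs h).not_ge,
    fun _ => hu.le⟩⟩

theorem mul (k : ℝ) {u v : ℝ} (h : SignCompat strict u v) : SignCompat strict (k * u) (k * v) := by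
  obtain ⟨h1, h2, h3⟩ := h
  rcases lt_trichotomy k 0 with hk | rfl | hk
  · have h4 : ∀ w, k * w ≤ 0 ↔ 0 ≤ w := fun w =>
      ⟨fun h => by nlinarith, fun h => by nlinarith⟩
    have h5 : ∀ w, 0 ≤ k * w ↔ w ≤ 0 := fun w =>
      ⟨fun h => by nlinarith, fun h => by nlinarith⟩
    simp only [SignCompat, h4, h5]
    exact ⟨h2, h1, fun hs => ⟨(h3 hs).2, (h3 hs).1⟩⟩
  · simpa using refl _
  · have h4 : ∀ w, k * w ≤ 0 ↔ w ≤ 0 := fun w =>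
      ⟨fun h => by nlinarith, fun h => by nlinarith⟩
    have h5 : ∀ w, 0 ≤ k * w ↔ 0 ≤ w := fun w =>
      ⟨fun h => by nlinarith, fun h => by nlinarith⟩
    simp only [SignCompat, h4, h5]
    exact ⟨h1, h2, h3⟩

theorem neg {u v : ℝ} (h : SignCompat strict u v) : SignCompat strict (-u) (-v) := by
  simpa using h.mul (-1)

theorem of_neg {u v : ℝ} (hu : u < 0) (hv : v ≤ 0) (hs : strict = true → v < 0) :
    SignCompat strict u v := by
  have := (of_pos (strict := strict) (neg_pos.2 hu) (neg_nonneg.2 hv) fun h => neg_pos.2 (hs h)).neg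
  simpa using this

theorem lt_iff {u v : ℝ} (h : SignCompat true u v) : u < 0 ↔ v < 0 := by
  have h3 := h.2.2 rfl
  rw [← not_le, ← not_le]
  exact not_congr ⟨h.2.1, h3.2⟩

end SignCompat

/-- The value of the affine function `ℓ` with slope `ℓ.1` and constant term `ℓ.2`. -/
def lineAt (ℓ : ℝ × ℝ) (x : ℝ) : ℝ := ℓ.1 * x + ℓ.2

@[simp] theorem lineAt_zero (c x : ℝ) : lineAt (0, c) x = c := by simp [lineAt]

/-- The point where two lines cross (`0` for parallel lines, which is an irrelevant point). -/
def crossing (ℓ ℓ' : ℝ × ℝ) : ℝ := (ℓ'.2 - ℓ.2) / (ℓ.1 - ℓ'.1)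

/-- The order of two lines changes only at their crossing. -/
theorem SignCompat.of_crossing {ℓ ℓ' : ℝ × ℝ} {t x : ℝ}
    (h : SignCompat strict (t - crossing ℓ ℓ') (x - crossing ℓ ℓ')) :
    SignCompat strict (lineAt ℓ t - lineAt ℓ' t) (lineAt ℓ x - lineAt ℓ' x) := by
  by_cases hk : ℓ.1 - ℓ'.1 = 0
  · have : ∀ z, lineAt ℓ z - lineAt ℓ' z = ℓ.2 - ℓ'.2 := by
      intro z
      rw [lineAt, lineAt, sub_eq_zero.1 hk]
      ring
    rw [this, this]
    exact refl _
  · have : ∀ z, lineAt ℓ z - lineAt ℓ' z = (ℓ.1 - ℓ'.1) * (z - crossing ℓ ℓ') := by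
      intro z
      rw [lineAt, lineAt, crossing]
      field_simp
      ring
    rw [this, this]
    exact h.mul _

namespace AffBound

/-- Being strictly above a lower bound. -/
def ltB (b : AffBound) (x y : ℝ) : Bool := b.elim true fun _ a c => _root_.ltB (a * x + c) y

/-- Being strictly below an upper bound. -/
def gtB (b : AffBound) (x y : ℝ) : Bool := b.elim true fun _ a c => _root_.ltB y (a * x + c)

/-- A test for `AffBound.above`. -/
def aboveB (b : AffBound) (x y : ℝ) : Bool :=
  b.elim true fun s a c => bif s then _root_.ltB (a * x + c) y else leB (a * x + c) y

/-- A test for `AffBound.below`. -/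
def belowB (b : AffBound) (x y : ℝ) : Bool :=
  b.elim true fun s a c => bif s then _root_.ltB y (a * x + c) else leB y (a * x + c)

/-- A point strictly between two bounds. -/
def between (l u : AffBound) (x : ℝ) : ℝ :=
  l.elim (u.elim 0 fun _ a c => a * x + c - 1) fun _ a c =>
    u.elim (a * x + c + 1) fun _ a' c' => ((a * x + c) + (a' * x + c')) / (1 + 1)

theorem aboveB_iff (b : AffBound) (x y : ℝ) : b.aboveB x y = true ↔ y ∈ b.above x := by
  rcases b with _ | ⟨_ | _, a, c⟩ <;> simp [aboveB, above, elim]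

theorem belowB_iff (b : AffBound) (x y : ℝ) : b.belowB x y = true ↔ y ∈ b.below x := by
  rcases b with _ | ⟨_ | _, a, c⟩ <;> simp [belowB, below, elim]

end AffBound

/-- A test for membership in an interval. -/
def AffInterval.memB (I : AffInterval strict) (x y : ℝ) : Bool := I.l.aboveB x y && I.u.belowB x y

theorem AffInterval.memB_iff (I : AffInterval strict) (x y : ℝ) :
    I.memB x y = true ↔ y ∈ I.toSet x := by
  rw [memB, Bool.and_eq_true, AffBound.aboveB_iff, AffBound.belowB_iff]
  rfl

/-- The bounds that an admissible interval may have. -/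
abbrev AdmissibleBound (strict : Bool) := {b : AffBound // b.IsStrict → strict = true}

/-- A line as a bound, excluded if strict bounds are admitted. -/
def lineBound (strict : Bool) (ℓ : ℝ × ℝ) : AdmissibleBound strict :=
  ⟨.affine strict ℓ.1 ℓ.2, fun h => h⟩

/-- The bounds of the cells of an arrangement. -/
def cellBounds (strict : Bool) (lines : List (ℝ × ℝ)) : List (AdmissibleBound strict) :=
  ⟨.infinite, fun h => h.elim⟩ :: lines.map (lineBound strict)

/-- The interval that consists of the point on a line. -/
def linePoint (strict : Bool) (ℓ : ℝ × ℝ) : AffInterval strict :=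
  ⟨.affine false ℓ.1 ℓ.2, .affine false ℓ.1 ℓ.2, fun h => by simp [AffBound.IsStrict] at h,
    fun h => by simp [AffBound.IsStrict] at h⟩

/-- `l` and `u` are neighbours in the arrangement above the point `t`. -/
def isCell (lines : List (ℝ × ℝ)) (t : ℝ) (l u : AffBound) : Bool :=
  l.ltB t (l.between u t) && u.gtB t (l.between u t) &&
    lines.all fun ℓ => !(l.ltB t (lineAt ℓ t) && u.gtB t (lineAt ℓ t))

/-- The cells into which the lines cut the vertical line above `t`, each with a sample point: the points on
the lines, and the intervals between neighbours.  The latter are open if strict bounds are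
admitted, and closed otherwise. -/
def cells (strict : Bool) (lines : List (ℝ × ℝ)) (t : ℝ) : List (AffInterval strict × ℝ) :=
  (lines.map fun ℓ => (linePoint strict ℓ, lineAt ℓ t)) ++
    (cellBounds strict lines).flatMap fun l =>
      ((cellBounds strict lines).filter fun u => isCell lines t l.1 u.1).map fun u =>
        (⟨l.1, u.1, l.2, u.2⟩, l.1.between u.1 t)

section cells

variable {lines : List (ℝ × ℝ)} {t x : ℝ}

theorem isCell_iff {l u : AffBound} : isCell lines t l u = true ↔
    (l.ltB t (l.between u t) = true ∧ u.gtB t (l.between u t) = true) ∧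
      ∀ ℓ ∈ lines, l.ltB t (lineAt ℓ t) = true → ¬ u.gtB t (lineAt ℓ t) = true := by
  simp [isCell, imp_iff_not_or]

theorem mem_cells {c : AffInterval strict × ℝ} : c ∈ cells strict lines t ↔
    (∃ ℓ ∈ lines, (linePoint strict ℓ, lineAt ℓ t) = c) ∨
    ∃ l ∈ cellBounds strict lines, ∃ u ∈ cellBounds strict lines, isCell lines t l.1 u.1 = true ∧
      (⟨l.1, u.1, l.2, u.2⟩, l.1.between u.1 t) = c := by
  simp only [cells, List.mem_append, List.mem_map, List.mem_flatMap, List.mem_filter, and_assoc]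

theorem mem_cellBounds {b : AdmissibleBound strict} : b ∈ cellBounds strict lines ↔
    b.1 = .infinite ∨ ∃ ℓ ∈ lines, lineBound strict ℓ = b := by
  simp only [cellBounds, List.mem_cons, List.mem_map, Subtype.ext_iff]

@[simp] theorem lineBound_ltB (ℓ : ℝ × ℝ) (x y : ℝ) :
    (lineBound strict ℓ).1.ltB x y = true ↔ lineAt ℓ x < y := by
  simp [lineBound, AffBound.ltB, AffBound.elim, lineAt]

@[simp] theorem lineBound_gtB (ℓ : ℝ × ℝ) (x y : ℝ) :
    (lineBound strict ℓ).1.gtB x y = true ↔ y < lineAt ℓ x := by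
  simp [lineBound, AffBound.gtB, AffBound.elim, lineAt]

theorem mem_above_lineBound {ℓ : ℝ × ℝ} {x y : ℝ} :
    y ∈ (lineBound strict ℓ).1.above x ↔ lineAt ℓ x ≤ y ∧ (strict = true → lineAt ℓ x < y) := by
  cases strict
  · simp [lineBound, AffBound.above, lineAt]
  · simp only [lineBound, AffBound.above, lineAt, Set.mem_Ioi, forall_const]
    exact ⟨fun h => ⟨h.le, h⟩, fun h => h.2⟩

theorem mem_below_lineBound {ℓ : ℝ × ℝ} {x y : ℝ} :
    y ∈ (lineBound strict ℓ).1.below x ↔ y ≤ lineAt ℓ x ∧ (strict = true → y < lineAt ℓ x) := by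
  cases strict
  · simp [lineBound, AffBound.below, lineAt]
  · simp only [lineBound, AffBound.below, lineAt, Set.mem_Iio, forall_const]
    exact ⟨fun h => ⟨h.le, h⟩, fun h => h.2⟩

theorem mem_linePoint {ℓ : ℝ × ℝ} {x y : ℝ} : y ∈ (linePoint strict ℓ).toSet x ↔ y = lineAt ℓ x := by
  simp only [linePoint, AffInterval.toSet, AffBound.above, AffBound.below, Set.mem_inter_iff,
    Set.mem_Ici, Set.mem_Iic, lineAt]
  exact ⟨fun h => le_antisymm h.2 h.1, fun h => ⟨h.ge, h.le⟩⟩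

/-- If the order of the lines above `x` is compatible with that above `t`, then so is, for all points of a cell
above `t`, the position relative to the lines. -/
theorem cells_sound
    (hx : ∀ ℓ ∈ lines, ∀ ℓ' ∈ lines,
      SignCompat strict (lineAt ℓ t - lineAt ℓ' t) (lineAt ℓ x - lineAt ℓ' x))
    {c : AffInterval strict × ℝ} (hc : c ∈ cells strict lines t) :
    (c.1.toSet x).Nonempty ∧
      ∀ y ∈ c.1.toSet x, ∀ ℓ ∈ lines, SignCompat strict (c.2 - lineAt ℓ t) (y - lineAt ℓ x) := by
  rcases mem_cells.1 hc with ⟨ℓ, hℓ, rfl⟩ | ⟨l, hl, u, hu, hcell, rfl⟩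
  · refine ⟨⟨lineAt ℓ x, mem_linePoint.2 rfl⟩, fun y hy ℓ' hℓ' => ?_⟩
    rw [mem_linePoint.1 hy]
    exact hx ℓ hℓ ℓ' hℓ'
  · obtain ⟨⟨h1, h2⟩, h3⟩ := isCell_iff.1 hcell
    set s := l.1.between u.1 t
    refine ⟨?_, fun y hy ℓ hℓ => ?_⟩
    · rcases mem_cellBounds.1 hl with hl | ⟨ℓ, hℓ, rfl⟩ <;>
        rcases mem_cellBounds.1 hu with hu | ⟨ℓ', hℓ', rfl⟩
      · exact ⟨0, by simp [AffInterval.toSet, hl, hu, AffBound.above, AffBound.below]⟩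
      · exact ⟨lineAt ℓ' x - 1, by simp [hl, AffBound.above], by
          simp only [mem_below_lineBound]; exact ⟨by linarith, fun _ => by linarith⟩⟩
      · refine ⟨lineAt ℓ x + 1, ?_, by simp [hu, AffBound.below]⟩
        simp only [mem_above_lineBound]; exact ⟨by linarith, fun _ => by linarith⟩
      · have h4 := hx ℓ hℓ ℓ' hℓ'
        rw [lineBound_ltB] at h1
        rw [lineBound_gtB] at h2
        have h5 := h4.1 (by linarith)
        have h6 : strict = true → lineAt ℓ x < lineAt ℓ' x := fun hs => by
          by_contra h
          have := (h4.2.2 hs).2 (by linarith)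
          linarith
        refine ⟨(lineAt ℓ x + lineAt ℓ' x) / 2, ?_, ?_⟩
        · simp only [mem_above_lineBound]
          exact ⟨by linarith, fun hs => by linarith [h6 hs]⟩
        · simp only [mem_below_lineBound]
          exact ⟨by linarith, fun hs => by linarith [h6 hs]⟩
    · by_cases h4 : l.1.ltB t (lineAt ℓ t) = true
      · -- then the line is not below the upper bound of the cell
        have h5 := h3 ℓ hℓ h4
        rcases mem_cellBounds.1 hu with hu | ⟨ℓ', hℓ', rfl⟩
        · simp [hu, AffBound.gtB, AffBound.elim] at h5
        · rw [lineBound_gtB] at h2 h5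
          have h6 := mem_below_lineBound.1 hy.2
          have h7 := (hx ℓ hℓ ℓ' hℓ').2.1 (by linarith)
          exact .of_neg (by simp only; linarith) (by linarith) fun hs => by linarith [h6.2 hs]
      · rcases mem_cellBounds.1 hl with hl | ⟨ℓ', hℓ', rfl⟩
        · simp [hl, AffBound.ltB, AffBound.elim] at h4
        · rw [lineBound_ltB] at h1 h4
          have h6 := mem_above_lineBound.1 hy.1
          have h7 := (hx ℓ' hℓ' ℓ hℓ).2.1 (by linarith)
          exact .of_pos (by simp only; linarith) (by linarith) fun hs => by linarith [h6.2 hs]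

theorem List.exists_max_of_exists {α : Type} (l : List α) (p : α → Prop) (f : α → ℝ)
    (h : ∃ a ∈ l, p a) : ∃ a ∈ l, p a ∧ ∀ b ∈ l, p b → f b ≤ f a := by
  classical
  obtain ⟨a, ha, hp⟩ := h
  obtain ⟨b, hb, hmax⟩ := (l.toFinset.filter p).exists_max_image f ⟨a, by simp [ha, hp]⟩
  simp only [Finset.mem_filter, List.mem_toFinset] at hb hmax
  exact ⟨b, hb.1, hb.2, fun c hc hpc => hmax c ⟨hc, hpc⟩⟩

/-- If the lines are ordered above `x` as above `t`, then every point above `x` lies in a cell above `t` with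
the same position relative to the lines. -/
theorem cells_complete
    (hx : ∀ ℓ ∈ lines, ∀ ℓ' ∈ lines,
      SignCompat true (lineAt ℓ t - lineAt ℓ' t) (lineAt ℓ x - lineAt ℓ' x)) (y : ℝ) :
    ∃ c ∈ cells strict lines t, y ∈ c.1.toSet x ∧
      ∀ ℓ ∈ lines, SignCompat true (c.2 - lineAt ℓ t) (y - lineAt ℓ x) := by
  have hlt : ∀ ℓ ∈ lines, ∀ ℓ' ∈ lines, lineAt ℓ t < lineAt ℓ' t ↔ lineAt ℓ x < lineAt ℓ' x := by
    intro ℓ hℓ ℓ' hℓ'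
    have := (hx ℓ hℓ ℓ' hℓ').lt_iff
    rwa [sub_neg, sub_neg] at this
  by_cases hy : ∃ ℓ ∈ lines, lineAt ℓ x = y
  · obtain ⟨ℓ, hℓ, rfl⟩ := hy
    exact ⟨_, mem_cells.2 (.inl ⟨ℓ, hℓ, rfl⟩), mem_linePoint.2 rfl, fun ℓ' hℓ' => hx ℓ hℓ ℓ' hℓ'⟩
  push Not at hy
  have hlo : ∃ l ∈ cellBounds strict lines, l.1.ltB x y = true ∧ y ∈ l.1.above x ∧
      ∀ ℓ ∈ lines, lineAt ℓ x < y → ∃ ℓ' ∈ lines, lineBound strict ℓ' = l ∧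
        lineAt ℓ t ≤ lineAt ℓ' t := by
    by_cases h : ∃ ℓ ∈ lines, lineAt ℓ x < y
    · obtain ⟨ℓ, hℓ, h1, h2⟩ := List.exists_max_of_exists lines _ (fun ℓ => lineAt ℓ x) h
      exact ⟨lineBound strict ℓ, mem_cellBounds.2 (.inr ⟨ℓ, hℓ, rfl⟩), (lineBound_ltB _ _ _).2 h1,
        mem_above_lineBound.2 ⟨h1.le, fun _ => h1⟩, fun ℓ' hℓ' h' => ⟨ℓ, hℓ, rfl,
          not_lt.1 fun h3 => absurd ((hlt ℓ hℓ ℓ' hℓ').1 h3) (h2 ℓ' hℓ' h').not_gt⟩⟩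
    · push Not at h
      exact ⟨⟨.infinite, fun h => h.elim⟩, mem_cellBounds.2 (.inl rfl), rfl, trivial,
        fun ℓ hℓ h' => absurd h' (h ℓ hℓ).not_gt⟩
  have hhi : ∃ u ∈ cellBounds strict lines, u.1.gtB x y = true ∧ y ∈ u.1.below x ∧
      ∀ ℓ ∈ lines, y < lineAt ℓ x → ∃ ℓ' ∈ lines, lineBound strict ℓ' = u ∧
        lineAt ℓ' t ≤ lineAt ℓ t := by
    by_cases h : ∃ ℓ ∈ lines, y < lineAt ℓ x
    · obtain ⟨ℓ, hℓ, h1, h2⟩ := List.exists_max_of_exists lines _ (fun ℓ => -lineAt ℓ x) h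
      exact ⟨lineBound strict ℓ, mem_cellBounds.2 (.inr ⟨ℓ, hℓ, rfl⟩), (lineBound_gtB _ _ _).2 h1,
        mem_below_lineBound.2 ⟨h1.le, fun _ => h1⟩, fun ℓ' hℓ' h' => ⟨ℓ, hℓ, rfl,
          not_lt.1 fun h3 => absurd ((hlt ℓ' hℓ' ℓ hℓ).1 h3)
            (neg_le_neg_iff.1 (h2 ℓ' hℓ' h')).not_gt⟩⟩
    · push Not at h
      exact ⟨⟨.infinite, fun h => h.elim⟩, mem_cellBounds.2 (.inl rfl), rfl, trivial,
        fun ℓ hℓ h' => absurd h' (h ℓ hℓ).not_gt⟩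
  obtain ⟨l, hl, hl1, hl2, hl3⟩ := hlo
  obtain ⟨u, hu, hu1, hu2, hu3⟩ := hhi
  have hs : l.1.ltB t (l.1.between u.1 t) = true ∧ u.1.gtB t (l.1.between u.1 t) = true := by
    rcases mem_cellBounds.1 hl with hl | ⟨ℓ, hℓ, rfl⟩ <;>
      rcases mem_cellBounds.1 hu with hu | ⟨ℓ', hℓ', rfl⟩
    · simp [hl, hu, AffBound.ltB, AffBound.gtB, AffBound.elim]
    · rw [lineBound_gtB]
      simp [hl, AffBound.ltB, AffBound.between, AffBound.elim, lineBound, lineAt]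
    · rw [lineBound_ltB]
      simp [hu, AffBound.gtB, AffBound.between, AffBound.elim, lineBound, lineAt]
    · rw [lineBound_ltB] at hl1 ⊢
      rw [lineBound_gtB] at hu1 ⊢
      have h := (hlt ℓ hℓ ℓ' hℓ').2 (hl1.trans hu1)
      have h' : (lineBound strict ℓ).1.between (lineBound strict ℓ').1 t =
          (lineAt ℓ t + lineAt ℓ' t) / (1 + 1) := rfl
      rw [h']
      constructor <;> linarith
  have hside : ∀ ℓ ∈ lines, (lineAt ℓ x < y ∧ lineAt ℓ t < l.1.between u.1 t ∧
      ¬ l.1.ltB t (lineAt ℓ t) = true) ∨ (y < lineAt ℓ x ∧ l.1.between u.1 t < lineAt ℓ t ∧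
      ¬ u.1.gtB t (lineAt ℓ t) = true) := by
    intro ℓ hℓ
    rcases lt_or_gt_of_ne (hy ℓ hℓ) with h | h
    · obtain ⟨ℓ', hℓ', rfl, h'⟩ := hl3 ℓ hℓ h
      rw [lineBound_ltB] at hs ⊢
      exact .inl ⟨h, h'.trans_lt hs.1, h'.not_gt⟩
    · obtain ⟨ℓ', hℓ', rfl, h'⟩ := hu3 ℓ hℓ h
      rw [lineBound_gtB] at hs ⊢
      exact .inr ⟨h, hs.2.trans_le h', h'.not_gt⟩
  refine ⟨_, mem_cells.2 (.inr ⟨l, hl, u, hu, isCell_iff.2 ⟨hs, fun ℓ hℓ h1 h2 => ?_⟩, rfl⟩),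
    ⟨hl2, hu2⟩, fun ℓ hℓ => ?_⟩
  · rcases hside ℓ hℓ with ⟨_, _, h⟩ | ⟨_, _, h⟩
    exacts [h h1, h h2]
  · rcases hside ℓ hℓ with ⟨h1, h2, _⟩ | ⟨h1, h2, _⟩
    · exact .of_pos (sub_pos.2 h2) (sub_pos.2 h1).le fun _ => sub_pos.2 h1
    · exact .of_neg (sub_neg.2 h2) (sub_neg.2 h1).le fun _ => sub_neg.2 h1

end cells

namespace PolyTime

@[fun_prop]
theorem lineAt {ℓ : α → ℝ × ℝ} {x : α → ℝ} (hℓ : PolyTime M ℓ) (hx : PolyTime M x) :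
    PolyTime M fun a => lineAt (ℓ a) (x a) := by unfold _root_.lineAt; fun_prop

@[fun_prop]
theorem crossing {ℓ ℓ' : α → ℝ × ℝ} (hℓ : PolyTime M ℓ) (hℓ' : PolyTime M ℓ') :
    PolyTime M fun a => crossing (ℓ a) (ℓ' a) := by unfold _root_.crossing; fun_prop

@[fun_prop]
theorem affBoundLtB {b : α → AffBound} {x y : α → ℝ} (hb : PolyTime M b) (hx : PolyTime M x)
    (hy : PolyTime M y) : PolyTime M fun a => (b a).ltB (x a) (y a) := by
  unfold AffBound.ltB; fun_prop

@[fun_prop]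
theorem affBoundGtB {b : α → AffBound} {x y : α → ℝ} (hb : PolyTime M b) (hx : PolyTime M x)
    (hy : PolyTime M y) : PolyTime M fun a => (b a).gtB (x a) (y a) := by
  unfold AffBound.gtB; fun_prop

@[fun_prop]
theorem affBoundBetween {l u : α → AffBound} {x : α → ℝ} (hl : PolyTime M l)
    (hu : PolyTime M u) (hx : PolyTime M x) : PolyTime M fun a => (l a).between (u a) (x a) := by
  unfold AffBound.between; fun_prop

@[fun_prop]
theorem affIntervalMemB {I : α → AffInterval strict} {x y : α → ℝ} (hI : PolyTime M I)
    (hx : PolyTime M x) (hy : PolyTime M y) : PolyTime M fun a => (I a).memB (x a) (y a) := by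
  unfold AffInterval.memB AffBound.aboveB AffBound.belowB; fun_prop

@[fun_prop]
theorem isCell {L : α → List (ℝ × ℝ)} {t : α → ℝ} {l u : α → AffBound} (hL : PolyTime M L)
    (ht : PolyTime M t) (hl : PolyTime M l) (hu : PolyTime M u) :
    PolyTime M fun a => isCell (L a) (t a) (l a) (u a) := by
  unfold _root_.isCell; fun_prop

@[fun_prop]
theorem cells {L : α → List (ℝ × ℝ)} {t : α → ℝ} (hL : PolyTime M L) (ht : PolyTime M t) :
    PolyTime M fun a => cells strict (L a) (t a) := by
  unfold _root_.cells cellBounds linePoint lineBound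
  fun_prop

end PolyTime

open scoped ENNReal

/-! ### Real numbers that stand for extended non-negative ones -/

/-- The real number `r` is a lower approximation of `M`, if `M` is finite. -/
def LowerApprox (r : ℝ) (M : ℝ≥0∞) : Prop := M ≠ ∞ → 0 ≤ r ∧ ENNReal.ofReal r ≤ M

/-- The real number `r` is equal to `M`, if `M` is finite. -/
def ExactApprox (r : ℝ) (M : ℝ≥0∞) : Prop := M ≠ ∞ → 0 ≤ r ∧ ENNReal.ofReal r = M

theorem ExactApprox.lower {r : ℝ} {M : ℝ≥0∞} (h : ExactApprox r M) : LowerApprox r M :=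
  fun hM => ⟨(h hM).1, (h hM).2.le⟩

theorem LowerApprox.eq_zero {r : ℝ} (h : LowerApprox r 0) : r = 0 := by
  obtain ⟨h1, h2⟩ := h (by simp)
  rw [nonpos_iff_eq_zero, ENNReal.ofReal_eq_zero] at h2
  exact le_antisymm h2 h1

/-- A product is finite although one factor is infinite only if another factor vanishes; then the arbitrary real
number that stands for the infinite factor does no harm. -/
theorem LowerApprox.mul {r r' : ℝ} {M M' : ℝ≥0∞} (h : LowerApprox r M) (h' : LowerApprox r' M') :
    LowerApprox (r * r') (M * M') := by
  intro hM
  by_cases h1 : M = ∞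
  · have h2 : M' = 0 := by
      by_contra h2
      exact hM (by rw [h1, ENNReal.top_mul h2])
    rw [h2] at h'
    simp [h'.eq_zero]
  by_cases h2 : M' = ∞
  · have h3 : M = 0 := by
      by_contra h3
      exact hM (by rw [h2, ENNReal.mul_top h3])
    rw [h3] at h
    simp [h.eq_zero]
  obtain ⟨h3, h4⟩ := h h1
  obtain ⟨h5, h6⟩ := h' h2
  exact ⟨mul_nonneg h3 h5, by rw [ENNReal.ofReal_mul h3]; exact mul_le_mul' h4 h6⟩

theorem ExactApprox.mul {r r' : ℝ} {M M' : ℝ≥0∞} (h : ExactApprox r M) (h' : ExactApprox r' M') :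
    ExactApprox (r * r') (M * M') := by
  intro hM
  refine ⟨(h.lower.mul h'.lower hM).1, ?_⟩
  by_cases h1 : M = ∞
  · have h2 : M' = 0 := by
      by_contra h2
      exact hM (by rw [h1, ENNReal.top_mul h2])
    rw [h2] at h' ⊢
    simp [h'.lower.eq_zero]
  by_cases h2 : M' = ∞
  · have h3 : M = 0 := by
      by_contra h3
      exact hM (by rw [h2, ENNReal.mul_top h3])
    rw [h3] at h ⊢
    simp [h.lower.eq_zero]
  rw [ENNReal.ofReal_mul (h h1).1, (h h1).2, (h' h2).2]

theorem LowerApprox.list_prod {α : Type} {l : List α} {r : α → ℝ} {M : α → ℝ≥0∞}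
    (h : ∀ a ∈ l, LowerApprox (r a) (M a)) : LowerApprox (l.map r).prod (l.map M).prod := by
  induction l with
  | nil => intro _; simp
  | cons a l ih =>
    rw [List.map_cons, List.map_cons, List.prod_cons, List.prod_cons]
    exact (h a (by simp)).mul (ih fun b hb => h b (by simp [hb]))

theorem ExactApprox.list_prod {α : Type} {l : List α} {r : α → ℝ} {M : α → ℝ≥0∞}
    (h : ∀ a ∈ l, ExactApprox (r a) (M a)) : ExactApprox (l.map r).prod (l.map M).prod := by
  induction l with
  | nil => intro _; simp
  | cons a l ih =>
    rw [List.map_cons, List.map_cons, List.prod_cons, List.prod_cons]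
    exact (h a (by simp)).mul (ih fun b hb => h b (by simp [hb]))

theorem exactApprox_ofReal {r : ℝ} (h : 0 ≤ r) : ExactApprox r (ENNReal.ofReal r) := fun _ => ⟨h, rfl⟩

theorem ENNReal.list_prod_ne_top {α : Type} {l : List α} {f : α → ℝ≥0∞} (h : ∀ a ∈ l, f a ≠ ∞) :
    (l.map f).prod ≠ ∞ := by
  induction l with
  | nil => simp
  | cons a l ih =>
    rw [List.map_cons, List.prod_cons]
    exact ENNReal.mul_ne_top (h a (by simp)) (ih fun b hb => h b (by simp [hb]))

theorem List.prod_map_flatMap {α β R : Type} [Monoid R] (l : List α) (g : α → List β) (f : β → R) :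
    ((l.flatMap g).map f).prod = (l.map fun a => ((g a).map f).prod).prod := by
  induction l with
  | nil => simp
  | cons a l ih => simp [ih]

/-! ### Literals of two variables -/

/-- The code of a literal: whether it is positive, whether it is an equation, its coefficients and
its right-hand side. -/
abbrev RawLit := Bool × Bool × List ℝ × ℝ

/-- The truth value of a literal, where `u` is the difference of its two sides. -/
def RawLit.test (l : RawLit) (u : ℝ) : Bool :=
  bif l.1 then (bif l.2.1 then eqB u 0 else leB u 0) else !(bif l.2.1 then eqB u 0 else leB u 0)

/-- The difference of the two sides of a literal in the variables `i` and `j` at `y` and `x`. -/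
def RawLit.diff (l : RawLit) (i j : ℕ) (y x : ℝ) : ℝ :=
  coef l.2.2.1 i * y + coef l.2.2.1 j * x - l.2.2.2

/-- The line on which the two sides of a literal agree, as a function of the variable `j`; it is an irrelevant
line if `i` does not occur. -/
def RawLit.line (l : RawLit) (i j : ℕ) : ℝ × ℝ :=
  (-(coef l.2.2.1 j / coef l.2.2.1 i), l.2.2.2 / coef l.2.2.1 i)

/-- The value of the variable `j` at which the two sides agree, if `i` does not occur. -/
def RawLit.break (l : RawLit) (j : ℕ) : ℝ := l.2.2.2 / coef l.2.2.1 j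

theorem SignCompat.symm {u v : ℝ} (h : SignCompat true u v) : SignCompat true v u :=
  ⟨(h.2.2 rfl).1, (h.2.2 rfl).2, fun _ => ⟨h.1, h.2.1⟩⟩

theorem RawLit.test_of_signCompat {l : RawLit} {u v : ℝ} (hl : strict = false → l.1 = true)
    (h : SignCompat strict u v) (hu : l.test u = true) : l.test v = true := by
  obtain ⟨pos, isEq, c⟩ := l
  obtain ⟨h1, h2, h3⟩ := h
  have key : ∀ u : ℝ, (bif isEq then eqB u 0 else leB u 0) = true ↔
      (u ≤ 0 ∧ (isEq = true → 0 ≤ u)) := by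
    intro u
    cases isEq
    · simp
    · simpa using le_antisymm_iff
  have hpos : ∀ u : ℝ, RawLit.test (pos, isEq, c) u = true ↔
      (if pos = true then (u ≤ 0 ∧ (isEq = true → 0 ≤ u)) else
        ¬ (u ≤ 0 ∧ (isEq = true → 0 ≤ u))) := by
    intro u
    rw [← key]
    simp only [RawLit.test]
    generalize (bif isEq then eqB u 0 else leB u 0) = b
    cases pos <;> cases b <;> simp
  rw [hpos] at hu ⊢
  cases pos
  · have hs : strict = true := by
      cases strict
      · exact absurd (hl rfl) (by simp)
      · rfl
    simp only [Bool.false_eq_true, if_false] at hu ⊢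
    exact fun h => hu ⟨(h3 hs).1 h.1, fun he => (h3 hs).2 (h.2 he)⟩
  · simp only [if_true] at hu ⊢
    exact ⟨h1 hu.1, fun he => h2 (hu.2 he)⟩

theorem RawLit.signCompat_diff {l : RawLit} {i j : ℕ} {s t y x : ℝ}
    (h1 : SignCompat strict (s - lineAt (l.line i j) t) (y - lineAt (l.line i j) x))
    (h2 : SignCompat strict (t - l.break j) (x - l.break j)) :
    SignCompat strict (l.diff i j s t) (l.diff i j y x) := by
  by_cases hi : coef l.2.2.1 i = 0
  · by_cases hj : coef l.2.2.1 j = 0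
    · simp only [RawLit.diff, hi, hj, zero_mul]
      exact .refl _
    · have : ∀ y x, l.diff i j y x = coef l.2.2.1 j * (x - l.break j) := by
        intro y x
        rw [RawLit.diff, RawLit.break, hi]
        field_simp
        ring
      rw [this, this]
      exact h2.mul _
  · have : ∀ y x, l.diff i j y x = coef l.2.2.1 i * (y - lineAt (l.line i j) x) := by
      intro y x
      rw [RawLit.diff, RawLit.line, lineAt]
      field_simp
      ring
    rw [this, this]
    exact h1.mul _

/-! ### Messages -/

/-- A message: a finite list of members of the family with intervals on which they count, and the extended
function on a domain of feasible points for which their pointwise maximum stands.  The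
machine sees only the list. -/
structure Msg (F : FunFamily) (strict : Bool) where
  pieces : List (AffInterval strict × F.Uni)
  dom : Set ℝ
  val : ℝ → ℝ≥0∞

instance : Enc (Msg F strict) := ⟨fun m => enc m.pieces⟩

/-- The list represents the function: at every point of the domain some interval is active; where the
value is finite, no active member exceeds it and one attains it. -/
def Msg.Valid (m : Msg F strict) : Prop :=
  (∀ x, x ∈ m.dom ↔ ∃ p ∈ m.pieces, x ∈ p.1.toSet 0) ∧
  ∀ x ∈ m.dom, m.val x ≠ ∞ →
    (∀ p ∈ m.pieces, x ∈ p.1.toSet 0 → LowerApprox (F.uni p.2 x) (m.val x)) ∧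
    ∃ p ∈ m.pieces, x ∈ p.1.toSet 0 ∧ ENNReal.ofReal (F.uni p.2 x) = m.val x

/-- The members that are active at a point. -/
def Msg.active (m : Msg F strict) (x : ℝ) : List F.Uni :=
  (m.pieces.filter fun p => p.1.memB 0 x).map Prod.snd

theorem Msg.mem_active {m : Msg F strict} {x : ℝ} {f : F.Uni} :
    f ∈ m.active x ↔ ∃ p ∈ m.pieces, x ∈ p.1.toSet 0 ∧ p.2 = f := by
  simp only [active, List.mem_map, List.mem_filter, AffInterval.memB_iff, and_assoc]

theorem Msg.Valid.mem_dom_iff {m : Msg F strict} (h : m.Valid) (x : ℝ) :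
    x ∈ m.dom ↔ m.active x ≠ [] := by
  rw [h.1, List.ne_nil_iff_exists_cons]
  constructor
  · rintro ⟨p, hp, hx⟩
    have := mem_active.2 ⟨p, hp, hx, rfl⟩
    cases h : m.active x with
    | nil => rw [h] at this; cases this
    | cons f l => exact ⟨f, l, rfl⟩
  · rintro ⟨f, l, h⟩
    obtain ⟨p, hp, hx, _⟩ := mem_active.1 (h ▸ List.mem_cons_self : f ∈ m.active x)
    exact ⟨p, hp, hx⟩

/-- The line of constant height at a bound. -/
def AffBound.line (b : AffBound) : List (ℝ × ℝ) := b.elim [] fun _ _ c => [(0, c)]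

/-- The lines at the ends of the intervals of a message. -/
def Msg.lines (m : Msg F strict) : List (ℝ × ℝ) :=
  m.pieces.flatMap fun p => p.1.l.line ++ p.1.u.line

theorem AffBound.above_of_signCompat {b : AffBound} (hb : b.IsStrict → strict = true) {u v : ℝ}
    (h : ∀ ℓ ∈ b.line, SignCompat strict (u - ℓ.2) (v - ℓ.2)) (hu : u ∈ b.above 0) :
    v ∈ b.above 0 := by
  rcases b with _ | ⟨_ | _, a, c⟩
  · trivial
  · have := (h (0, c) (by simp [line, elim])).2.1
    simp_all [above]
  · have := (h (0, c) (by simp [line, elim])).2.2 (hb rfl)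
    simp only [above, Set.mem_Ioi, mul_zero, zero_add] at hu ⊢
    by_contra hv
    have := this.1 (by simpa using hv)
    simp only at this
    linarith

theorem AffBound.below_of_signCompat {b : AffBound} (hb : b.IsStrict → strict = true) {u v : ℝ}
    (h : ∀ ℓ ∈ b.line, SignCompat strict (u - ℓ.2) (v - ℓ.2)) (hu : u ∈ b.below 0) :
    v ∈ b.below 0 := by
  rcases b with _ | ⟨_ | _, a, c⟩
  · trivial
  · have := (h (0, c) (by simp [line, elim])).1
    simp_all [below]
  · have := (h (0, c) (by simp [line, elim])).2.2 (hb rfl)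
    simp only [below, Set.mem_Iio, mul_zero, zero_add] at hu ⊢
    by_contra hv
    have := this.2 (by simpa using hv)
    simp only at this
    linarith

theorem Msg.active_subset_of_signCompat {s : Bool} {m : Msg F strict} {u v : ℝ}
    (hs : strict = true → s = true)
    (h : ∀ ℓ ∈ m.lines, SignCompat s (u - ℓ.2) (v - ℓ.2)) : m.active u ⊆ m.active v := by
  intro f hf
  obtain ⟨p, hp, hu, rfl⟩ := mem_active.1 hf
  refine mem_active.2 ⟨p, hp, ⟨?_, ?_⟩, rfl⟩
  · exact AffBound.above_of_signCompat (fun h => hs (p.1.l_ok h)) (fun ℓ hℓ => h ℓ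
      (List.mem_flatMap.2 ⟨p, hp, List.mem_append_left _ hℓ⟩)) hu.1
  · exact AffBound.below_of_signCompat (fun h => hs (p.1.u_ok h)) (fun ℓ hℓ => h ℓ
      (List.mem_flatMap.2 ⟨p, hp, List.mem_append_right _ hℓ⟩)) hu.2

theorem Msg.lines_slope {m : Msg F strict} {ℓ : ℝ × ℝ} (h : ℓ ∈ m.lines) : ℓ = (0, ℓ.2) := by
  have key : ∀ b : AffBound, ℓ ∈ b.line → ℓ = (0, ℓ.2) := by
    intro b hb
    rcases b with _ | ⟨s, a, c⟩ <;> simp_all [AffBound.line, AffBound.elim]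
  obtain ⟨p, _, h⟩ := List.mem_flatMap.1 h
  rcases List.mem_append.1 h with h | h <;> exact key _ h

/-! ### Elimination of a variable -/

/-- What matters for the elimination of the variable `var` in favour of its only neighbour `parent`: the
clauses and bivariate factors with `var`, and the messages to `var`. -/
structure Leaf (F : FunFamily) (strict : Bool) where
  var : ℕ
  parent : ℕ
  clauses : List (List RawLit)
  factors : List F.Bi
  msgs : List (Msg F strict)

instance : Enc (Leaf F strict) := ⟨fun p => enc (p.var, p.parent, p.clauses, p.factors, p.msgs)⟩

namespace Leaf

/-- The value `y` of the variable is feasible for the value `x` of its neighbour. -/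
def Feas (p : Leaf F strict) (y x : ℝ) : Prop :=
  (∀ C ∈ p.clauses, ∃ l ∈ C, l.test (l.diff p.var p.parent y x) = true) ∧ ∀ m ∈ p.msgs, y ∈ m.dom

/-- The product of factors and messages. -/
def weight (K : Toolkit M F strict) (p : Leaf F strict) (y x : ℝ) : ℝ≥0∞ :=
  (p.factors.map fun f => ENNReal.ofReal (K.ev f y x)).prod * (p.msgs.map fun m => m.val y).prod

/-- The conditions under which elimination is correct. -/
structure Valid (K : Toolkit M F strict) (p : Leaf F strict) : Prop where
  msgs : ∀ m ∈ p.msgs, m.Valid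
  factors : ∀ f ∈ p.factors, ∀ y x, 0 ≤ K.ev f y x
  clauses : strict = false → ∀ C ∈ p.clauses, ∀ l ∈ C, l.1 = true
  nonempty : p.msgs ≠ []

/-- The lines along which the feasible values of the variable can change. -/
def lines (p : Leaf F strict) : List (ℝ × ℝ) :=
  (p.clauses.flatMap fun C => C.map fun l => l.line p.var p.parent) ++ p.msgs.flatMap Msg.lines

/-- The values of the neighbour at which the arrangement of these lines can change. -/
def breaks (p : Leaf F strict) : List (ℝ × ℝ) :=
  (p.lines.flatMap fun ℓ => p.lines.map fun ℓ' => (0, crossing ℓ ℓ')) ++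
    p.clauses.flatMap fun C => C.map fun l => (0, l.break p.parent)

/-- A test for feasibility. -/
def feasB (p : Leaf F strict) (y x : ℝ) : Bool :=
  p.clauses.all (fun C => C.any fun l => l.test (l.diff p.var p.parent y x)) &&
    p.msgs.all fun m => !(m.active y).isEmpty

/-- The product of the factors and the messages near the value `y`. -/
def product (K : Toolkit M F strict) (p : Leaf F strict) (y : ℝ) : List F.Bi :=
  K.prodBi (p.factors ++ p.msgs.flatMap fun m => (K.maxUni (m.active y)).map K.lift)

/-- The pieces of the plane on which a member of the family gives the weight: over the interval `q.1` of the
neighbour, the variable ranges in `q.2.1`, and the weight is `q.2.2`. -/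
def pieces (K : Toolkit M F strict) (p : Leaf F strict) :
    List (AffInterval strict × AffInterval strict × F.Bi) :=
  (cells strict p.breaks 0).flatMap fun T => (cells strict p.lines T.2).flatMap fun I =>
    bif p.feasB I.2 T.2 then (p.product K I.2).map fun g => (T.1, I.1, g) else []

/-- The message to the neighbour. -/
def message (K : Toolkit M F strict) (p : Leaf F strict) : Msg F strict where
  pieces := (p.pieces K).map fun q => (q.1, K.sup q.2.2 q.2.1)
  dom := {x | ∃ y, p.Feas y x}
  val x := ⨆ (y) (_ : p.Feas y x), p.weight K y x

/-- The choice of the variable, given the value of its neighbour: the best of the points where the pieces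
attain their suprema, or any feasible point if there is none. -/
def choose (K : Toolkit M F strict) (P : List (AffInterval strict × AffInterval strict × F.Bi))
    (x : ℝ) : ℝ :=
  bestOf
    (P.flatMap fun q => bif q.1.memB 0 x && q.2.1.memB x (K.argsup q.2.2 q.2.1 x) then
      [(K.ev q.2.2 (K.argsup q.2.2 q.2.1 x) x, K.argsup q.2.2 q.2.1 x)] else [])
    (((P.filter fun q => q.1.memB 0 x).map fun q => q.2.1.l.between q.2.1.u x).headD 0)

variable {K : Toolkit M F strict} {p : Leaf F strict}

theorem feasB_iff (h : p.Valid K) {y x : ℝ} : p.feasB y x = true ↔ p.Feas y x := by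
  rw [feasB, Bool.and_eq_true, List.all_eq_true, List.all_eq_true, Feas]
  refine and_congr (by simp only [List.any_eq_true]) ?_
  refine forall_congr' fun m => forall_congr' fun hm => ?_
  rw [(h.msgs m hm).mem_dom_iff]
  simp

theorem mem_lines_of_lit {C : List RawLit} (hC : C ∈ p.clauses) {l : RawLit} (hl : l ∈ C) :
    l.line p.var p.parent ∈ p.lines :=
  List.mem_append_left _ (List.mem_flatMap.2 ⟨C, hC, List.mem_map.2 ⟨l, hl, rfl⟩⟩)

theorem mem_lines_of_msg {m : Msg F strict} (hm : m ∈ p.msgs) {ℓ : ℝ × ℝ} (h : ℓ ∈ m.lines) :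
    ℓ ∈ p.lines :=
  List.mem_append_right _ (List.mem_flatMap.2 ⟨m, hm, h⟩)

theorem mem_breaks_of_lit {C : List RawLit} (hC : C ∈ p.clauses) {l : RawLit} (hl : l ∈ C) :
    (0, l.break p.parent) ∈ p.breaks :=
  List.mem_append_right _ (List.mem_flatMap.2 ⟨C, hC, List.mem_map.2 ⟨l, hl, rfl⟩⟩)

theorem mem_breaks_of_lines {ℓ ℓ' : ℝ × ℝ} (h : ℓ ∈ p.lines) (h' : ℓ' ∈ p.lines) :
    (0, crossing ℓ ℓ') ∈ p.breaks :=
  List.mem_append_left _ (List.mem_flatMap.2 ⟨ℓ, h, List.mem_map.2 ⟨ℓ', h', rfl⟩⟩)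

theorem breaks_slope {ℓ : ℝ × ℝ} (h : ℓ ∈ p.breaks) : ℓ = (0, ℓ.2) := by
  simp only [breaks, List.mem_append, List.mem_flatMap, List.mem_map] at h
  rcases h with ⟨_, _, _, _, rfl⟩ | ⟨_, _, _, _, rfl⟩ <;> rfl

/-- The position of `(y, x)` in the arrangement is compatible with that of `(s, t)`. -/
structure Compat (strict : Bool) {s₀ : Bool} (p : Leaf F s₀) (s t y x : ℝ) : Prop where
  lines : ∀ ℓ ∈ p.lines, SignCompat strict (s - lineAt ℓ t) (y - lineAt ℓ x)
  breaks : ∀ ℓ ∈ p.breaks, SignCompat strict (t - ℓ.2) (x - ℓ.2)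

theorem compat_sound {T I : AffInterval strict × ℝ} (hT : T ∈ cells strict p.breaks 0)
    (hI : I ∈ cells strict p.lines T.2) {x : ℝ} (hx : x ∈ T.1.toSet 0) :
    (I.1.toSet x).Nonempty ∧ ∀ y ∈ I.1.toSet x, p.Compat strict I.2 T.2 y x := by
  have h1 : ∀ ℓ ∈ p.breaks, SignCompat strict (T.2 - ℓ.2) (x - ℓ.2) := by
    intro ℓ hℓ
    have := (cells_sound (x := 0) (fun ℓ hℓ ℓ' hℓ' => .refl _) hT).2 x hx ℓ hℓ
    rwa [breaks_slope hℓ, lineAt_zero] at this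
  have h2 := cells_sound (x := x) (fun ℓ hℓ ℓ' hℓ' =>
    .of_crossing (h1 _ (mem_breaks_of_lines hℓ hℓ'))) hI
  exact ⟨h2.1, fun y hy => ⟨h2.2 y hy, h1⟩⟩

theorem compat_complete (p : Leaf F strict) (y x : ℝ) :
    ∃ T ∈ cells strict p.breaks 0, ∃ I ∈ cells strict p.lines T.2,
      x ∈ T.1.toSet 0 ∧ y ∈ I.1.toSet x ∧ p.Compat true I.2 T.2 y x := by
  obtain ⟨T, hT, hx, h1⟩ := cells_complete (strict := strict) (lines := p.breaks) (t := 0) (x := 0)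
    (fun ℓ hℓ ℓ' hℓ' => .refl _) x
  have h1 : ∀ ℓ ∈ p.breaks, SignCompat true (T.2 - ℓ.2) (x - ℓ.2) := by
    intro ℓ hℓ
    have := h1 ℓ hℓ
    rwa [breaks_slope hℓ, lineAt_zero] at this
  obtain ⟨I, hI, hy, h2⟩ := cells_complete (strict := strict) (lines := p.lines) (t := T.2) (x := x)
    (fun ℓ hℓ ℓ' hℓ' => .of_crossing (h1 _ (mem_breaks_of_lines hℓ hℓ'))) y
  exact ⟨T, hT, I, hI, hx, hy, h2, h1⟩

theorem Compat.symm {s t y x : ℝ} (h : p.Compat true s t y x) : p.Compat true y x s t :=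
  ⟨fun ℓ hℓ => (h.lines ℓ hℓ).symm, fun ℓ hℓ => (h.breaks ℓ hℓ).symm⟩

theorem Compat.active_subset {s₀ : Bool} {s t y x : ℝ} (hs : strict = true → s₀ = true)
    (h : p.Compat s₀ s t y x) {m : Msg F strict} (hm : m ∈ p.msgs) : m.active s ⊆ m.active y := by
  refine Msg.active_subset_of_signCompat hs fun ℓ hℓ => ?_
  have := h.lines ℓ (mem_lines_of_msg hm hℓ)
  rwa [Msg.lines_slope hℓ, lineAt_zero, lineAt_zero] at this

theorem Compat.feas {s₀ : Bool} {s t y x : ℝ} (hs : strict = true → s₀ = true)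
    (hp : p.Valid K) (hl : s₀ = false → ∀ C ∈ p.clauses, ∀ l ∈ C, l.1 = true)
    (h : p.Compat s₀ s t y x) (hf : p.Feas s t) : p.Feas y x := by
  refine ⟨fun C hC => ?_, fun m hm => ?_⟩
  · obtain ⟨l, hlC, hl'⟩ := hf.1 C hC
    refine ⟨l, hlC, RawLit.test_of_signCompat (fun h => hl h C hC l hlC) ?_ hl'⟩
    exact RawLit.signCompat_diff (h.lines _ (mem_lines_of_lit hC hlC))
      (h.breaks _ (mem_breaks_of_lit hC hlC))
  · rw [(hp.msgs m hm).mem_dom_iff]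
    have h1 := (hp.msgs m hm).mem_dom_iff s |>.1 (hf.2 m hm)
    intro h2
    have := h.active_subset hs hm
    rw [h2] at this
    exact h1 (List.subset_nil.1 this)

theorem exists_product (hp : p.Valid K) {s : ℝ} (hs : ∀ m ∈ p.msgs, m.active s ≠ []) :
    ∃ g, p.product K s = [g] ∧ ∃ u : Msg F strict → F.Uni,
      (∀ y x, K.ev g y x = (p.factors.map fun f => K.ev f y x).prod *
        (p.msgs.map fun m => F.uni (u m) y).prod) ∧
      ∀ m ∈ p.msgs, ∀ y, IsGreatest {r | ∃ f ∈ m.active s, r = F.uni f y} (F.uni (u m) y) := by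
  have hu : ∀ m ∈ p.msgs, ∃ u : F.Uni, K.maxUni (m.active s) = [u] ∧
      ∀ y, IsGreatest {r | ∃ f ∈ m.active s, r = F.uni f y} (F.uni u y) :=
    fun m hm => K.maxUni_spec _ (hs m hm)
  obtain ⟨m₀, hm₀⟩ := List.exists_mem_of_ne_nil _ hp.nonempty
  obtain ⟨u₀, h₀, _⟩ := hu m₀ hm₀
  let u : Msg F strict → F.Uni := fun m => (K.maxUni (m.active s)).headD u₀
  have hu1 : ∀ m ∈ p.msgs, K.maxUni (m.active s) = [u m] := by
    intro m hm
    obtain ⟨v, hv, _⟩ := hu m hm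
    simp [u, hv]
  obtain ⟨g, hg, hg'⟩ := K.prodBi_spec
    (p.factors ++ p.msgs.flatMap fun m => (K.maxUni (m.active s)).map K.lift) (by
      intro h
      rw [List.append_eq_nil_iff, List.flatMap_eq_nil_iff] at h
      have := h.2 m₀ hm₀
      simp [h₀] at this)
  refine ⟨g, hg, u, fun y x => ?_, fun m hm y => ?_⟩
  · rw [hg', List.map_append, List.prod_append, List.prod_map_flatMap]
    congr 2
    refine List.map_congr_left fun m hm => ?_
    rw [hu1 m hm]
    simp [K.ev_lift]
  · obtain ⟨v, hv, hv'⟩ := hu m hm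
    rw [hu1 m hm, List.cons.injEq] at hv
    rw [hv.1]
    exact hv' y

theorem mem_pieces {q : AffInterval strict × AffInterval strict × F.Bi} : q ∈ p.pieces K ↔
    ∃ T ∈ cells strict p.breaks 0, ∃ I ∈ cells strict p.lines T.2, p.feasB I.2 T.2 = true ∧
      ∃ g ∈ p.product K I.2, (T.1, I.1, g) = q := by
  simp only [pieces, List.mem_flatMap]
  refine exists_congr fun T => and_congr_right fun _ => exists_congr fun I =>
    and_congr_right fun _ => ?_
  cases p.feasB I.2 T.2 <;> simp

/-- The pieces consist of feasible points, and their members do not exceed the weight. -/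
theorem pieces_sound (hp : p.Valid K) {q : AffInterval strict × AffInterval strict × F.Bi}
    (hq : q ∈ p.pieces K) {x : ℝ} (hx : x ∈ q.1.toSet 0) :
    (q.2.1.toSet x).Nonempty ∧ ∀ y ∈ q.2.1.toSet x,
      p.Feas y x ∧ LowerApprox (K.ev q.2.2 y x) (p.weight K y x) := by
  obtain ⟨T, hT, I, hI, hfeas, g, hg, rfl⟩ := mem_pieces.1 hq
  obtain ⟨h1, h2⟩ := compat_sound hT hI hx
  have hf := (feasB_iff hp).1 hfeas
  refine ⟨h1, fun y hy => ⟨(h2 y hy).feas id hp hp.clauses hf, ?_⟩⟩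
  obtain ⟨g', hg', u, hu1, hu2⟩ := exists_product hp fun m hm =>
    ((hp.msgs m hm).mem_dom_iff I.2).1 (hf.2 m hm)
  rw [hg', List.mem_singleton] at hg
  simp only
  rw [hg, hu1, weight]
  refine (ExactApprox.list_prod fun f hf => exactApprox_ofReal (hp.factors f hf y x)).lower.mul
    (LowerApprox.list_prod fun m hm => ?_)
  obtain ⟨f, hfa, hfe⟩ := (hu2 m hm y).1
  obtain ⟨r, hr, hry, hrf⟩ := Msg.mem_active.1 ((h2 y hy).active_subset id hm hfa)
  intro hM
  have h3 := ((hp.msgs m hm).2 y (((hp.msgs m hm).1 y).2 ⟨r, hr, hry⟩) hM).1 r hr hry hM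
  rwa [hrf, ← hfe] at h3

/-- Every feasible point lies in a piece whose member gives the weight there. -/
theorem pieces_complete (hp : p.Valid K) {y x : ℝ} (hf : p.Feas y x) :
    ∃ q ∈ p.pieces K, x ∈ q.1.toSet 0 ∧ y ∈ q.2.1.toSet x ∧
      ExactApprox (K.ev q.2.2 y x) (p.weight K y x) := by
  obtain ⟨T, hT, I, hI, hx, hy, hc⟩ := compat_complete p y x
  have hf' : p.Feas I.2 T.2 := hc.symm.feas (fun _ => rfl) hp (by simp) hf
  obtain ⟨g, hg, u, hu1, hu2⟩ := exists_product hp fun m hm =>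
    ((hp.msgs m hm).mem_dom_iff I.2).1 (hf'.2 m hm)
  refine ⟨(T.1, I.1, g), mem_pieces.2 ⟨T, hT, I, hI, (feasB_iff hp).2 hf', g, by simp [hg], rfl⟩,
    hx, hy, ?_⟩
  simp only
  rw [hu1, weight]
  refine (ExactApprox.list_prod fun f hf => exactApprox_ofReal (hp.factors f hf y x)).mul
    (ExactApprox.list_prod fun m hm => ?_)
  intro hM
  obtain ⟨h1, r, hr, hry, hre⟩ := (hp.msgs m hm).2 y (hf.2 m hm) hM
  obtain ⟨f, hfa, hfe⟩ := (hu2 m hm y).1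
  obtain ⟨r', hr', hry', hrf'⟩ := Msg.mem_active.1 (hc.active_subset (fun _ => rfl) hm hfa)
  obtain ⟨h2, h3⟩ := h1 r' hr' hry' hM
  rw [hrf', ← hfe] at h2 h3
  refine ⟨h2, le_antisymm h3 ?_⟩
  rw [← hre]
  refine ENNReal.ofReal_le_ofReal ((hu2 m hm y).2 ⟨r.2, ?_, rfl⟩)
  exact hc.symm.active_subset (fun _ => rfl) hm (Msg.mem_active.2 ⟨r, hr, hry, rfl⟩)

theorem weight_le_val {y x : ℝ} (hf : p.Feas y x) : p.weight K y x ≤ (p.message K).val x :=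
  le_iSup₂ (f := fun y (_ : p.Feas y x) => p.weight K y x) y hf

theorem lowerApprox_val (hp : p.Valid K) {q : AffInterval strict × AffInterval strict × F.Bi}
    (hq : q ∈ p.pieces K) {x : ℝ} (hx : x ∈ q.1.toSet 0) {y : ℝ} (hy : y ∈ q.2.1.toSet x)
    (hM : (p.message K).val x ≠ ∞) :
    0 ≤ K.ev q.2.2 y x ∧ K.ev q.2.2 y x ≤ ((p.message K).val x).toReal := by
  obtain ⟨hf, ha⟩ := (pieces_sound hp hq hx).2 y hy
  have hle := weight_le_val (K := K) hf
  obtain ⟨h1, h2⟩ := ha (ne_top_of_le_ne_top hM hle)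
  exact ⟨h1, (ENNReal.ofReal_le_iff_le_toReal hM).1 (h2.trans hle)⟩

/-- Where the message is finite, the symbolic supremum over a piece is the supremum. -/
theorem isLUB_piece (hp : p.Valid K) {q : AffInterval strict × AffInterval strict × F.Bi}
    (hq : q ∈ p.pieces K) {x : ℝ} (hx : x ∈ q.1.toSet 0) (hM : (p.message K).val x ≠ ∞) :
    IsLUB ((fun y => K.ev q.2.2 y x) '' q.2.1.toSet x) (F.uni (K.sup q.2.2 q.2.1) x) := by
  have h1 := isLUB_csSup ((pieces_sound hp hq hx).1.image fun y => K.ev q.2.2 y x)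
    ⟨((p.message K).val x).toReal, by
      rintro _ ⟨y, hy, rfl⟩; exact (lowerApprox_val hp hq hx hy hM).2⟩
  rwa [← K.sup_spec _ _ _ _ h1] at h1

theorem message_valid (hp : p.Valid K) : (p.message K).Valid := by
  have hdom : ∀ x, x ∈ (p.message K).dom ↔ ∃ r ∈ (p.message K).pieces, x ∈ r.1.toSet 0 := by
    intro x
    constructor
    · rintro ⟨y, hy⟩
      obtain ⟨q, hq, hx, _⟩ := pieces_complete hp hy
      exact ⟨_, List.mem_map.2 ⟨q, hq, rfl⟩, hx⟩
    · rintro ⟨r, hr, hx⟩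
      obtain ⟨q, hq, rfl⟩ := List.mem_map.1 hr
      obtain ⟨⟨y, hy⟩, h⟩ := pieces_sound hp hq hx
      exact ⟨y, (h y hy).1⟩
  refine ⟨hdom, fun x hxd hM => ?_⟩
  have hlow : ∀ r ∈ (p.message K).pieces, x ∈ r.1.toSet 0 →
      LowerApprox (F.uni r.2 x) ((p.message K).val x) := by
    intro r hr hx _
    obtain ⟨q, hq, rfl⟩ := List.mem_map.1 hr
    have hlub := isLUB_piece hp hq hx hM
    obtain ⟨y, hy⟩ := (pieces_sound hp hq hx).1
    refine ⟨(lowerApprox_val hp hq hx hy hM).1.trans (hlub.1 ⟨y, hy, rfl⟩), ?_⟩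
    refine (ENNReal.ofReal_le_iff_le_toReal hM).2 (hlub.2 ?_)
    rintro _ ⟨y, hy, rfl⟩
    exact (lowerApprox_val hp hq hx hy hM).2
  refine ⟨hlow, ?_⟩
  obtain ⟨r, hr, hxr, hmax⟩ := List.exists_max_of_exists (p.message K).pieces
    (fun r => x ∈ r.1.toSet 0) (fun r => F.uni r.2 x) ((hdom x).1 hxd)
  refine ⟨r, hr, hxr, le_antisymm (hlow r hr hxr hM).2 (iSup₂_le fun y hy => ?_)⟩
  obtain ⟨q, hq, hx, hyq, hex⟩ := pieces_complete hp hy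
  rw [← (hex (ne_top_of_le_ne_top hM (weight_le_val hy))).2]
  refine ENNReal.ofReal_le_ofReal (((isLUB_piece hp hq hx hM).1 ⟨y, hyq, rfl⟩).trans ?_)
  exact hmax _ (List.mem_map.2 ⟨q, hq, rfl⟩) hx

theorem _root_.AffInterval.between_mem {I : AffInterval strict} {x : ℝ} (h : (I.toSet x).Nonempty) :
    I.l.between I.u x ∈ I.toSet x := by
  obtain ⟨l, u, _, _⟩ := I
  obtain ⟨y, hl, hu⟩ := h
  rcases l with _ | ⟨_ | _, a, c⟩ <;> rcases u with _ | ⟨_ | _, a', c'⟩ <;>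
    simp only [AffInterval.toSet, AffBound.above, AffBound.below, AffBound.between, AffBound.elim,
      Set.mem_inter_iff, Set.mem_univ, Set.mem_Ici, Set.mem_Iic, Set.mem_Ioi, Set.mem_Iio,
      true_and, and_true] at * <;> first | trivial | linarith | constructor <;> linarith

theorem mem_candidates {P : List (AffInterval strict × AffInterval strict × F.Bi)} {x : ℝ}
    {c : ℝ × ℝ} :
    c ∈ (P.flatMap fun q => bif q.1.memB 0 x && q.2.1.memB x (K.argsup q.2.2 q.2.1 x) then
      [(K.ev q.2.2 (K.argsup q.2.2 q.2.1 x) x, K.argsup q.2.2 q.2.1 x)] else []) ↔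
    ∃ q ∈ P, x ∈ q.1.toSet 0 ∧ K.argsup q.2.2 q.2.1 x ∈ q.2.1.toSet x ∧
      c = (K.ev q.2.2 (K.argsup q.2.2 q.2.1 x) x, K.argsup q.2.2 q.2.1 x) := by
  rw [List.mem_flatMap]
  refine exists_congr fun q => and_congr_right fun _ => ?_
  rw [← AffInterval.memB_iff, ← AffInterval.memB_iff, ← and_assoc, ← Bool.and_eq_true]
  cases q.1.memB 0 x && q.2.1.memB x (K.argsup q.2.2 q.2.1 x) <;> simp

theorem choose_feas (hp : p.Valid K) {x : ℝ} (hx : x ∈ (p.message K).dom) :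
    p.Feas (choose K (p.pieces K) x) x := by
  rw [choose]
  by_cases hl : (p.pieces K).flatMap (fun q =>
      bif q.1.memB 0 x && q.2.1.memB x (K.argsup q.2.2 q.2.1 x) then
      [(K.ev q.2.2 (K.argsup q.2.2 q.2.1 x) x, K.argsup q.2.2 q.2.1 x)] else []) = []
  · rw [hl, bestOf]
    obtain ⟨y, hy⟩ := hx
    obtain ⟨q, hq, hxq, _⟩ := pieces_complete hp hy
    have hmem : q ∈ (p.pieces K).filter fun q => q.1.memB 0 x :=
      List.mem_filter.2 ⟨hq, (AffInterval.memB_iff _ _ _).2 hxq⟩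
    cases hL : (p.pieces K).filter fun q => q.1.memB 0 x with
    | nil => rw [hL] at hmem; cases hmem
    | cons q' L =>
      have hq' : q' ∈ (p.pieces K).filter fun q => q.1.memB 0 x := by rw [hL]; simp
      obtain ⟨hq1, hq2⟩ := List.mem_filter.1 hq'
      have hs := pieces_sound hp hq1 ((AffInterval.memB_iff _ _ _).1 hq2)
      exact (hs.2 _ (AffInterval.between_mem hs.1)).1
  · obtain ⟨c, hc, hb, _⟩ := bestOf_spec _
      ((((p.pieces K).filter fun q => q.1.memB 0 x).map fun q =>
        q.2.1.l.between q.2.1.u x).headD 0) hl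
    rw [hb]
    obtain ⟨q, hq, hxq, hyq, rfl⟩ := mem_candidates.1 hc
    exact ((pieces_sound hp hq hxq).2 _ hyq).1

/-- If the supremum in a message is finite and attained, then it is attained by the chosen point. -/
theorem choose_exact (hp : p.Valid K) {x : ℝ} (hM : (p.message K).val x ≠ ∞)
    (h : ∃ y, p.Feas y x ∧ p.weight K y x = (p.message K).val x) :
    p.weight K (choose K (p.pieces K) x) x = (p.message K).val x := by
  obtain ⟨y, hy, hyw⟩ := h
  refine le_antisymm (weight_le_val (choose_feas hp ⟨y, hy⟩)) ?_
  obtain ⟨q, hq, hxq, hyq, hex⟩ := pieces_complete hp hy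
  rw [hyw] at hex
  have hmax : ∀ z ∈ q.2.1.toSet x, K.ev q.2.2 z x ≤ K.ev q.2.2 y x := by
    intro z hz
    refine (lowerApprox_val hp hq hxq hz hM).2.trans ?_
    rw [← (hex hM).2, ENNReal.toReal_ofReal (hex hM).1]
  have harg := K.argsup_spec q.2.2 q.2.1 x ⟨y, hyq, hmax⟩
  have hcand := mem_candidates.2 ⟨q, hq, hxq, harg.1, rfl⟩
  obtain ⟨c, hc, hb, hbest⟩ := bestOf_spec _
    ((((p.pieces K).filter fun q => q.1.memB 0 x).map fun q =>
      q.2.1.l.between q.2.1.u x).headD 0) (List.ne_nil_of_mem hcand)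
  obtain ⟨q', hq', hxq', hyq', rfl⟩ := mem_candidates.1 hc
  obtain ⟨hf, hlow⟩ := (pieces_sound hp hq' hxq').2 _ hyq'
  have h1 := (hlow (ne_top_of_le_ne_top hM (weight_le_val hf))).2
  rw [choose, hb]
  refine le_trans ?_ h1
  rw [← (hex hM).2]
  exact ENNReal.ofReal_le_ofReal ((harg.2 y hyq).trans (hbest _ hcand))

/-- If all suprema over intervals are attained, then messages are finite and attained. -/
theorem message_attained (hp : p.Valid K)
    (hK : ∀ f (I : AffInterval strict) x, (I.toSet x).Nonempty →
      ∃ y, IsArgmaxOn (fun y => K.ev f y x) (I.toSet x) y)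
    (hm : ∀ m ∈ p.msgs, ∀ x, m.val x ≠ ∞) (x : ℝ) :
    (p.message K).val x ≠ ∞ ∧ (x ∈ (p.message K).dom →
      ∃ y, p.Feas y x ∧ p.weight K y x = (p.message K).val x) := by
  have hw : ∀ y, p.weight K y x ≠ ∞ := by
    intro y
    exact ENNReal.mul_ne_top (ENNReal.list_prod_ne_top fun f _ => ENNReal.ofReal_ne_top)
      (ENNReal.list_prod_ne_top fun m hm' => hm m hm' y)
  by_cases hx : x ∈ (p.message K).dom
  · obtain ⟨r, hr, hxr⟩ := ((message_valid hp).1 x).1 hx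
    obtain ⟨q, hq, rfl⟩ := List.mem_map.1 hr
    have harg : ∀ q' ∈ p.pieces K, x ∈ q'.1.toSet 0 →
        ∃ y, IsArgmaxOn (fun y => K.ev q'.2.2 y x) (q'.2.1.toSet x) y :=
      fun q' hq' hx' => hK _ _ _ (pieces_sound hp hq' hx').1
    obtain ⟨q', hq', ⟨hx', y', hy'⟩, hmax⟩ := List.exists_max_of_exists (p.pieces K)
      (fun q => x ∈ q.1.toSet 0 ∧ ∃ y, IsArgmaxOn (fun y => K.ev q.2.2 y x) (q.2.1.toSet x) y)
      (fun q => F.uni (K.sup q.2.2 q.2.1) x) ⟨q, hq, hxr, harg q hq hxr⟩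
    have hsup : ∀ (q : AffInterval strict × AffInterval strict × F.Bi) (y : ℝ),
        IsArgmaxOn (fun y => K.ev q.2.2 y x) (q.2.1.toSet x) y →
        F.uni (K.sup q.2.2 q.2.1) x = K.ev q.2.2 y x := by
      intro q y hy
      refine K.sup_spec _ _ _ _ ⟨?_, fun b hb => hb ⟨y, hy.1, rfl⟩⟩
      rintro _ ⟨z, hz, rfl⟩
      exact hy.2 z hz
    obtain ⟨hf', hlow'⟩ := (pieces_sound hp hq' hx').2 y' hy'.1
    have hle : (p.message K).val x ≤ p.weight K y' x := by
      refine iSup₂_le fun y hy => ?_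
      obtain ⟨q₁, hq₁, hx₁, hy₁, hex⟩ := pieces_complete hp hy
      obtain ⟨y₁, hy₁'⟩ := harg q₁ hq₁ hx₁
      rw [← (hex (hw y)).2]
      refine le_trans (ENNReal.ofReal_le_ofReal ?_) (hlow' (hw y')).2
      have h1 := hmax q₁ hq₁ ⟨hx₁, y₁, hy₁'⟩
      rw [hsup q₁ y₁ hy₁', hsup q' y' hy'] at h1
      exact (hy₁'.2 y hy₁).trans h1
    exact ⟨ne_top_of_le_ne_top (hw y') hle, fun _ => ⟨y', hf', le_antisymm (weight_le_val hf') hle⟩⟩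
  · refine ⟨?_, fun h => absurd h hx⟩
    have : (p.message K).val x = 0 := by
      rw [← nonpos_iff_eq_zero]
      exact iSup₂_le fun y hy => absurd ⟨y, hy⟩ hx
    simp [this]

end Leaf

namespace PolyTime

@[fun_prop]
theorem rawLitTest {l : α → RawLit} {u : α → ℝ} (hl : PolyTime M l) (hu : PolyTime M u) :
    PolyTime M fun a => (l a).test (u a) := by unfold RawLit.test; fun_prop

@[fun_prop]
theorem rawLitDiff {l : α → RawLit} {i j : α → ℕ} {y x : α → ℝ} (hl : PolyTime M l)
    (hi : PolyTime M i) (hj : PolyTime M j) (hy : PolyTime M y) (hx : PolyTime M x) :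
    PolyTime M fun a => (l a).diff (i a) (j a) (y a) (x a) := by unfold RawLit.diff; fun_prop

@[fun_prop]
theorem rawLitLine {l : α → RawLit} {i j : α → ℕ} (hl : PolyTime M l) (hi : PolyTime M i)
    (hj : PolyTime M j) : PolyTime M fun a => (l a).line (i a) (j a) := by
  unfold RawLit.line; fun_prop

@[fun_prop]
theorem rawLitBreak {l : α → RawLit} {j : α → ℕ} (hl : PolyTime M l) (hj : PolyTime M j) :
    PolyTime M fun a => (l a).break (j a) := by unfold RawLit.break; fun_prop

@[fun_prop]
theorem msgPieces {m : α → Msg F strict} (hm : PolyTime M m) :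
    PolyTime M fun a => (m a).pieces :=
  comp (g := fun m : Msg F strict => m.pieces) (of_enc_eq fun _ => rfl) hm

@[fun_prop]
theorem msgMk {P : α → List (AffInterval strict × F.Uni)} {d : α → Set ℝ} {v : α → ℝ → ℝ≥0∞}
    (hP : PolyTime M P) : PolyTime M fun a => (⟨P a, d a, v a⟩ : Msg F strict) := by
  obtain ⟨p, q, h⟩ := hP
  exact ⟨p, q, h⟩

@[fun_prop]
theorem msgActive {m : α → Msg F strict} {x : α → ℝ} (hm : PolyTime M m) (hx : PolyTime M x) :
    PolyTime M fun a => (m a).active (x a) := by unfold Msg.active; fun_prop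

@[fun_prop]
theorem msgLines {m : α → Msg F strict} (hm : PolyTime M m) : PolyTime M fun a => (m a).lines := by
  unfold Msg.lines AffBound.line; fun_prop

theorem leafTuple {p : α → Leaf F strict} (hp : PolyTime M p) :
    PolyTime M fun a => ((p a).var, (p a).parent, (p a).clauses, (p a).factors, (p a).msgs) :=
  comp (g := fun p : Leaf F strict => (p.var, p.parent, p.clauses, p.factors, p.msgs))
    (of_enc_eq fun _ => rfl) hp

@[fun_prop]
theorem leafVar {p : α → Leaf F strict} (hp : PolyTime M p) : PolyTime M fun a => (p a).var :=
  prodFst (leafTuple hp)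

@[fun_prop]
theorem leafParent {p : α → Leaf F strict} (hp : PolyTime M p) :
    PolyTime M fun a => (p a).parent := prodFst (prodSnd (leafTuple hp))

@[fun_prop]
theorem leafClauses {p : α → Leaf F strict} (hp : PolyTime M p) :
    PolyTime M fun a => (p a).clauses := prodFst (prodSnd (prodSnd (leafTuple hp)))

@[fun_prop]
theorem leafFactors {p : α → Leaf F strict} (hp : PolyTime M p) :
    PolyTime M fun a => (p a).factors := prodFst (prodSnd (prodSnd (prodSnd (leafTuple hp))))

@[fun_prop]
theorem leafMsgs {p : α → Leaf F strict} (hp : PolyTime M p) :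
    PolyTime M fun a => (p a).msgs := prodSnd (prodSnd (prodSnd (prodSnd (leafTuple hp))))

@[fun_prop]
theorem leafMk {i j : α → ℕ} {C : α → List (List RawLit)} {f : α → List F.Bi}
    {m : α → List (Msg F strict)} (hi : PolyTime M i) (hj : PolyTime M j) (hC : PolyTime M C)
    (hf : PolyTime M f) (hm : PolyTime M m) :
    PolyTime M fun a => (⟨i a, j a, C a, f a, m a⟩ : Leaf F strict) := by
  obtain ⟨p, q, h⟩ := prodMk hi (prodMk hj (prodMk hC (prodMk hf hm)))
  exact ⟨p, q, h⟩

@[fun_prop]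
theorem leafLines {p : α → Leaf F strict} (hp : PolyTime M p) :
    PolyTime M fun a => (p a).lines := by unfold Leaf.lines; fun_prop

@[fun_prop]
theorem leafBreaks {p : α → Leaf F strict} (hp : PolyTime M p) :
    PolyTime M fun a => (p a).breaks := by unfold Leaf.breaks; fun_prop

@[fun_prop]
theorem leafFeasB {p : α → Leaf F strict} {y x : α → ℝ} (hp : PolyTime M p) (hy : PolyTime M y)
    (hx : PolyTime M x) : PolyTime M fun a => (p a).feasB (y a) (x a) := by
  unfold Leaf.feasB; fun_prop

@[fun_prop]
theorem leafProduct {K : Toolkit M F strict} {p : α → Leaf F strict} {y : α → ℝ}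
    (hp : PolyTime M p) (hy : PolyTime M y) : PolyTime M fun a => (p a).product K (y a) := by
  unfold Leaf.product; fun_prop

@[fun_prop]
theorem leafPieces {K : Toolkit M F strict} {p : α → Leaf F strict} (hp : PolyTime M p) :
    PolyTime M fun a => (p a).pieces K := by unfold Leaf.pieces; fun_prop

@[fun_prop]
theorem leafMessage {K : Toolkit M F strict} {p : α → Leaf F strict} (hp : PolyTime M p) :
    PolyTime M fun a => (p a).message K := by unfold Leaf.message; fun_prop

@[fun_prop]
theorem leafChoose {K : Toolkit M F strict}
    {P : α → List (AffInterval strict × AffInterval strict × F.Bi)} {x : α → ℝ}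
    (hP : PolyTime M P) (hx : PolyTime M x) : PolyTime M fun a => Leaf.choose K (P a) (x a) := by
  unfold Leaf.choose; fun_prop

end PolyTime

/-! ### Rounds of elimination -/

/-- The problem that is left after some variables have been eliminated: the remaining variables, the clauses
and bivariate factors of these variables, and messages, each with the variable to which it was sent.  The
number `root` is an auxiliary variable, to which isolated variables send their messages. -/
structure State (F : FunFamily) (strict : Bool) where
  root : ℕ
  act : List ℕ
  clauses : List (List RawLit)
  pairs : List ((ℕ × ℕ) × F.Bi)
  msgs : List (ℕ × Msg F strict)

instance : Enc (State F strict) := ⟨fun S => enc (S.root, S.act, S.clauses, S.pairs, S.msgs)⟩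

/-- The variable `i` appears in a clause. -/
def clauseVar (C : List RawLit) (i : ℕ) : Bool := C.any fun l => !eqB (coef l.2.2.1 i) 0

/-- The variable `i` belongs to a pair. -/
def pairVar {β : Type} (e : (ℕ × ℕ) × β) (i : ℕ) : Bool := eqN e.1.1 i || eqN e.1.2 i

namespace State

/-- Adjacency in the global graph of the state: different variables with a common clause or factor. -/
def adj (S : State F strict) (i j : ℕ) : Bool :=
  !eqN i j && (S.clauses.any (fun C => clauseVar C i && clauseVar C j) ||
    S.pairs.any fun e => pairVar e i && pairVar e j)

/-- The remaining neighbours of a variable. -/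
def nbrs (S : State F strict) (i : ℕ) : List ℕ := S.act.filter (S.adj i)

/-- Variables to be eliminated next: those with at most one neighbour, except for the larger one of two variables
that have no neighbours but each other. -/
def isLeaf (S : State F strict) (i : ℕ) : Bool :=
  (S.nbrs i).all (fun j => (S.nbrs i).all fun k => eqN j k) &&
    (S.nbrs i).all fun j => (S.nbrs j).any (fun k => !eqN k i) || ltN i j

/-- The variables that are eliminated in the next round. -/
def leaves (S : State F strict) : List ℕ := S.act.filter S.isLeaf

/-- The neighbour of a leaf. -/
def parent (S : State F strict) (i : ℕ) : ℕ := (S.nbrs i).headD S.root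

/-- A leaf with its neighbour and all clauses, factors and messages in which it occurs. -/
def leaf (S : State F strict) (i : ℕ) : Leaf F strict where
  var := i
  parent := S.parent i
  clauses := S.clauses.filter fun C => clauseVar C i
  factors := (S.pairs.filter fun e => pairVar e i).map Prod.snd
  msgs := (S.msgs.filter fun m => eqN m.1 i).map Prod.snd

/-- The message of a leaf; the first toolkit is for variables that precede their neighbours. -/
def message (K : Bool → Toolkit M F strict) (S : State F strict) (i : ℕ) : Msg F strict :=
  (S.leaf i).message (K (ltN i (S.parent i)))

/-- Elimination of all leaves. -/
def round (K : Bool → Toolkit M F strict) (S : State F strict) : State F strict where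
  root := S.root
  act := S.act.filter fun i => !S.isLeaf i
  clauses := S.clauses.filter fun C => !S.leaves.any (clauseVar C)
  pairs := S.pairs.filter fun e => !S.leaves.any (pairVar e)
  msgs := (S.msgs.filter fun m => !S.leaves.any (eqN m.1)) ++
    S.leaves.map fun i => (S.parent i, S.message K i)

/-- The type of what is remembered of a leaf for choosing its value: its number, its neighbour, and the pieces
of its weight. -/
abbrev _root_.Record (F : FunFamily) (strict : Bool) :=
  ℕ × ℕ × List (AffInterval strict × AffInterval strict × F.Bi)

/-- What a round remembers of its leaves. -/
def records (K : Bool → Toolkit M F strict) (S : State F strict) : List (Record F strict) :=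
  S.leaves.map fun i => (i, S.parent i, (S.leaf i).pieces (K (ltN i (S.parent i))))

/-- The choice of values for the leaves, given the values of their neighbours. -/
def _root_.assignLeaves (K : Bool → Toolkit M F strict) (R : List (Record F strict))
    (a : List (ℕ × ℝ)) : List (ℕ × ℝ) :=
  R.map (fun r => (r.1, Leaf.choose (K (ltN r.1 r.2.1)) r.2.2 (lookupVar r.2.1 a))) ++ a

end State

namespace PolyTime

@[fun_prop]
theorem clauseVar {C : α → List RawLit} {i : α → ℕ} (hC : PolyTime M C) (hi : PolyTime M i) :
    PolyTime M fun a => clauseVar (C a) (i a) := by unfold _root_.clauseVar; fun_prop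

@[fun_prop]
theorem pairVar {e : α → (ℕ × ℕ) × β} {i : α → ℕ} (he : PolyTime M e) (hi : PolyTime M i) :
    PolyTime M fun a => pairVar (e a) (i a) := by unfold _root_.pairVar; fun_prop

theorem stateTuple {S : α → State F strict} (hS : PolyTime M S) :
    PolyTime M fun a => ((S a).root, (S a).act, (S a).clauses, (S a).pairs, (S a).msgs) :=
  comp (g := fun S : State F strict => (S.root, S.act, S.clauses, S.pairs, S.msgs))
    (of_enc_eq fun _ => rfl) hS

@[fun_prop]
theorem stateRoot {S : α → State F strict} (hS : PolyTime M S) : PolyTime M fun a => (S a).root :=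
  prodFst (stateTuple hS)

@[fun_prop]
theorem stateAct {S : α → State F strict} (hS : PolyTime M S) : PolyTime M fun a => (S a).act :=
  prodFst (prodSnd (stateTuple hS))

@[fun_prop]
theorem stateClauses {S : α → State F strict} (hS : PolyTime M S) :
    PolyTime M fun a => (S a).clauses := prodFst (prodSnd (prodSnd (stateTuple hS)))

@[fun_prop]
theorem statePairs {S : α → State F strict} (hS : PolyTime M S) :
    PolyTime M fun a => (S a).pairs := prodFst (prodSnd (prodSnd (prodSnd (stateTuple hS))))

@[fun_prop]
theorem stateMsgs {S : α → State F strict} (hS : PolyTime M S) :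
    PolyTime M fun a => (S a).msgs := prodSnd (prodSnd (prodSnd (prodSnd (stateTuple hS))))

@[fun_prop]
theorem stateMk {r : α → ℕ} {A : α → List ℕ} {C : α → List (List RawLit)}
    {e : α → List ((ℕ × ℕ) × F.Bi)} {m : α → List (ℕ × Msg F strict)} (hr : PolyTime M r)
    (hA : PolyTime M A) (hC : PolyTime M C) (he : PolyTime M e) (hm : PolyTime M m) :
    PolyTime M fun a => (⟨r a, A a, C a, e a, m a⟩ : State F strict) := by
  obtain ⟨p, q, h⟩ := prodMk hr (prodMk hA (prodMk hC (prodMk he hm)))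
  exact ⟨p, q, h⟩

@[fun_prop]
theorem stateNbrs {S : α → State F strict} {i : α → ℕ} (hS : PolyTime M S) (hi : PolyTime M i) :
    PolyTime M fun a => (S a).nbrs (i a) := by unfold State.nbrs State.adj; fun_prop

@[fun_prop]
theorem stateIsLeaf {S : α → State F strict} {i : α → ℕ} (hS : PolyTime M S)
    (hi : PolyTime M i) : PolyTime M fun a => (S a).isLeaf (i a) := by
  unfold State.isLeaf; fun_prop

@[fun_prop]
theorem stateLeaves {S : α → State F strict} (hS : PolyTime M S) :
    PolyTime M fun a => (S a).leaves := by unfold State.leaves; fun_prop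

@[fun_prop]
theorem stateParent {S : α → State F strict} {i : α → ℕ} (hS : PolyTime M S)
    (hi : PolyTime M i) : PolyTime M fun a => (S a).parent (i a) := by
  unfold State.parent; fun_prop

@[fun_prop]
theorem stateLeaf {S : α → State F strict} {i : α → ℕ} (hS : PolyTime M S)
    (hi : PolyTime M i) : PolyTime M fun a => (S a).leaf (i a) := by
  unfold State.leaf; fun_prop

/-- An operation for one of two toolkits, which is selected in the course of the computation. -/
theorem selectToolkit {K : Bool → Toolkit M F strict} {b : α → Bool}
    {f : Toolkit M F strict → α → β} (hb : PolyTime M b) (hf : ∀ K, PolyTime M (f K)) :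
    PolyTime M fun a => f (K (b a)) a := by
  have h : (fun a => f (K (b a)) a) = fun a => bif b a then f (K true) a else f (K false) a := by
    funext a
    cases b a <;> rfl
  rw [h]
  exact boolCond hb (hf _) (hf _)

@[fun_prop]
theorem stateMessage {K : Bool → Toolkit M F strict} {S : α → State F strict} {i : α → ℕ}
    (hS : PolyTime M S) (hi : PolyTime M i) : PolyTime M fun a => (S a).message K (i a) := by
  unfold State.message
  exact selectToolkit (f := fun K a => ((S a).leaf (i a)).message K) (by fun_prop)
    fun K => by fun_prop

@[fun_prop]
theorem stateRound {K : Bool → Toolkit M F strict} {S : α → State F strict} (hS : PolyTime M S) :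
    PolyTime M fun a => (S a).round K := by unfold State.round; fun_prop

@[fun_prop]
theorem stateRecords {K : Bool → Toolkit M F strict} {S : α → State F strict}
    (hS : PolyTime M S) : PolyTime M fun a => (S a).records K := by
  unfold State.records
  refine listMap (by fun_prop) (prodMk (by fun_prop) (prodMk (by fun_prop) ?_))
  exact selectToolkit (f := fun K (p : α × ℕ) => ((S p.1).leaf p.2).pieces K) (by fun_prop)
    fun K => by fun_prop

@[fun_prop]
theorem assignLeaves {K : Bool → Toolkit M F strict} {R : α → List (Record F strict)}
    {a : α → List (ℕ × ℝ)} (hR : PolyTime M R) (ha : PolyTime M a) :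
    PolyTime M fun x => assignLeaves K (R x) (a x) := by
  unfold _root_.assignLeaves
  refine listAppend (listMap hR (prodMk (by fun_prop) ?_)) ha
  exact selectToolkit (f := fun K (p : α × Record F strict) =>
    Leaf.choose K p.2.2.2 (_root_.lookupVar p.2.2.1 (a p.1))) (by fun_prop) fun K => by fun_prop

end PolyTime

/-! ### The meaning of a state -/

/-- The difference of the two sides of a literal at an assignment. -/
def RawLit.fullDiff (l : RawLit) (z : ℕ → ℝ) : ℝ :=
  ∑ k ∈ Finset.range l.2.2.1.length, coef l.2.2.1 k * z k - l.2.2.2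

/-- A clause is true under an assignment. -/
def clauseHolds (C : List RawLit) (z : ℕ → ℝ) : Prop := ∃ l ∈ C, l.test (l.fullDiff z) = true

theorem clauseVar_iff {C : List RawLit} {i : ℕ} :
    clauseVar C i = true ↔ ∃ l ∈ C, coef l.2.2.1 i ≠ 0 := by
  simp only [clauseVar, List.any_eq_true, Bool.not_eq_true', ← Bool.not_eq_true, eqB_iff, ne_eq]

theorem pairVar_iff {β : Type} {e : (ℕ × ℕ) × β} {i : ℕ} :
    pairVar e i = true ↔ e.1.1 = i ∨ e.1.2 = i := by
  simp only [pairVar, Bool.or_eq_true, eqN_iff]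

theorem RawLit.fullDiff_eq_diff {l : RawLit} {i j : ℕ} (hij : i ≠ j)
    (h : ∀ k, coef l.2.2.1 k ≠ 0 → k = i ∨ k = j) (z : ℕ → ℝ) :
    l.fullDiff z = l.diff i j (z i) (z j) := by
  have h0 : ∀ k, k ∉ Finset.range l.2.2.1.length → coef l.2.2.1 k * z k = 0 := by
    intro k hk
    rw [Finset.mem_range, not_lt] at hk
    rw [coef, List.getD_eq_default _ _ hk, zero_mul]
  rw [RawLit.fullDiff, RawLit.diff, Finset.sum_eq_add i j hij _ (h0 i) (h0 j)]
  intro k _ hk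
  by_contra h'
  rcases h k (fun h0 => h' (by rw [h0, zero_mul])) with rfl | rfl
  exacts [hk.1 rfl, hk.2 rfl]

theorem clauseHolds_congr {C : List RawLit} {z z' : ℕ → ℝ}
    (h : ∀ i, clauseVar C i = true → z i = z' i) : clauseHolds C z ↔ clauseHolds C z' := by
  refine exists_congr fun l => and_congr_right fun hl => ?_
  have : l.fullDiff z = l.fullDiff z' := by
    rw [RawLit.fullDiff, RawLit.fullDiff]
    congr 1
    refine Finset.sum_congr rfl fun k _ => ?_
    by_cases hk : coef l.2.2.1 k = 0
    · rw [hk, zero_mul, zero_mul]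
    · rw [h k (clauseVar_iff.2 ⟨l, hl, hk⟩)]
  rw [this]

/-- A product over a list, each of whose members belongs to at most one element of `B`. -/
theorem List.prod_partition {A R : Type} [CommMonoid R] (L : List A) {B : List ℕ} (hB : B.Nodup)
    (touch : A → ℕ → Bool) (f : A → R)
    (h : ∀ a ∈ L, ∀ i ∈ B, ∀ k ∈ B, touch a i = true → touch a k = true → i = k) :
    (L.map f).prod = ((L.filter fun a => !B.any (touch a)).map f).prod *
      (B.map fun i => ((L.filter fun a => touch a i).map f).prod).prod := by
  induction L with
  | nil => simp
  | cons a L ih =>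
    have h1 : (B.map fun i => (((a :: L).filter fun a => touch a i).map f).prod).prod =
        (B.map fun i => if touch a i = true then f a else 1).prod *
        (B.map fun i => ((L.filter fun a => touch a i).map f).prod).prod := by
      rw [← List.prod_map_mul]
      congr 1
      refine List.map_congr_left fun i _ => ?_
      by_cases hi : touch a i = true <;> simp [hi]
    have h2 : (B.map fun i => if touch a i = true then f a else 1).prod =
        if B.any (touch a) = true then f a else 1 := by
      have ha := h a (by simp)
      clear h1 ih h
      induction B with
      | nil => simp
      | cons i B ihB =>
        rw [List.nodup_cons] at hB
        have hB' := ihB hB.2 fun j hj k hk => ha j (by simp [hj]) k (by simp [hk])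
        rw [List.map_cons, List.prod_cons, hB', List.any_cons]
        by_cases hi : touch a i = true
        · have : B.any (touch a) = false := by
            rw [← Bool.not_eq_true, List.any_eq_true]
            rintro ⟨k, hk, hak⟩
            exact hB.1 (ha i (by simp) k (by simp [hk]) hi hak ▸ hk)
          simp [hi, this]
        · simp [hi]
    rw [h1, h2, List.map_cons, List.prod_cons, ih fun a ha => h a (by simp [ha])]
    by_cases ha : B.any (touch a) = true
    · rw [List.filter_cons_of_neg (by simpa using ha), if_pos ha]
      exact mul_left_comm _ _ _
    · rw [List.filter_cons_of_pos (by simpa using ha), if_neg ha, List.map_cons, List.prod_cons,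
        one_mul, mul_assoc]

/-- A product of functions of different variables can be maximised factor by factor. -/
theorem ENNReal.iSup_list_prod {B : List ℕ} (hB : B.Nodup) (f : ℕ → ℝ → ℝ≥0∞) :
    ⨆ z : ℕ → ℝ, (B.map fun i => f i (z i)).prod = (B.map fun i => ⨆ y, f i y).prod := by
  refine le_antisymm (iSup_le fun z => ?_) ?_
  · refine List.prod_le_prod' fun i _ => le_iSup (f i) (z i)
  · induction B with
    | nil => simp
    | cons i B ih =>
      rw [List.nodup_cons] at hB
      rw [List.map_cons, List.prod_cons]
      refine (mul_le_mul_right (ih hB.2) _).trans ?_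
      rw [ENNReal.iSup_mul]
      refine iSup_le fun y => ?_
      rw [ENNReal.mul_iSup]
      refine iSup_le fun z => ?_
      refine le_trans (le_of_eq ?_) (le_iSup _ (Function.update z i y))
      rw [List.map_cons, List.prod_cons, Function.update_self]
      congr 2
      refine List.map_congr_left fun k hk => ?_
      rw [Function.update_of_ne (fun h : k = i => hB.1 (h ▸ hk))]

/-- Factors that are bounded by others with the same finite, non-zero product are equal to them. -/
theorem ENNReal.eq_of_list_prod_eq {α : Type} {l : List α} {f g : α → ℝ≥0∞}
    (hfg : ∀ a ∈ l, f a ≤ g a) (h : (l.map f).prod = (l.map g).prod) (h0 : (l.map g).prod ≠ 0)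
    (ht : (l.map g).prod ≠ ∞) : ∀ a ∈ l, f a = g a ∧ g a ≠ ∞ := by
  induction l with
  | nil => simp
  | cons a l ih =>
    rw [List.map_cons, List.prod_cons] at h0 ht
    rw [List.map_cons, List.prod_cons, List.map_cons, List.prod_cons] at h
    have h1 : g a ≠ 0 := fun h' => h0 (by rw [h', zero_mul])
    have h2 : (l.map g).prod ≠ 0 := fun h' => h0 (by rw [h', mul_zero])
    have h3 : g a ≠ ∞ := fun h' => ht (by rw [h', ENNReal.top_mul h2])
    have h4 : (l.map g).prod ≠ ∞ := fun h' => ht (by rw [h', ENNReal.mul_top h1])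
    have hle : (l.map f).prod ≤ (l.map g).prod :=
      List.prod_le_prod' fun b hb => hfg b (by simp [hb])
    have h5 : f a = g a := by
      refine le_antisymm (hfg a (by simp)) ?_
      have : g a * (l.map g).prod ≤ f a * (l.map g).prod := by
        rw [← h]
        exact mul_le_mul_right hle _
      exact (ENNReal.mul_le_mul_iff_left h2 h4).1 this
    have h6 : (l.map f).prod = (l.map g).prod := by
      rw [h5] at h
      exact (ENNReal.mul_right_inj h1 h3).1 h
    intro b hb
    rcases List.mem_cons.1 hb with rfl | hb
    · exact ⟨h5, h3⟩
    · exact ih (fun b hb => hfg b (by simp [hb])) h6 h2 h4 b hb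

/-! ### Correctness of a round -/

/-- The first toolkit eliminates first variables of bivariate members, the second one second variables. -/
def Oriented (K : Bool → Toolkit M F strict) : Prop :=
  ∀ f y x, (K true).ev f y x = F.bi f y x ∧ (K false).ev f y x = F.bi f x y

/-- The invariants of a state. -/
structure State.Valid (S : State F strict) : Prop where
  nodup : S.act.Nodup
  act_lt : ∀ i ∈ S.act, i < S.root
  clause_vars : ∀ C ∈ S.clauses, ∀ i, clauseVar C i = true → i ∈ S.act
  clause_two : ∀ C ∈ S.clauses, ∀ i j k, clauseVar C i = true → clauseVar C j = true →
    clauseVar C k = true → i = j ∨ i = k ∨ j = k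
  positive : strict = false → ∀ C ∈ S.clauses, ∀ l ∈ C, l.1 = true
  pair_lt : ∀ e ∈ S.pairs, e.1.1 < e.1.2
  pair_vars : ∀ e ∈ S.pairs, ∀ i, pairVar e i = true → i ∈ S.act
  pair_nonneg : ∀ e ∈ S.pairs, ∀ x y, 0 ≤ F.bi e.2 x y
  msgs : ∀ m ∈ S.msgs, m.2.Valid
  exists_msg : ∀ i ∈ S.act, ∃ m ∈ S.msgs, m.1 = i
  msg_vars : ∀ m ∈ S.msgs, m.1 ∈ S.act ∨ m.1 = S.root

namespace State

variable {K : Bool → Toolkit M F strict} {S : State F strict}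

/-- All constraints are satisfied. -/
def Feas (S : State F strict) (z : ℕ → ℝ) : Prop :=
  (∀ C ∈ S.clauses, clauseHolds C z) ∧ ∀ m ∈ S.msgs, z m.1 ∈ m.2.dom

/-- The product of all factors and messages. -/
def weight (S : State F strict) (z : ℕ → ℝ) : ℝ≥0∞ :=
  (S.pairs.map fun e => ENNReal.ofReal (F.bi e.2 (z e.1.1) (z e.1.2))).prod *
    (S.msgs.map fun m => m.2.val (z m.1)).prod

open Classical in
/-- The weight of feasible assignments, and `0` for the others. -/
def total (S : State F strict) (z : ℕ → ℝ) : ℝ≥0∞ := if S.Feas z then S.weight z else 0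

theorem adj_iff {i j : ℕ} : S.adj i j = true ↔ i ≠ j ∧
    ((∃ C ∈ S.clauses, clauseVar C i = true ∧ clauseVar C j = true) ∨
      ∃ e ∈ S.pairs, pairVar e i = true ∧ pairVar e j = true) := by
  simp only [adj, Bool.and_eq_true, Bool.or_eq_true, List.any_eq_true, Bool.not_eq_true',
    ← Bool.not_eq_true, eqN_iff, ne_eq]

theorem adj_comm {i j : ℕ} : S.adj i j = true ↔ S.adj j i = true := by
  rw [adj_iff, adj_iff]
  simp only [and_comm, ne_comm]

theorem mem_nbrs {i j : ℕ} : j ∈ S.nbrs i ↔ j ∈ S.act ∧ S.adj i j = true := List.mem_filter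

theorem isLeaf_iff {i : ℕ} : S.isLeaf i = true ↔ (∀ j ∈ S.nbrs i, ∀ k ∈ S.nbrs i, j = k) ∧
    ∀ j ∈ S.nbrs i, (∃ k ∈ S.nbrs j, k ≠ i) ∨ i < j := by
  simp only [isLeaf, Bool.and_eq_true, List.all_eq_true, Bool.or_eq_true, List.any_eq_true,
    Bool.not_eq_true', ← Bool.not_eq_true, eqN_iff, ltN_iff, ne_eq]

theorem mem_leaves {i : ℕ} : i ∈ S.leaves ↔ i ∈ S.act ∧ S.isLeaf i = true := List.mem_filter

theorem parent_mem {i : ℕ} : S.parent i ∈ S.nbrs i ∨ S.parent i = S.root := by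
  rw [parent]
  cases S.nbrs i <;> simp

theorem eq_parent {i k : ℕ} (hi : i ∈ S.leaves) (hk : k ∈ S.nbrs i) : k = S.parent i := by
  have h := (isLeaf_iff.1 (mem_leaves.1 hi).2).1
  have h2 : S.parent i ∈ S.nbrs i := by
    rw [parent]
    cases h : S.nbrs i with
    | nil => rw [h] at hk; cases hk
    | cons j l => simp
  exact h _ hk _ h2

theorem leaves_not_adj {i k : ℕ} (hi : i ∈ S.leaves) (hk : k ∈ S.leaves) : ¬ S.adj i k = true := by
  intro h
  rw [mem_leaves] at hi hk
  have hki : k ∈ S.nbrs i := mem_nbrs.2 ⟨hk.1, h⟩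
  have hik : i ∈ S.nbrs k := mem_nbrs.2 ⟨hi.1, adj_comm.1 h⟩
  have h1 := isLeaf_iff.1 hi.2
  have h2 := isLeaf_iff.1 hk.2
  have h3 : i < k := (h1.2 k hki).resolve_left fun ⟨l, hl, hne⟩ => hne (h2.1 l hl i hik)
  have h4 : k < i := (h2.2 i hik).resolve_left fun ⟨l, hl, hne⟩ => hne (h1.1 l hl k hki)
  omega

theorem Valid.root_not_mem (h : S.Valid) : S.root ∉ S.act := fun h' => lt_irrefl _ (h.act_lt _ h')

theorem parent_not_mem_leaves (h : S.Valid) {i : ℕ} (hi : i ∈ S.leaves) :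
    S.parent i ∉ S.leaves := by
  intro hp
  rcases parent_mem (S := S) (i := i) with h' | h'
  · exact leaves_not_adj hi hp (mem_nbrs.1 h').2
  · rw [h'] at hp
    exact h.root_not_mem (mem_leaves.1 hp).1

theorem ne_parent (h : S.Valid) {i : ℕ} (hi : i ∈ S.leaves) : i ≠ S.parent i :=
  fun h' => parent_not_mem_leaves h hi (h' ▸ hi)

theorem Valid.leaves_nodup (h : S.Valid) : S.leaves.Nodup := h.nodup.filter _

theorem clause_parent (h : S.Valid) {i : ℕ} (hi : i ∈ S.leaves) {C : List RawLit}
    (hC : C ∈ S.clauses) (hCi : clauseVar C i = true) {k : ℕ} (hCk : clauseVar C k = true) :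
    k = i ∨ k = S.parent i := by
  by_cases hki : k = i
  · exact .inl hki
  · exact .inr (eq_parent hi (mem_nbrs.2 ⟨h.clause_vars C hC k hCk,
      adj_iff.2 ⟨Ne.symm hki, .inl ⟨C, hC, hCi, hCk⟩⟩⟩))

theorem pair_parent (h : S.Valid) {i : ℕ} (hi : i ∈ S.leaves) {e : (ℕ × ℕ) × F.Bi}
    (he : e ∈ S.pairs) (hei : pairVar e i = true) {k : ℕ} (hek : pairVar e k = true) :
    k = i ∨ k = S.parent i := by
  by_cases hki : k = i
  · exact .inl hki
  · exact .inr (eq_parent hi (mem_nbrs.2 ⟨h.pair_vars e he k hek,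
      adj_iff.2 ⟨Ne.symm hki, .inr ⟨e, he, hei, hek⟩⟩⟩))

theorem ev_pair (hK : Oriented K) (h : S.Valid) {i : ℕ} (hi : i ∈ S.leaves)
    {e : (ℕ × ℕ) × F.Bi} (he : e ∈ S.pairs) (hei : pairVar e i = true) (z : ℕ → ℝ) :
    (K (ltN i (S.parent i))).ev e.2 (z i) (z (S.parent i)) = F.bi e.2 (z e.1.1) (z e.1.2) := by
  have hlt := h.pair_lt e he
  have h1 := pair_parent h hi he hei (k := e.1.1) (pairVar_iff.2 (.inl rfl))
  have h2 := pair_parent h hi he hei (k := e.1.2) (pairVar_iff.2 (.inr rfl))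
  rcases h1 with h1 | h1 <;> rcases h2 with h2 | h2
  · omega
  · have : ltN i (S.parent i) = true := by rw [ltN_iff]; omega
    rw [this, (hK _ _ _).1, h1, h2]
  · have : ltN i (S.parent i) = false := by rw [← Bool.not_eq_true, ltN_iff]; omega
    rw [this, (hK _ _ _).2, h1, h2]
  · omega

theorem leaf_valid (hK : Oriented K) (h : S.Valid) {i : ℕ} (hi : i ∈ S.leaves) :
    (S.leaf i).Valid (K (ltN i (S.parent i))) where
  msgs := by
    intro m hm
    obtain ⟨m', hm', rfl⟩ := List.mem_map.1 hm
    exact h.msgs m' (List.mem_filter.1 hm').1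
  factors := by
    intro f hf y x
    obtain ⟨e, he, rfl⟩ := List.mem_map.1 hf
    have h1 := h.pair_nonneg e (List.mem_filter.1 he).1
    cases ltN i (S.parent i)
    · rw [(hK _ _ _).2]; exact h1 _ _
    · rw [(hK _ _ _).1]; exact h1 _ _
  clauses := fun hs C hC => h.positive hs C (List.mem_filter.1 hC).1
  nonempty := by
    obtain ⟨m, hm, rfl⟩ := h.exists_msg i (mem_leaves.1 hi).1
    refine List.ne_nil_of_mem (a := m.2) (List.mem_map.2 ⟨m, List.mem_filter.2 ⟨hm, ?_⟩, rfl⟩)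
    rw [eqN_iff]

/-- The part of the constraints that concerns no leaf. -/
def RestFeas (S : State F strict) (z : ℕ → ℝ) : Prop :=
  (∀ C ∈ S.clauses, ¬ S.leaves.any (clauseVar C) = true → clauseHolds C z) ∧
    ∀ m ∈ S.msgs, ¬ S.leaves.any (eqN m.1) = true → z m.1 ∈ m.2.dom

/-- The part of the weight that concerns no leaf. -/
def restWeight (S : State F strict) (z : ℕ → ℝ) : ℝ≥0∞ :=
  ((S.pairs.filter fun e => !S.leaves.any (pairVar e)).map
    fun e => ENNReal.ofReal (F.bi e.2 (z e.1.1) (z e.1.2))).prod *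
    ((S.msgs.filter fun m => !S.leaves.any (eqN m.1)).map fun m => m.2.val (z m.1)).prod

theorem restFeas_congr {z z' : ℕ → ℝ} (hz : ∀ k, k ∉ S.leaves → z k = z' k) :
    S.RestFeas z ↔ S.RestFeas z' := by
  refine and_congr ?_ ?_
  · refine forall_congr' fun C => forall_congr' fun _ => forall_congr' fun hC => ?_
    refine clauseHolds_congr fun i hi => hz i fun h => hC ?_
    exact List.any_eq_true.2 ⟨i, h, hi⟩
  · refine forall_congr' fun m => forall_congr' fun _ => forall_congr' fun hm => ?_
    rw [hz m.1 fun h => hm (List.any_eq_true.2 ⟨_, h, (eqN_iff _ _).2 rfl⟩)]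

theorem restWeight_congr {z z' : ℕ → ℝ} (hz : ∀ k, k ∉ S.leaves → z k = z' k) :
    S.restWeight z = S.restWeight z' := by
  rw [restWeight, restWeight]
  congr 2
  · refine List.map_congr_left fun e he => ?_
    have he' : ∀ k, pairVar e k = true → k ∉ S.leaves := by
      intro k hk h
      have := (List.mem_filter.1 he).2
      rw [Bool.not_eq_true', ← Bool.not_eq_true] at this
      exact this (List.any_eq_true.2 ⟨k, h, hk⟩)
    rw [hz _ (he' _ (pairVar_iff.2 (.inl rfl))), hz _ (he' _ (pairVar_iff.2 (.inr rfl)))]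
  · refine List.map_congr_left fun m hm => ?_
    have := (List.mem_filter.1 hm).2
    rw [Bool.not_eq_true', ← Bool.not_eq_true] at this
    rw [hz m.1 fun h => this (List.any_eq_true.2 ⟨_, h, (eqN_iff _ _).2 rfl⟩)]

theorem feas_leaf_iff (h : S.Valid) {i : ℕ} (hi : i ∈ S.leaves) (z : ℕ → ℝ) :
    (S.leaf i).Feas (z i) (z (S.parent i)) ↔
      (∀ C ∈ S.clauses, clauseVar C i = true → clauseHolds C z) ∧
      ∀ m ∈ S.msgs, m.1 = i → z m.1 ∈ m.2.dom := by
  refine and_congr ?_ ?_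
  · simp only [leaf, List.mem_filter, and_imp]
    refine forall_congr' fun C => forall_congr' fun hC => forall_congr' fun hCi => ?_
    refine exists_congr fun l => and_congr_right fun hl => ?_
    rw [RawLit.fullDiff_eq_diff (ne_parent h hi) fun k hk =>
      clause_parent h hi hC hCi (clauseVar_iff.2 ⟨l, hl, hk⟩)]
  · simp only [leaf, List.mem_map, List.mem_filter, eqN_iff]
    constructor
    · rintro h m hm rfl
      exact h m.2 ⟨m, ⟨hm, rfl⟩, rfl⟩
    · rintro h _ ⟨m, ⟨hm, rfl⟩, rfl⟩
      exact h m hm rfl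

theorem feas_iff (h : S.Valid) (z : ℕ → ℝ) : S.Feas z ↔
    S.RestFeas z ∧ ∀ i ∈ S.leaves, (S.leaf i).Feas (z i) (z (S.parent i)) := by
  constructor
  · intro hz
    refine ⟨⟨fun C hC _ => hz.1 C hC, fun m hm _ => hz.2 m hm⟩, fun i hi => ?_⟩
    exact (feas_leaf_iff h hi z).2 ⟨fun C hC _ => hz.1 C hC, fun m hm _ => hz.2 m hm⟩
  · rintro ⟨h1, h2⟩
    refine ⟨fun C hC => ?_, fun m hm => ?_⟩
    · by_cases hC' : S.leaves.any (clauseVar C) = true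
      · obtain ⟨i, hi, hCi⟩ := List.any_eq_true.1 hC'
        exact ((feas_leaf_iff h hi z).1 (h2 i hi)).1 C hC hCi
      · exact h1.1 C hC hC'
    · by_cases hm' : S.leaves.any (eqN m.1) = true
      · obtain ⟨i, hi, hmi⟩ := List.any_eq_true.1 hm'
        exact ((feas_leaf_iff h hi z).1 (h2 i hi)).2 m hm ((eqN_iff _ _).1 hmi)
      · exact h1.2 m hm hm'

theorem feas_round_iff (z : ℕ → ℝ) : (S.round K).Feas z ↔
    S.RestFeas z ∧ ∀ i ∈ S.leaves, z (S.parent i) ∈ (S.message K i).dom := by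
  simp only [Feas, RestFeas, round, List.mem_append, List.mem_filter, List.mem_map, or_imp,
    forall_and, and_imp, Bool.not_eq_true', ← Bool.not_eq_true, and_assoc, forall_exists_index,
    forall_apply_eq_imp_iff₂]

theorem weight_eq (hK : Oriented K) (h : S.Valid) (z : ℕ → ℝ) : S.weight z =
    S.restWeight z * (S.leaves.map fun i =>
      (S.leaf i).weight (K (ltN i (S.parent i))) (z i) (z (S.parent i))).prod := by
  rw [weight, restWeight, List.prod_partition S.pairs h.leaves_nodup pairVar _ ?_,
    List.prod_partition S.msgs h.leaves_nodup (fun m i => eqN m.1 i) _ ?_, mul_mul_mul_comm,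
    ← List.prod_map_mul]
  · congr 2
    refine List.map_congr_left fun i hi => ?_
    rw [Leaf.weight, leaf, List.map_map, List.map_map]
    congr 2
    · refine List.map_congr_left fun e he => ?_
      obtain ⟨he, hei⟩ := List.mem_filter.1 he
      rw [Function.comp_apply, ev_pair hK h hi he hei]
    · refine List.map_congr_left fun m hm => ?_
      have := (List.mem_filter.1 hm).2
      rw [eqN_iff] at this
      rw [Function.comp_apply, this]
  · intro m _ i _ k _ hi hk
    rw [eqN_iff] at hi hk
    omega
  · intro e he i hi k hk hei hek
    by_contra hik
    exact leaves_not_adj hi hk (adj_iff.2 ⟨hik, .inr ⟨e, he, hei, hek⟩⟩)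

theorem weight_round (z : ℕ → ℝ) : (S.round K).weight z =
    S.restWeight z * (S.leaves.map fun i => (S.message K i).val (z (S.parent i))).prod := by
  simp only [weight, restWeight, round, List.map_append, List.prod_append, List.map_map, mul_assoc]
  rfl

theorem feas_round_of_feas (h : S.Valid) {z : ℕ → ℝ} (hz : S.Feas z) : (S.round K).Feas z := by
  rw [feas_iff h] at hz
  exact (feas_round_iff z).2 ⟨hz.1, fun i hi => ⟨z i, hz.2 i hi⟩⟩

/-- A round replaces the totals by their suprema over the values of the leaves. -/
theorem total_round (hK : Oriented K) (h : S.Valid) (x : ℕ → ℝ) :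
    (S.round K).total x = ⨆ (z : ℕ → ℝ) (_ : ∀ k, k ∉ S.leaves → z k = x k), S.total z := by
  classical
  let f : ℕ → ℝ → ℝ≥0∞ := fun i y => ⨆ _ : (S.leaf i).Feas y (x (S.parent i)),
    (S.leaf i).weight (K (ltN i (S.parent i))) y (x (S.parent i))
  have hval : ∀ i, (S.message K i).val (x (S.parent i)) = ⨆ y, f i y := fun i => rfl
  have hf : ∀ i y, (S.leaf i).Feas y (x (S.parent i)) →
      f i y = (S.leaf i).weight (K (ltN i (S.parent i))) y (x (S.parent i)) :=
    fun i y hy => by simp [f, hy]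
  have hf0 : ∀ i y, ¬ (S.leaf i).Feas y (x (S.parent i)) → f i y = 0 :=
    fun i y hy => by simp [f, hy]
  -- the total in terms of `f`
  have htot : ∀ z : ℕ → ℝ, (∀ k, k ∉ S.leaves → z k = x k) → S.total z =
      if S.RestFeas x then S.restWeight x * (S.leaves.map fun i => f i (z i)).prod else 0 := by
    intro z hz
    have hp : ∀ i ∈ S.leaves, z (S.parent i) = x (S.parent i) :=
      fun i hi => hz _ (parent_not_mem_leaves h hi)
    rw [total, feas_iff h, restFeas_congr hz, weight_eq hK h, restWeight_congr hz]
    by_cases hr : S.RestFeas x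
    · by_cases hl : ∀ i ∈ S.leaves, (S.leaf i).Feas (z i) (z (S.parent i))
      · rw [if_pos ⟨hr, hl⟩, if_pos hr]
        congr 2
        refine List.map_congr_left fun i hi => ?_
        have := hl i hi
        rw [hp i hi] at this ⊢
        rw [hf i _ this]
      · rw [if_neg (fun h => hl h.2), if_pos hr]
        push Not at hl
        obtain ⟨i, hi, hli⟩ := hl
        rw [hp i hi] at hli
        rw [List.prod_eq_zero (List.mem_map.2 ⟨i, hi, hf0 i _ hli⟩), mul_zero]
    · rw [if_neg (fun h => hr h.1), if_neg hr]
  have hround : (S.round K).total x =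
      if S.RestFeas x then S.restWeight x * (S.leaves.map fun i => ⨆ y, f i y).prod else 0 := by
    rw [total, feas_round_iff, weight_round]
    by_cases hr : S.RestFeas x
    · by_cases hl : ∀ i ∈ S.leaves, x (S.parent i) ∈ (S.message K i).dom
      · rw [if_pos ⟨hr, hl⟩, if_pos hr]
        rfl
      · rw [if_neg (fun h => hl h.2), if_pos hr]
        push Not at hl
        obtain ⟨i, hi, hli⟩ := hl
        have : ⨆ y, f i y = 0 := by
          rw [← nonpos_iff_eq_zero]
          refine iSup_le fun y => (hf0 i y fun hy => hli ⟨y, hy⟩).le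
        rw [List.prod_eq_zero (List.mem_map.2 ⟨i, hi, this⟩), mul_zero]
    · rw [if_neg (fun h => hr h.1), if_neg hr]
  rw [hround, ← ENNReal.iSup_list_prod h.leaves_nodup]
  refine le_antisymm ?_ (iSup₂_le fun z hz => ?_)
  · by_cases hr : S.RestFeas x
    · rw [if_pos hr, ENNReal.mul_iSup]
      refine iSup_le fun z => ?_
      let z' : ℕ → ℝ := fun k => if k ∈ S.leaves then z k else x k
      have hz' : ∀ k, k ∉ S.leaves → z' k = x k := fun k hk => if_neg hk
      refine le_trans (le_of_eq ?_) (le_iSup₂ (f := fun (z : ℕ → ℝ)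
        (_ : ∀ k, k ∉ S.leaves → z k = x k) => S.total z) z' hz')
      rw [htot z' hz', if_pos hr]
      congr 2
      refine List.map_congr_left fun i hi => ?_
      rw [show z' i = z i from if_pos hi]
    · rw [if_neg hr]
      exact zero_le
  · rw [htot z hz]
    by_cases hr : S.RestFeas x
    · rw [if_pos hr, if_pos hr]
      exact mul_le_mul_right (le_iSup (fun z : ℕ → ℝ => (S.leaves.map fun i => f i (z i)).prod) z) _
    · rw [if_neg hr]
      exact zero_le

theorem round_valid (hK : Oriented K) (h : S.Valid) : (S.round K).Valid where
  nodup := h.nodup.filter _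
  act_lt := fun i hi => h.act_lt i (List.mem_filter.1 hi).1
  clause_vars := by
    intro C hC i hi
    obtain ⟨hC1, hC2⟩ := List.mem_filter.1 hC
    have hia := h.clause_vars C hC1 i hi
    refine List.mem_filter.2 ⟨hia, ?_⟩
    rw [Bool.not_eq_true', ← Bool.not_eq_true] at hC2 ⊢
    exact fun hl => hC2 (List.any_eq_true.2 ⟨i, mem_leaves.2 ⟨hia, hl⟩, hi⟩)
  clause_two := fun C hC => h.clause_two C (List.mem_filter.1 hC).1
  positive := fun hs C hC => h.positive hs C (List.mem_filter.1 hC).1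
  pair_lt := fun e he => h.pair_lt e (List.mem_filter.1 he).1
  pair_vars := by
    intro e he i hi
    obtain ⟨he1, he2⟩ := List.mem_filter.1 he
    have hia := h.pair_vars e he1 i hi
    refine List.mem_filter.2 ⟨hia, ?_⟩
    rw [Bool.not_eq_true', ← Bool.not_eq_true] at he2 ⊢
    exact fun hl => he2 (List.any_eq_true.2 ⟨i, mem_leaves.2 ⟨hia, hl⟩, hi⟩)
  pair_nonneg := fun e he => h.pair_nonneg e (List.mem_filter.1 he).1
  msgs := by
    intro m hm
    rcases List.mem_append.1 hm with hm | hm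
    · exact h.msgs m (List.mem_filter.1 hm).1
    · obtain ⟨i, hi, rfl⟩ := List.mem_map.1 hm
      exact Leaf.message_valid (leaf_valid hK h hi)
  exists_msg := by
    intro i hi
    obtain ⟨hi1, hi2⟩ := List.mem_filter.1 hi
    obtain ⟨m, hm, rfl⟩ := h.exists_msg i hi1
    refine ⟨m, List.mem_append_left _ (List.mem_filter.2 ⟨hm, ?_⟩), rfl⟩
    rw [Bool.not_eq_true', ← Bool.not_eq_true] at hi2 ⊢
    intro hl
    obtain ⟨k, hk, hmk⟩ := List.any_eq_true.1 hl
    rw [eqN_iff] at hmk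
    exact hi2 (hmk ▸ (mem_leaves.1 hk).2)
  msg_vars := by
    intro m hm
    have hact : ∀ k ∈ S.act, k ∉ S.leaves → k ∈ (S.round K).act := by
      intro k hk hl
      refine List.mem_filter.2 ⟨hk, ?_⟩
      rw [Bool.not_eq_true', ← Bool.not_eq_true]
      exact fun h' => hl (mem_leaves.2 ⟨hk, h'⟩)
    rcases List.mem_append.1 hm with hm | hm
    · obtain ⟨hm1, hm2⟩ := List.mem_filter.1 hm
      rw [Bool.not_eq_true', ← Bool.not_eq_true] at hm2
      refine (h.msg_vars m hm1).imp_left fun hm' => hact _ hm' fun hl => hm2 ?_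
      exact List.any_eq_true.2 ⟨_, hl, (eqN_iff _ _).2 rfl⟩
    · obtain ⟨i, hi, rfl⟩ := List.mem_map.1 hm
      exact (parent_mem (S := S) (i := i)).imp_left fun hp =>
        hact _ (mem_nbrs.1 hp).1 (parent_not_mem_leaves h hi)

/-- Feasibility and weight depend only on the remaining variables and the auxiliary one. -/
theorem Valid.total_congr (h : S.Valid) {z z' : ℕ → ℝ}
    (hz : ∀ k, k ∈ S.act ∨ k = S.root → z k = z' k) :
    (S.Feas z ↔ S.Feas z') ∧ S.total z = S.total z' := by
  have hfeas : S.Feas z ↔ S.Feas z' := by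
    refine and_congr ?_ ?_
    · exact forall_congr' fun C => forall_congr' fun hC =>
        clauseHolds_congr fun i hi => hz i (.inl (h.clause_vars C hC i hi))
    · exact forall_congr' fun m => forall_congr' fun hm => by rw [hz _ (h.msg_vars m hm)]
  refine ⟨hfeas, ?_⟩
  have hweight : S.weight z = S.weight z' := by
    rw [weight, weight]
    congr 2
    · refine List.map_congr_left fun e he => ?_
      rw [hz _ (.inl (h.pair_vars e he _ (pairVar_iff.2 (.inl rfl)))),
        hz _ (.inl (h.pair_vars e he _ (pairVar_iff.2 (.inr rfl))))]
    · exact List.map_congr_left fun m hm => by rw [hz _ (h.msg_vars m hm)]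
  classical
  rw [total, total, hweight]
  exact if_congr hfeas rfl rfl

/-- The assignment that a list stands for. -/
def _root_.assignment (a : List (ℕ × ℝ)) : ℕ → ℝ := fun k => lookupVar k a

theorem lookupVar_append_map {B : List ℕ} (f : ℕ → ℝ) (a : List (ℕ × ℝ)) (k : ℕ) :
    lookupVar k ((B.map fun i => (i, f i)) ++ a) = if k ∈ B then f k else lookupVar k a := by
  induction B with
  | nil => simp
  | cons i B ih =>
    by_cases hik : i = k
    · subst hik
      have : eqN i i = true := (eqN_iff _ _).2 rfl
      simp [lookupVar, this]
    · have h1 : eqN i k = false := by rw [← Bool.not_eq_true, eqN_iff]; exact hik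
      have h2 : lookupVar k (((i :: B).map fun i => (i, f i)) ++ a) =
          lookupVar k ((B.map fun i => (i, f i)) ++ a) := by
        simp [lookupVar, h1]
      rw [h2, ih]
      simp [Ne.symm hik]

theorem assignLeaves_apply (a : List (ℕ × ℝ)) (k : ℕ) :
    assignment (assignLeaves K (S.records K) a) k =
      if k ∈ S.leaves then Leaf.choose (K (ltN k (S.parent k)))
        ((S.leaf k).pieces (K (ltN k (S.parent k)))) (assignment a (S.parent k))
      else assignment a k := by
  rw [assignment, assignLeaves, records, List.map_map]
  exact lookupVar_append_map (fun k => Leaf.choose (K (ltN k (S.parent k)))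
    ((S.leaf k).pieces (K (ltN k (S.parent k)))) (assignment a (S.parent k))) a k

theorem assignLeaves_feas (hK : Oriented K) (h : S.Valid) {a : List (ℕ × ℝ)}
    (ha : (S.round K).Feas (assignment a)) :
    S.Feas (assignment (assignLeaves K (S.records K) a)) := by
  rw [feas_round_iff] at ha
  have hz : ∀ k, k ∉ S.leaves → assignment (assignLeaves K (S.records K) a) k = assignment a k :=
    fun k hk => by rw [assignLeaves_apply, if_neg hk]
  refine (feas_iff h _).2 ⟨(restFeas_congr hz).2 ha.1, fun i hi => ?_⟩
  rw [hz _ (parent_not_mem_leaves h hi), assignLeaves_apply, if_pos hi]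
  exact Leaf.choose_feas (leaf_valid hK h hi) (ha.2 i hi)

/-- The choices for the leaves keep the total, if it is `0` or the suprema in the messages are finite and
attained. -/
theorem assignLeaves_total (hK : Oriented K) (h : S.Valid) {a : List (ℕ × ℝ)}
    (ha : (S.round K).Feas (assignment a))
    (hatt : (S.round K).total (assignment a) ≠ 0 → ∀ i ∈ S.leaves,
      (S.message K i).val (assignment a (S.parent i)) ≠ ∞ ∧
      ∃ y, (S.leaf i).Feas y (assignment a (S.parent i)) ∧
        (S.leaf i).weight (K (ltN i (S.parent i))) y (assignment a (S.parent i)) =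
          (S.message K i).val (assignment a (S.parent i))) :
    S.total (assignment (assignLeaves K (S.records K) a)) =
      (S.round K).total (assignment a) := by
  have hfeas := assignLeaves_feas hK h ha
  have hz : ∀ k, k ∉ S.leaves → assignment (assignLeaves K (S.records K) a) k = assignment a k :=
    fun k hk => by rw [assignLeaves_apply, if_neg hk]
  by_cases h0 : (S.round K).total (assignment a) = 0
  · refine le_antisymm ?_ (by rw [h0]; exact zero_le)
    rw [total_round hK h]
    exact le_iSup₂ (f := fun (z : ℕ → ℝ)
      (_ : ∀ k, k ∉ S.leaves → z k = assignment a k) => S.total z) _ hz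
  · rw [total, if_pos hfeas, total, if_pos ha, weight_eq hK h, weight_round, restWeight_congr hz]
    congr 2
    refine List.map_congr_left fun i hi => ?_
    rw [hz _ (parent_not_mem_leaves h hi), assignLeaves_apply, if_pos hi]
    exact Leaf.choose_exact (leaf_valid hK h hi) (hatt h0 i hi).1 (hatt h0 i hi).2

/-- If the supremum over the values of the leaves is finite, positive and attained, then so are the suprema in
the messages. -/
theorem messages_attained (hK : Oriented K) (h : S.Valid) {x : ℕ → ℝ} (hfin : (S.round K).total x ≠ ∞)
    (h0 : (S.round K).total x ≠ 0)
    (hatt : ∃ z : ℕ → ℝ, (∀ k, k ∉ S.leaves → z k = x k) ∧ S.total z = (S.round K).total x) :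
    ∀ i ∈ S.leaves, (S.message K i).val (x (S.parent i)) ≠ ∞ ∧
      ∃ y, (S.leaf i).Feas y (x (S.parent i)) ∧
        (S.leaf i).weight (K (ltN i (S.parent i))) y (x (S.parent i)) =
          (S.message K i).val (x (S.parent i)) := by
  obtain ⟨z, hz, hzt⟩ := hatt
  have hzf : S.Feas z := by
    by_contra hzf
    rw [total, if_neg hzf] at hzt
    exact h0 hzt.symm
  have hxf : (S.round K).Feas x := by
    by_contra hxf
    rw [total, if_neg hxf] at h0
    exact h0 rfl
  have hp : ∀ i ∈ S.leaves, z (S.parent i) = x (S.parent i) :=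
    fun i hi => hz _ (parent_not_mem_leaves h hi)
  have hlf : ∀ i ∈ S.leaves, (S.leaf i).Feas (z i) (x (S.parent i)) := by
    intro i hi
    rw [← hp i hi]
    exact ((feas_iff h z).1 hzf).2 i hi
  rw [total, if_pos hxf, weight_round] at hfin h0
  rw [total, if_pos hzf, total, if_pos hxf, weight_eq hK h, weight_round, restWeight_congr hz]
    at hzt
  have h1 : S.restWeight x ≠ 0 := fun h' => h0 (by rw [h', zero_mul])
  have h2 : (S.leaves.map fun i => (S.message K i).val (x (S.parent i))).prod ≠ 0 :=
    fun h' => h0 (by rw [h', mul_zero])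
  have h3 : S.restWeight x ≠ ∞ := fun h' => hfin (by rw [h', ENNReal.top_mul h2])
  have h4 : (S.leaves.map fun i => (S.message K i).val (x (S.parent i))).prod ≠ ∞ :=
    fun h' => hfin (by rw [h', ENNReal.mul_top h1])
  have h5 := ENNReal.eq_of_list_prod_eq (fun i hi => ?_)
    ((ENNReal.mul_right_inj h1 h3).1 hzt) h2 h4
  · intro i hi
    have h6 := h5 i hi
    rw [hp i hi] at h6
    exact ⟨h6.2, z i, hlf i hi, h6.1⟩
  · rw [hp i hi]
    exact Leaf.weight_le_val (hlf i hi)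

end State

/-! ### Graphs of treewidth one -/

namespace SimpleGraph

theorem Preconnected.induce_induction {N : Type} {T : SimpleGraph N} {X : Set N}
    (hX : (T.induce X).Preconnected) {P : N → Prop} {a : N} (ha : a ∈ X) (hPa : P a)
    (hstep : ∀ x ∈ X, ∀ y ∈ X, T.Adj x y → P x → P y) : ∀ b ∈ X, P b := by
  intro b hb
  obtain ⟨p⟩ := hX ⟨a, ha⟩ ⟨b, hb⟩
  have key : ∀ {u v : X} (_ : (T.induce X).Walk u v), P u → P v := by
    intro u v p
    induction p with
    | nil => exact id
    | cons h p ih => exact fun hu => ih (hstep _ (Subtype.coe_prop _) _ (Subtype.coe_prop _) h hu)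
  exact key p hPa

theorem IsAcyclic.length_eq_dist {N : Type} {T : SimpleGraph N} (hT : T.IsAcyclic) {u v : N}
    {p : T.Walk u v} (hp : p.IsPath) : p.length = T.dist u v := by
  obtain ⟨q, hq, hlen⟩ := p.reachable.exists_path_of_dist
  rw [← hlen, Subtype.mk.inj ((hT.subsingleton_path u v).elim ⟨p, hp⟩ ⟨q, hq⟩)]

/-- `t` lies on the path from `a` to `r`. -/
def Below {N : Type} (T : SimpleGraph N) (r t a : N) : Prop :=
  ∃ p : T.Walk a r, p.IsPath ∧ t ∈ p.support

theorem Below.of_adj {N : Type} {T : SimpleGraph N} (hT : T.IsAcyclic) {r t a b : N}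
    (h : T.Below r t a) (hab : T.Adj a b) (hat : a ≠ t ∨ T.dist t r ≤ T.dist b r) :
    T.Below r t b := by
  classical
  obtain ⟨p, hp, ht⟩ := h
  by_cases hb : b ∈ p.support
  · have hsnd := hT.eq_snd_of_adj_start hp hab hb
    cases p with
    | nil =>
      rw [Walk.support_nil, List.mem_singleton] at hb
      exact absurd hb.symm hab.ne
    | cons hac q =>
      rw [Walk.snd_cons] at hsnd
      subst hsnd
      have hq := (Walk.cons_isPath_iff _ _).1 hp
      refine ⟨q, hq.1, ?_⟩
      rw [Walk.support_cons, List.mem_cons] at ht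
      rcases ht with rfl | ht
      · rcases hat with hat | hat
        · exact absurd rfl hat
        · rw [← hT.length_eq_dist hp, ← hT.length_eq_dist hq.1, Walk.length_cons] at hat
          omega
      · exact ht
  · exact ⟨.cons hab.symm p, (Walk.cons_isPath_iff _ _).2 ⟨hp, hb⟩, by simp [ht]⟩

theorem Below.dist_lt {N : Type} {T : SimpleGraph N} (hT : T.IsAcyclic) {r t a : N}
    (h : T.Below r t a) (hat : a ≠ t) : T.dist t r < T.dist a r := by
  classical
  obtain ⟨p, hp, ht⟩ := h
  rw [← hT.length_eq_dist hp, ← hT.length_eq_dist (hp.dropUntil ht),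
    ← congrArg Walk.length (p.take_spec ht), Walk.length_append]
  have : (p.takeUntil t ht).length ≠ 0 := fun h => hat (Walk.eq_of_length_eq_zero h)
  omega

end SimpleGraph

/-- A graph of treewidth at most one is a forest.  Among the vertices of a cycle, take one whose bags start as
far as possible from a root of the decomposition tree: the bag where they start contains both
its neighbours on the cycle. -/
theorem TreewidthAtMost.isAcyclic {V : Type} {G : SimpleGraph V} (h : TreewidthAtMost G 1) :
    G.IsAcyclic := by
  obtain ⟨N, T, bag, -, hT, hcov, hadj, hconn, hcard⟩ := h
  intro v₀ c hc
  obtain ⟨r⟩ := hT.connected.nonempty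
  have htop : ∀ v, ∃ t, v ∈ bag t ∧ ∀ t', v ∈ bag t' → T.dist t r ≤ T.dist t' r := by
    intro v
    obtain ⟨t, ht, hmin⟩ := (measure fun t => T.dist t r).wf.has_min {t | v ∈ bag t} (hcov v)
    exact ⟨t, ht, fun t' ht' => not_lt.1 (hmin t' ht')⟩
  choose top htop hmin using htop
  obtain ⟨v, hv, -, hmax⟩ := List.exists_max_of_exists c.support (fun _ => True)
    (fun v => (T.dist (top v) r : ℝ)) ⟨v₀, c.start_mem_support, trivial⟩
  have hbelow : ∀ s, v ∈ bag s → T.Below r (top v) s := by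
    refine SimpleGraph.Preconnected.induce_induction (hconn v) (htop v) ?_
      fun x _ y hy hxy hx => hx.of_adj hT.isAcyclic hxy (.inr (hmin v y hy))
    obtain ⟨p, hp, -⟩ := hT.existsUnique_path (top v) r
    exact ⟨p, hp, p.start_mem_support⟩
  have hmem : ∀ u ∈ c.support, G.Adj v u → u ∈ bag (top v) := by
    intro u hu hvu
    obtain ⟨s, hvs, hus⟩ := hadj v u hvu
    by_contra hut
    have hne : ∀ x, u ∈ bag x → x ≠ top v := fun x hx h => hut (h ▸ hx)
    have := SimpleGraph.Preconnected.induce_induction (hconn u) hus (hbelow s hvs)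
      (fun x hx y _ hxy h => h.of_adj hT.isAcyclic hxy (.inl (hne x hx))) (top u) (htop u)
    have h1 := this.dist_lt hT.isAcyclic (hne _ (htop u))
    have h2 := hmax u hu trivial
    rw [Nat.cast_le] at h2
    omega
  obtain ⟨x, y, hxy, hset⟩ := Set.ncard_eq_two.1 (hc.ncard_neighborSet_toSubgraph_eq_two hv)
  have hx : c.toSubgraph.Adj v x := by
    rw [← SimpleGraph.Subgraph.mem_neighborSet, hset]; simp
  have hy : c.toSubgraph.Adj v y := by
    rw [← SimpleGraph.Subgraph.mem_neighborSet, hset]; simp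
  have hx' := hmem x (c.mem_verts_toSubgraph.1 hx.snd_mem) hx.adj_sub
  have hy' := hmem y (c.mem_verts_toSubgraph.1 hy.snd_mem) hy.adj_sub
  have h3 : ({v, x, y} : Set V).encard = 3 :=
    Set.encard_eq_three.2 ⟨v, x, y, hx.adj_sub.ne, hy.adj_sub.ne, hxy, rfl⟩
  have h4 : ({v, x, y} : Set V) ⊆ bag (top v) := by
    rintro z (rfl | rfl | rfl)
    exacts [htop _, hx', hy']
  have h5 := (Set.encard_le_encard h4).trans (hcard _)
  rw [h3] at h5
  norm_num at h5

/-- In a forest, if every vertex of a level has two neighbours in the level below, then paths of growing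
length start in the levels. -/
theorem SimpleGraph.IsAcyclic.exists_path_of_levels {V : Type} {G : SimpleGraph V}
    (hG : G.IsAcyclic) (L : ℕ → Set V)
    (h0 : ∀ v ∈ L 0, ∃ x y, x ≠ y ∧ G.Adj v x ∧ G.Adj v y)
    (hs : ∀ r, ∀ v ∈ L (r + 1), ∃ x ∈ L r, ∃ y ∈ L r, x ≠ y ∧ G.Adj v x ∧ G.Adj v y) :
    ∀ r, ∀ v ∈ L r, ∀ u, ∃ (w : V) (p : G.Walk v w), p.IsPath ∧ p.length = r + 1 ∧
      (G.Adj v u → u ∉ p.support) := by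
  have step : ∀ (v u x w : V) (p : G.Walk x w) (hvx : G.Adj v x), p.IsPath → x ≠ u →
      v ∉ p.support → (Walk.cons hvx p).IsPath ∧
        (G.Adj v u → u ∉ (Walk.cons hvx p).support) := by
    intro v u x w p hvx hp hxu hv
    have hp' : (Walk.cons hvx p).IsPath := (Walk.cons_isPath_iff _ _).2 ⟨hp, hv⟩
    refine ⟨hp', fun hvu hu => hxu ?_⟩
    have := hG.eq_snd_of_adj_start hp' hvu hu
    rw [this, Walk.snd_cons]
  have pick : ∀ {x y u : V}, x ≠ y → ∀ {P : V → Prop}, P x → P y → ∃ z, P z ∧ z ≠ u := by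
    intro x y u hxy P hx hy
    by_cases h : x = u
    · exact ⟨y, hy, fun h' => hxy (h.trans h'.symm)⟩
    · exact ⟨x, hx, h⟩
  intro r
  induction r with
  | zero =>
    intro v hv u
    obtain ⟨x, y, hxy, hx, hy⟩ := h0 v hv
    obtain ⟨z, hz, hzu⟩ := pick (u := u) hxy hx hy
    refine ⟨z, .cons hz .nil, ?_⟩
    obtain ⟨h1, h2⟩ := step v u z z .nil hz .nil hzu (by simpa using hz.ne)
    exact ⟨h1, rfl, h2⟩
  | succ r ih =>
    intro v hv u
    obtain ⟨x, hxL, y, hyL, hxy, hx, hy⟩ := hs r v hv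
    obtain ⟨z, ⟨hzL, hz⟩, hzu⟩ :=
      pick (u := u) hxy (P := fun z => z ∈ L r ∧ G.Adj v z) ⟨hxL, hx⟩ ⟨hyL, hy⟩
    obtain ⟨w, p, hp, hlen, hvp⟩ := ih z hzL v
    obtain ⟨h1, h2⟩ := step v u z w p hz hp hzu (hvp hz.symm)
    exact ⟨w, .cons hz p, h1, by rw [Walk.length_cons, hlen], h2⟩

/-! ### The number of rounds -/

namespace State

variable {K : Bool → Toolkit M F strict} {S : State F strict}

/-- A remaining variable with two remaining neighbours. -/
def Inner (S : State F strict) (i : ℕ) : Prop :=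
  i ∈ S.act ∧ ∃ j ∈ S.nbrs i, ∃ k ∈ S.nbrs i, j ≠ k

theorem adj_of_adj_round {i j : ℕ} (h : (S.round K).adj i j = true) : S.adj i j = true := by
  rw [adj_iff] at h ⊢
  refine ⟨h.1, h.2.imp ?_ ?_⟩
  · rintro ⟨C, hC, h⟩
    exact ⟨C, (List.mem_filter.1 hC).1, h⟩
  · rintro ⟨e, he, h⟩
    exact ⟨e, (List.mem_filter.1 he).1, h⟩

theorem mem_act_round {i : ℕ} : i ∈ (S.round K).act ↔ i ∈ S.act ∧ ¬ S.isLeaf i = true := by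
  simp only [round, List.mem_filter, Bool.not_eq_true', Bool.not_eq_true]

theorem nbrs_round_subset {i j : ℕ} (h : j ∈ (S.round K).nbrs i) : j ∈ S.nbrs i := by
  rw [mem_nbrs] at h ⊢
  exact ⟨(mem_act_round.1 h.1).1, adj_of_adj_round h.2⟩

/-- A remaining variable that is neither inner nor a leaf is the larger one of two variables that have no
neighbours but each other. -/
theorem exists_partner {i : ℕ} (hi : i ∈ S.act) (hl : ¬ S.isLeaf i = true) (hn : ¬ S.Inner i) :
    ∃ j ∈ S.nbrs i, (∀ k ∈ S.nbrs i, k = j) ∧ (∀ k ∈ S.nbrs j, k = i) ∧ ¬ i < j := by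
  have h1 : ∀ j ∈ S.nbrs i, ∀ k ∈ S.nbrs i, j = k := by
    intro j hj k hk
    by_contra hjk
    exact hn ⟨hi, j, hj, k, hk, hjk⟩
  rw [isLeaf_iff] at hl
  push Not at hl
  obtain ⟨j, hj, h2, h3⟩ := hl h1
  exact ⟨j, hj, fun k hk => h1 k hk j hj, h2, h3.not_gt⟩

theorem Inner.of_round {i : ℕ} (h : (S.round K).Inner i) : S.Inner i := by
  obtain ⟨hi, j, hj, k, hk, hjk⟩ := h
  exact ⟨(mem_act_round.1 hi).1, j, nbrs_round_subset hj, k, nbrs_round_subset hk, hjk⟩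

theorem Inner.nbr_of_round {i j : ℕ} (h : (S.round K).Inner i) (hj : j ∈ (S.round K).nbrs i) :
    S.Inner j := by
  have hi' := h.of_round
  have hja := mem_act_round.1 (mem_nbrs.1 hj).1
  by_contra hn
  obtain ⟨k, hk, h1, h2, -⟩ := exists_partner hja.1 hja.2 hn
  have hij : i ∈ S.nbrs j :=
    mem_nbrs.2 ⟨hi'.1, adj_comm.1 (mem_nbrs.1 (nbrs_round_subset hj)).2⟩
  obtain rfl := h1 i hij
  obtain ⟨-, a, ha, b, hb, hab⟩ := hi'
  exact hab ((h2 a ha).trans (h2 b hb).symm)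

theorem act_eq_nil_of_not_inner (hn : ∀ i, ¬ S.Inner i) : ((S.round K).round K).act = [] := by
  rw [List.eq_nil_iff_forall_not_mem]
  intro i hi
  obtain ⟨hi1, hl1⟩ := mem_act_round.1 hi
  obtain ⟨hi2, hl2⟩ := mem_act_round.1 hi1
  obtain ⟨j, hj, h1, h2, h3⟩ := exists_partner hi2 hl2 (hn i)
  have hji : j ≠ i := fun h => (adj_iff.1 (mem_nbrs.1 hj).2).1 h.symm
  have hjl : S.isLeaf j = true := by
    refine isLeaf_iff.2 ⟨fun k hk l hl => (h2 k hk).trans (h2 l hl).symm, fun k hk => .inr ?_⟩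
    rw [h2 k hk]
    omega
  refine hl1 (isLeaf_iff.2 ⟨fun k hk => ?_, fun k hk => ?_⟩) <;>
  · have := h1 k (nbrs_round_subset hk)
    subst this
    exact absurd hjl (mem_act_round.1 (mem_nbrs.1 hk).1).2

/-- If the variables form a forest whose components have diameter at most `d`, then none remains after `d + 2`
rounds. -/
theorem act_eq_nil {n d : ℕ} {G : SimpleGraph (Fin n)} (hG : G.IsAcyclic)
    (hd : ∀ i j, G.Reachable i j → G.dist i j ≤ d) (hn : ∀ i ∈ S.act, i < n)
    (hadj : ∀ i j : Fin n, S.adj i j = true → G.Adj i j) :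
    ((State.round K)^[d + 2] S).act = [] := by
  have hact : ∀ r i, i ∈ ((State.round K)^[r] S).act → i ∈ S.act := by
    intro r
    induction r with
    | zero => exact fun i => id
    | succ r ih =>
      intro i hi
      rw [Function.iterate_succ_apply'] at hi
      exact ih i (mem_act_round.1 hi).1
  have hadj' : ∀ r i j, ((State.round K)^[r] S).adj i j = true → S.adj i j = true := by
    intro r
    induction r with
    | zero => exact fun i j => id
    | succ r ih =>
      intro i j hij
      rw [Function.iterate_succ_apply'] at hij
      exact ih i j (adj_of_adj_round hij)
  have hnbr : ∀ r (i : Fin n) j, j ∈ ((State.round K)^[r] S).nbrs i →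
      ∃ j' : Fin n, j'.1 = j ∧ G.Adj i j' := by
    intro r i j hj
    obtain ⟨h1, h2⟩ := mem_nbrs.1 hj
    exact ⟨⟨j, hn j (hact r j h1)⟩, rfl, hadj _ _ (hadj' r _ _ h2)⟩
  rw [Function.iterate_succ_apply', Function.iterate_succ_apply']
  refine act_eq_nil_of_not_inner fun i hi => ?_
  have hin := hn i (hact d i hi.1)
  obtain ⟨w, p, hp, hlen, -⟩ := hG.exists_path_of_levels
    (fun r => {i : Fin n | ((State.round K)^[r] S).Inner i}) (fun v hv => by
      obtain ⟨-, x, hx, y, hy, hxy⟩ := hv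
      obtain ⟨x', rfl, hx'⟩ := hnbr 0 v x hx
      obtain ⟨y', rfl, hy'⟩ := hnbr 0 v y hy
      exact ⟨x', y', fun h => hxy (congrArg _ h), hx', hy'⟩) (fun r v hv => by
      have hv' := hv
      obtain ⟨-, x, hx, y, hy, hxy⟩ := hv
      obtain ⟨x', rfl, hx'⟩ := hnbr (r + 1) v x hx
      obtain ⟨y', rfl, hy'⟩ := hnbr (r + 1) v y hy
      rw [Set.mem_ofPred_eq, Function.iterate_succ_apply'] at hv'
      rw [Function.iterate_succ_apply'] at hx hy
      exact ⟨x', hv'.nbr_of_round hx, y', hv'.nbr_of_round hy, fun h => hxy (congrArg _ h), hx',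
        hy'⟩) d ⟨i, hin⟩ hi ⟨i, hin⟩
  have h1 := hd _ _ p.reachable
  rw [← hG.length_eq_dist hp, hlen] at h1
  omega

end State

/-! ### The initial state -/

/-- The elements of a list with their positions. -/
def List.indexed {β : Type} (l : List β) : List (ℕ × β) := l.zipIdx.map Prod.swap

@[fun_prop]
theorem PolyTime.listIndexed {l : α → List β} (hl : PolyTime M l) :
    PolyTime M fun a => (l a).indexed := by
  refine comp (g := fun l : List β => l.indexed) ?_ hl
  have h : ∀ l : List β, l.foldl (fun (s : ℕ × List (ℕ × β)) b => (s.1 + 1, (s.1, b) :: s.2))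
      (0, []) = (l.length, l.indexed.reverse) := by
    intro l
    induction l using List.reverseRecOn with
    | nil => rfl
    | append_singleton l b ih =>
      rw [List.foldl_append, ih]
      simp [List.indexed, List.zipIdx_append]
  have hsize : ∀ l : List β, esize l.indexed ≤ 3 * esize l := by
    intro l
    induction l using List.reverseRecOn with
    | nil => simp [List.indexed]
    | append_singleton l b ih =>
      have h1 : (l ++ [b]).indexed = l.indexed ++ [(l.length, b)] := by
        simp [List.indexed, List.zipIdx_append]
      have h2 := esize_append l [b]
      have h3 := esize_append l.indexed [(l.length, b)]
      have h4 := esize_pos b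
      rw [h1]
      simp only [esize_cons, esize_nil, esize_prod, esize_nat] at h2 h3
      omega
  have h' : (fun l : List β => l.indexed) = fun l => (l.foldl
      (fun (s : ℕ × List (ℕ × β)) b => (s.1 + 1, (s.1, b) :: s.2)) (0, [])).2.reverse := by
    funext l
    simp [h]
  rw [h']
  refine listReverse (prodSnd (foldl (i := fun _ => ((0 : ℕ), ([] : List (ℕ × β))))
    (g := fun _ (s : ℕ × List (ℕ × β)) b => (s.1 + 1, (s.1, b) :: s.2)) id' (by fun_prop)
    (by fun_prop) (3 * X + 2) fun l l' hl' => ?_))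
  rw [h]
  have h1 := hsize l'
  have h2 := esize_le_of_prefix hl'
  simp only [esize_prod, esize_nat, esize_reverse, eval_add, eval_mul, eval_ofNat, eval_X]
  omega

theorem List.indexed_ofFn {β : Type} {n : ℕ} (u : Fin n → β) :
    (List.ofFn u).indexed = List.ofFn fun i => ((i : ℕ), u i) := by
  refine List.ext_getElem (by simp [indexed]) fun i h1 h2 => ?_
  simp [indexed]

/-- The input of the machine: the number of variables, the clauses, the univariate and the bivariate factors. -/
abbrev RawProblem (F : FunFamily) :=
  ℕ × List (List RawLit) × List F.Uni × List ((ℕ × ℕ) × F.Bi)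

/-- A literal as the machine sees it. -/
def LinLit.raw {n : ℕ} (l : LinLit n) : RawLit :=
  (l.positive, (match l.atom.rel with | .le => false | .eq => true), List.ofFn l.atom.coeff,
    l.atom.bound)

/-- A problem as the machine sees it. -/
def MapProblem.raw (P : MapProblem F) : RawProblem F :=
  (P.n, P.clauses.map fun C => C.map LinLit.raw, List.ofFn P.unary,
    P.pairs.map fun e => ((e.1.1, e.1.2), e.2))

theorem MapProblem.enc_raw (P : MapProblem F) : enc P.raw = P.code := by
  have h : ∀ l : LinLit P.n, enc l.raw = l.code := by
    intro l
    simp only [enc, LinLit.raw, LinLit.code, Val.ofVec, List.map_ofFn]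
    rfl
  simp only [raw, code]
  simp only [enc] at h ⊢
  simp only [List.map_map, List.map_ofFn]
  congr 4
  funext C
  rw [Function.comp_apply, List.map_map]
  congr 1
  exact List.map_congr_left fun l _ => h l

/-- The interval of all numbers. -/
def AffInterval.full (strict : Bool) : AffInterval strict where
  l := .infinite
  u := .infinite
  l_ok := False.elim
  u_ok := False.elim

theorem AffInterval.mem_full (x y : ℝ) : y ∈ (AffInterval.full strict).toSet x := ⟨trivial, trivial⟩

/-- A univariate factor as a message. -/
def Msg.ofUni (strict : Bool) (f : F.Uni) : Msg F strict where
  pieces := [(AffInterval.full strict, f)]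
  dom := Set.univ
  val x := ENNReal.ofReal (F.uni f x)

theorem Msg.ofUni_valid {f : F.Uni} (hf : ∀ x, 0 ≤ F.uni f x) : (Msg.ofUni strict f).Valid := by
  have hm : (AffInterval.full strict, f) ∈ (Msg.ofUni strict f).pieces := List.mem_singleton.2 rfl
  refine ⟨fun x => ⟨fun _ => ⟨_, hm, AffInterval.mem_full _ _⟩, fun _ => trivial⟩,
    fun x _ _ => ⟨fun p hp _ => ?_, _, hm, AffInterval.mem_full _ _, rfl⟩⟩
  rw [List.mem_singleton.1 hp]
  exact (exactApprox_ofReal (hf x)).lower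

/-- The state from which the elimination starts. -/
def State.initial (strict : Bool) (I : RawProblem F) : State F strict where
  root := I.1
  act := List.range I.2.2.1.length
  clauses := I.2.1
  pairs := I.2.2.2
  msgs := I.2.2.1.indexed.map fun p => (p.1, Msg.ofUni strict p.2)

@[fun_prop]
theorem PolyTime.stateInitial {I : α → RawProblem F} (hI : PolyTime M I) :
    PolyTime M fun a => State.initial strict (I a) := by
  unfold State.initial Msg.ofUni AffInterval.full
  fun_prop

theorem coef_ofFn {n : ℕ} (c : Fin n → ℝ) (i : Fin n) : coef (List.ofFn c) i = c i := by
  simp [coef]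

theorem coef_ofFn_of_le {n : ℕ} (c : Fin n → ℝ) {k : ℕ} (hk : n ≤ k) :
    coef (List.ofFn c) k = 0 := by
  rw [coef, List.getD_eq_default _ _ (by simpa using hk)]

theorem LinLit.test_raw {n : ℕ} (l : LinLit n) (z : ℕ → ℝ) :
    l.raw.test (l.raw.fullDiff z) = true ↔ l.Holds fun i => z i := by
  have h : l.raw.fullDiff z = ∑ i, l.atom.coeff i * z i - l.atom.bound := by
    simp only [RawLit.fullDiff, raw, List.length_ofFn, Finset.sum_range, coef_ofFn]
  rw [h]
  obtain ⟨⟨c, rel, b⟩, pos⟩ := l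
  cases rel <;> cases pos <;>
    simp [raw, RawLit.test, Holds, LinAtom.Holds, ← Bool.not_eq_true, sub_eq_zero]

namespace MapProblem

variable {P : MapProblem F}

theorem clauseVar_raw {C : LinClause P.n} {i : ℕ} :
    clauseVar (C.map LinLit.raw) i = true ↔ ∃ h : i < P.n, ⟨i, h⟩ ∈ LinClause.vars C := by
  rw [clauseVar_iff]
  constructor
  · rintro ⟨_, hl, hc⟩
    obtain ⟨l, hl', rfl⟩ := List.mem_map.1 hl
    have hi : i < P.n := by
      by_contra hi
      exact hc (coef_ofFn_of_le _ (not_lt.1 hi))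
    exact ⟨hi, l, hl', fun h => hc ((coef_ofFn _ ⟨i, hi⟩).trans h)⟩
  · rintro ⟨hi, l, hl, hc⟩
    exact ⟨l.raw, List.mem_map.2 ⟨l, hl, rfl⟩, fun h => hc ((coef_ofFn _ ⟨i, hi⟩).symm.trans h)⟩

theorem mem_act_initial {i : ℕ} : i ∈ (State.initial strict P.raw).act ↔ i < P.n := by
  simp [State.initial, raw]

theorem mem_msgs_initial {m : ℕ × Msg F strict} : m ∈ (State.initial strict P.raw).msgs ↔
    ∃ i : Fin P.n, m = ((i : ℕ), Msg.ofUni strict (P.unary i)) := by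
  simp only [State.initial, raw, List.indexed_ofFn, List.map_ofFn, List.mem_ofFn,
    Function.comp_apply, eq_comm]

theorem initial_valid (hs : strict = false → P.NonStrict) : (State.initial strict P.raw).Valid where
  nodup := List.nodup_range
  act_lt := fun i hi => mem_act_initial.1 hi
  clause_vars := by
    intro C hC i hi
    obtain ⟨C, -, rfl⟩ := List.mem_map.1 hC
    exact mem_act_initial.2 (clauseVar_raw.1 hi).1
  clause_two := by
    intro C hC i j k hi hj hk
    obtain ⟨C, hC', rfl⟩ := List.mem_map.1 hC
    obtain ⟨hi', hi⟩ := clauseVar_raw.1 hi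
    obtain ⟨hj', hj⟩ := clauseVar_raw.1 hj
    obtain ⟨hk', hk⟩ := clauseVar_raw.1 hk
    by_contra! hne
    have h3 : ({⟨i, hi'⟩, ⟨j, hj'⟩, ⟨k, hk'⟩} : Set (Fin P.n)).encard = 3 :=
      Set.encard_eq_three.2 ⟨_, _, _, by simpa using hne.1, by simpa using hne.2.1,
        by simpa using hne.2.2, rfl⟩
    have h4 : ({⟨i, hi'⟩, ⟨j, hj'⟩, ⟨k, hk'⟩} : Set (Fin P.n)) ⊆ LinClause.vars C := by
      rintro x (rfl | rfl | rfl)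
      exacts [hi, hj, hk]
    have h5 := (Set.encard_le_encard h4).trans (P.clauses_bivariate C hC')
    rw [h3] at h5
    norm_num at h5
  positive := by
    intro h C hC l hl
    obtain ⟨C, hC', rfl⟩ := List.mem_map.1 hC
    obtain ⟨l, hl', rfl⟩ := List.mem_map.1 hl
    exact hs h C hC' l hl'
  pair_lt := by
    intro e he
    obtain ⟨e, he', rfl⟩ := List.mem_map.1 he
    exact P.pairs_lt e he'
  pair_vars := by
    intro e he i hi
    obtain ⟨e, he', rfl⟩ := List.mem_map.1 he
    rw [mem_act_initial]
    rcases pairVar_iff.1 hi with rfl | rfl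
    exacts [e.1.1.2, e.1.2.2]
  pair_nonneg := by
    intro e he
    obtain ⟨e, he', rfl⟩ := List.mem_map.1 he
    exact P.pairs_nonneg e he'
  msgs := by
    intro m hm
    obtain ⟨i, rfl⟩ := mem_msgs_initial.1 hm
    exact Msg.ofUni_valid (P.unary_nonneg i)
  exists_msg := fun i hi =>
    ⟨_, mem_msgs_initial.2 ⟨⟨i, mem_act_initial.1 hi⟩, rfl⟩, rfl⟩
  msg_vars := by
    intro m hm
    obtain ⟨i, rfl⟩ := mem_msgs_initial.1 hm
    exact .inl (mem_act_initial.2 i.2)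

theorem feas_initial (z : ℕ → ℝ) :
    (State.initial strict P.raw).Feas z ↔ (fun i : Fin P.n => z i) ∈ P.feasible := by
  have h1 : ∀ C : LinClause P.n, clauseHolds (C.map LinLit.raw) z ↔
      ∃ l ∈ C, l.Holds fun i => z i := by
    intro C
    simp only [clauseHolds, List.mem_map, exists_exists_and_eq_and, LinLit.test_raw]
  constructor
  · intro h C hC
    exact (h1 C).1 (h.1 _ (List.mem_map.2 ⟨C, hC, rfl⟩))
  · intro h
    refine ⟨fun C hC => ?_, fun m hm => ?_⟩
    · obtain ⟨C, hC', rfl⟩ := List.mem_map.1 hC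
      exact (h1 C).2 (h C hC')
    · obtain ⟨i, rfl⟩ := mem_msgs_initial.1 hm
      trivial

theorem density_nonneg (x : Fin P.n → ℝ) : 0 ≤ P.density x := by
  refine mul_nonneg (Finset.prod_nonneg fun i _ => P.unary_nonneg i _) (List.prod_nonneg ?_)
  intro r hr
  obtain ⟨e, he, rfl⟩ := List.mem_map.1 hr
  exact P.pairs_nonneg e he _ _

theorem weight_initial (z : ℕ → ℝ) :
    (State.initial strict P.raw).weight z = ENNReal.ofReal (P.density fun i => z i) := by
  have h1 : ((State.initial strict P.raw).msgs.map fun m => m.2.val (z m.1)).prod =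
      ENNReal.ofReal (∏ i, F.uni (P.unary i) (z i)) := by
    simp only [State.initial, raw, List.indexed_ofFn, List.map_ofFn, List.prod_ofFn]
    rw [ENNReal.ofReal_prod_of_nonneg fun i _ => P.unary_nonneg i _]
    rfl
  have h2 : ∀ L : List ((Fin P.n × Fin P.n) × F.Bi), (∀ e ∈ L, ∀ x y, 0 ≤ F.bi e.2 x y) →
      (L.map fun e => ENNReal.ofReal (F.bi e.2 (z e.1.1) (z e.1.2))).prod =
        ENNReal.ofReal (L.map fun e => F.bi e.2 (z e.1.1) (z e.1.2)).prod := by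
    intro L
    induction L with
    | nil => simp
    | cons e L ih =>
      intro h
      rw [List.map_cons, List.map_cons, List.prod_cons, List.prod_cons,
        ENNReal.ofReal_mul (h e (by simp) _ _), ih fun e he => h e (by simp [he])]
  rw [State.weight, h1, density, ENNReal.ofReal_mul (Finset.prod_nonneg fun i _ =>
    P.unary_nonneg i _), mul_comm, ← h2 P.pairs P.pairs_nonneg]
  simp only [State.initial, raw, List.map_map]
  rfl

theorem adj_initial {i j : Fin P.n} (h : (State.initial strict P.raw).adj i j = true) :
    P.globalGraph.Adj i j := by
  obtain ⟨hij, h⟩ := State.adj_iff.1 h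
  have hij' : i ≠ j := fun h => hij (congrArg _ h)
  rw [globalGraph, SimpleGraph.fromRel_adj]
  refine ⟨hij', ?_⟩
  rcases h with ⟨C, hC, hi, hj⟩ | ⟨e, he, hi, hj⟩
  · obtain ⟨C, hC', rfl⟩ := List.mem_map.1 hC
    exact .inl (.inl ⟨C, hC', (clauseVar_raw.1 hi).2, (clauseVar_raw.1 hj).2⟩)
  · obtain ⟨e, he', rfl⟩ := List.mem_map.1 he
    have key : ∀ {a b : Fin P.n}, e.1.1.1 = a.1 → e.1.2.1 = b.1 → e.1 = (a, b) :=
      fun h1 h2 => Prod.ext (Fin.ext h1) (Fin.ext h2)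
    rcases pairVar_iff.1 hi with hi | hi <;> rcases pairVar_iff.1 hj with hj | hj
    · exact absurd (hi.symm.trans hj) hij
    · exact .inl (.inr ⟨e, he', key hi hj⟩)
    · exact .inr (.inr ⟨e, he', key hj hi⟩)
    · exact absurd (hi.symm.trans hj) hij

end MapProblem

/-! ### Several rounds -/

namespace State

variable {K : Bool → Toolkit M F strict} {S S₀ : State F strict}

/-- The totals of `S` are the suprema of those of `S₀` over the values of all eliminated variables. -/
def Extends (S S₀ : State F strict) : Prop :=
  ∀ x : ℕ → ℝ, S.total x =
    ⨆ (z : ℕ → ℝ) (_ : ∀ k, k ∈ S.act ∨ k = S.root → z k = x k), S₀.total z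

theorem Valid.extends_self (h : S.Valid) : S.Extends S := by
  intro x
  refine le_antisymm ?_ (iSup₂_le fun z hz => (h.total_congr hz).2.le)
  exact le_iSup₂ (f := fun (z : ℕ → ℝ) (_ : ∀ k, k ∈ S.act ∨ k = S.root → z k = x k) =>
    S.total z) x fun _ _ => rfl

theorem not_mem_leaves_of_mem_round {k : ℕ} (h : S.Valid)
    (hk : k ∈ (S.round K).act ∨ k = (S.round K).root) : k ∉ S.leaves := by
  intro hl
  rcases hk with hk | hk
  · exact (mem_act_round.1 hk).2 (mem_leaves.1 hl).2
  · exact h.root_not_mem ((show k = S.root from hk) ▸ (mem_leaves.1 hl).1)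

theorem mem_round_of_not_mem_leaves {k : ℕ} (hk : k ∈ S.act ∨ k = S.root) (hl : k ∉ S.leaves) :
    k ∈ (S.round K).act ∨ k = (S.round K).root :=
  hk.imp_left fun hk => mem_act_round.2 ⟨hk, fun h' => hl (mem_leaves.2 ⟨hk, h'⟩)⟩

theorem Extends.round (hK : Oriented K) (h : S.Valid) (hS : S.Extends S₀) :
    (S.round K).Extends S₀ := by
  intro x
  rw [total_round hK h]
  refine le_antisymm (iSup₂_le fun z hz => ?_) (iSup₂_le fun w hw => ?_)
  · rw [hS z]
    refine iSup₂_le fun w hw => ?_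
    refine le_iSup₂ (f := fun (z : ℕ → ℝ) (_ : ∀ k, k ∈ (S.round K).act ∨ k = (S.round K).root →
      z k = x k) => S₀.total z) w fun k hk => ?_
    rw [hw k (hk.imp_left fun hk => (mem_act_round.1 hk).1),
      hz k (not_mem_leaves_of_mem_round h hk)]
  · let z : ℕ → ℝ := fun k => if k ∈ S.leaves then w k else x k
    have hz : ∀ k, k ∉ S.leaves → z k = x k := fun k hk => if_neg hk
    refine le_trans ?_ (le_iSup₂ (f := fun (z : ℕ → ℝ)
      (_ : ∀ k, k ∉ S.leaves → z k = x k) => S.total z) z hz)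
    rw [hS z]
    refine le_iSup₂ (f := fun (w : ℕ → ℝ) (_ : ∀ k, k ∈ S.act ∨ k = S.root → w k = z k) =>
      S₀.total w) w fun k hk => ?_
    by_cases hl : k ∈ S.leaves
    · exact (if_pos hl).symm
    · rw [hz k hl, hw k (mem_round_of_not_mem_leaves hk hl)]

theorem iterate_valid (hK : Oriented K) (h : S.Valid) (k : ℕ) : ((State.round K)^[k] S).Valid := by
  induction k with
  | zero => exact h
  | succ k ih =>
    rw [Function.iterate_succ_apply']
    exact round_valid hK ih

theorem iterate_extends (hK : Oriented K) (h : S.Valid) (k : ℕ) :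
    ((State.round K)^[k] S).Extends S := by
  induction k with
  | zero => exact h.extends_self
  | succ k ih =>
    rw [Function.iterate_succ_apply']
    exact ih.round hK (iterate_valid hK h k)

theorem iterate_feas (hK : Oriented K) (h : S.Valid) {z : ℕ → ℝ} (hz : S.Feas z) (k : ℕ) :
    ((State.round K)^[k] S).Feas z := by
  induction k with
  | zero => exact hz
  | succ k ih =>
    rw [Function.iterate_succ_apply']
    exact feas_round_of_feas (iterate_valid hK h k) ih

theorem iterate_root (k : ℕ) : ((State.round K)^[k] S).root = S.root := by
  induction k with
  | zero => rfl
  | succ k ih =>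
    rw [Function.iterate_succ_apply']
    exact ih

/-- The records of `k` rounds, the last round first. -/
def trail (K : Bool → Toolkit M F strict) : ℕ → State F strict → List (List (Record F strict))
  | 0, _ => []
  | k + 1, S => trail K k (S.round K) ++ [S.records K]

/-- The values that are chosen for the variables eliminated in `k` rounds. -/
def backtrack (K : Bool → Toolkit M F strict) (k : ℕ) (S : State F strict) : List (ℕ × ℝ) :=
  (S.trail K k).foldl (fun a R => assignLeaves K R a) []

theorem backtrack_succ (k : ℕ) : S.backtrack K (k + 1) =
    assignLeaves K (S.records K) ((S.round K).backtrack K k) := by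
  simp [backtrack, trail]

theorem backtrack_feas (hK : Oriented K) (k : ℕ) (h : S.Valid)
    (h0 : ((State.round K)^[k] S).Feas 0) : S.Feas (assignment (S.backtrack K k)) := by
  induction k generalizing S with
  | zero => exact h0
  | succ k ih =>
    rw [backtrack_succ]
    exact assignLeaves_feas hK h (ih (round_valid hK h) h0)

/-- Wherever the total after a round equals `t`, the suprema in the messages of this round are finite
and attained. -/
def Attains (K : Bool → Toolkit M F strict) (t : ℝ≥0∞) (S : State F strict) : Prop :=
  ∀ x, (S.round K).total x = t → ∀ i ∈ S.leaves, (S.message K i).val (x (S.parent i)) ≠ ∞ ∧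
    ∃ y, (S.leaf i).Feas y (x (S.parent i)) ∧
      (S.leaf i).weight (K (ltN i (S.parent i))) y (x (S.parent i)) =
        (S.message K i).val (x (S.parent i))

theorem backtrack_total (hK : Oriented K) (k : ℕ) (h : S.Valid)
    (h0 : ((State.round K)^[k] S).Feas 0)
    (hatt : ((State.round K)^[k] S).total 0 ≠ 0 → ∀ j,
      ((State.round K)^[j] S).Attains K (((State.round K)^[k] S).total 0)) :
    S.total (assignment (S.backtrack K k)) = ((State.round K)^[k] S).total 0 := by
  induction k generalizing S with
  | zero => rfl
  | succ k ih =>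
    have h1 := ih (round_valid hK h) h0 fun h' j => hatt h' (j + 1)
    rw [backtrack_succ, assignLeaves_total hK h (backtrack_feas hK k (round_valid hK h) h0)]
    · exact h1
    · intro hne
      rw [h1] at hne
      exact hatt hne 0 _ h1

/-- All messages are finite. -/
def FiniteMsgs (S : State F strict) : Prop := ∀ m ∈ S.msgs, ∀ x, m.2.val x ≠ ∞

theorem leaf_attained (hK : Oriented K) (hF : F.AttainsSup strict) (h : S.Valid)
    (hm : S.FiniteMsgs) {i : ℕ} (hi : i ∈ S.leaves) (x : ℝ) :
    (S.message K i).val x ≠ ∞ ∧ (x ∈ (S.message K i).dom → ∃ y, (S.leaf i).Feas y x ∧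
      (S.leaf i).weight (K (ltN i (S.parent i))) y x = (S.message K i).val x) := by
  refine Leaf.message_attained (leaf_valid hK h hi) (fun f I x hI => ?_) (fun m hm' => ?_) x
  · cases ltN i (S.parent i)
    · simp only [(hK _ _ _).2]
      exact (hF f I x hI).1
    · simp only [(hK _ _ _).1]
      exact (hF f I x hI).2
  · obtain ⟨m, hm₁, rfl⟩ := List.mem_map.1 hm'
    exact hm m (List.mem_filter.1 hm₁).1

theorem FiniteMsgs.round (hK : Oriented K) (hF : F.AttainsSup strict) (h : S.Valid)
    (hm : S.FiniteMsgs) : (S.round K).FiniteMsgs := by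
  intro m hm'
  rcases List.mem_append.1 hm' with hm' | hm'
  · exact hm m (List.mem_filter.1 hm').1
  · obtain ⟨i, hi, rfl⟩ := List.mem_map.1 hm'
    exact fun x => (leaf_attained hK hF h hm hi x).1

theorem FiniteMsgs.attains (hK : Oriented K) (hF : F.AttainsSup strict) (h : S.Valid)
    (hm : S.FiniteMsgs) {t : ℝ≥0∞} (ht : t ≠ 0) : S.Attains K t := by
  intro x hx i hi
  have hxf : (S.round K).Feas x := by
    by_contra hxf
    rw [total, if_neg hxf] at hx
    exact ht hx.symm
  have h1 := leaf_attained hK hF h hm hi (x (S.parent i))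
  exact ⟨h1.1, h1.2 (((feas_round_iff x).1 hxf).2 i hi)⟩

/-- If every assignment to the remaining variables with total `t` extends to one with total `t` in the initial
state, then the suprema in the messages are attained where the total is `t`. -/
theorem attains_of_extends (hK : Oriented K) (h : S.Valid) (hS : S.Extends S₀) {t : ℝ≥0∞}
    (ht : t ≠ 0) (ht' : t ≠ ∞)
    (hext : ∀ x, (S.round K).total x = t → ∃ z : ℕ → ℝ,
      (∀ k, k ∈ (S.round K).act ∨ k = (S.round K).root → z k = x k) ∧ S₀.total z = t) :
    S.Attains K t := by
  intro x hx
  refine messages_attained hK h (hx ▸ ht') (hx ▸ ht) ?_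
  obtain ⟨w, hw, hwt⟩ := hext x hx
  let z : ℕ → ℝ := fun k => if k ∈ S.leaves then w k else x k
  have hz : ∀ k, k ∉ S.leaves → z k = x k := fun k hk => if_neg hk
  refine ⟨z, hz, le_antisymm ?_ ?_⟩
  · rw [total_round hK h]
    exact le_iSup₂ (f := fun (z : ℕ → ℝ) (_ : ∀ k, k ∉ S.leaves → z k = x k) => S.total z) z hz
  · rw [hx, ← hwt, hS z]
    refine le_iSup₂ (f := fun (w : ℕ → ℝ) (_ : ∀ k, k ∈ S.act ∨ k = S.root → w k = z k) =>
      S₀.total w) w fun k hk => ?_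
    by_cases hl : k ∈ S.leaves
    · exact (if_pos hl).symm
    · rw [hz k hl, hw k (mem_round_of_not_mem_leaves hk hl)]

/-! ### Reading off the result -/

/-- A test for feasibility of the zero assignment. -/
def finalFeas (S : State F strict) : Bool :=
  S.clauses.all (fun C => C.any fun l => l.test (0 - l.2.2.2)) &&
    S.msgs.all fun m => !(m.2.active 0).isEmpty

/-- The product of the messages when no variable remains. -/
def finalValue (K : Toolkit M F strict) (S : State F strict) : ℝ :=
  (S.msgs.map fun m => ((K.maxUni (m.2.active 0)).map fun f => F.uni f 0).prod).prod

theorem finalFeas_iff (h : S.Valid) : S.finalFeas = true ↔ S.Feas 0 := by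
  rw [finalFeas, Bool.and_eq_true, List.all_eq_true, List.all_eq_true, Feas]
  refine and_congr ?_ ?_
  · simp only [List.any_eq_true, clauseHolds]
    refine forall_congr' fun C => forall_congr' fun _ => exists_congr fun l => ?_
    simp [RawLit.fullDiff]
  · refine forall_congr' fun m => forall_congr' fun hm => ?_
    rw [(h.msgs m hm).mem_dom_iff, Bool.not_eq_true', ← Bool.not_eq_true, List.isEmpty_iff]
    rfl

theorem finalValue_exact (K : Toolkit M F strict) (h : S.Valid) (hS : S.act = [])
    (h0 : S.Feas 0) : ExactApprox (S.finalValue K) (S.total 0) := by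
  have hp : S.pairs = [] := by
    rw [List.eq_nil_iff_forall_not_mem]
    intro e he
    have := h.pair_vars e he _ (pairVar_iff.2 (.inl rfl))
    rw [hS] at this
    cases this
  rw [total, if_pos h0, weight, hp, List.map_nil, List.prod_nil, one_mul, finalValue]
  refine ExactApprox.list_prod fun m hm hM => ?_
  have hd := h0.2 m hm
  obtain ⟨g, hg, hmax⟩ := K.maxUni_spec _ (((h.msgs m hm).mem_dom_iff _).1 hd)
  obtain ⟨h1, p, hp, hxp, hpe⟩ := (h.msgs m hm).2 _ hd hM
  obtain ⟨f, hfa, hfe⟩ := (hmax 0).1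
  obtain ⟨p', hp', hxp', rfl⟩ := Msg.mem_active.1 hfa
  obtain ⟨h2, h3⟩ := h1 p' hp' hxp' hM
  simp only [Pi.zero_apply] at hg hpe h2 h3 hxp ⊢
  rw [hg, List.map_singleton, List.prod_singleton]
  rw [← hfe] at h2 h3
  refine ⟨h2, le_antisymm h3 ?_⟩
  rw [← hpe]
  exact ENNReal.ofReal_le_ofReal ((hmax 0).2 ⟨p.2, Msg.mem_active.2 ⟨p, hp, hxp, rfl⟩, rfl⟩)

end State

/-! ### The program -/

instance {α : Type} [Enc α] : Enc (Option α) := ⟨fun a => a.elim .nil enc⟩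

instance : Literal M (none : Option α) := ⟨.nil, 1, fun v => Runs.nil v⟩

@[fun_prop]
theorem PolyTime.optionSome {f : α → β} (hf : PolyTime M f) : PolyTime M fun a => some (f a) := by
  obtain ⟨p, q, h⟩ := hf
  exact ⟨p, q, h⟩

/-- On the input `v`, the program `p` halts with output `w` after at most `q v.size` steps. -/
def RunsWithin (M : Machine ι) (p : Prog ι) (q : ℕ[X]) (v w : Val) : Prop :=
  ∃ t, Runs M.prim p v w t ∧ t ≤ q.eval v.size

theorem RunsWithin.seq {p p' : Prog ι} {q q' : ℕ[X]} {v a b : Val} (h : RunsWithin M p q v a)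
    (h' : RunsWithin M p' q' a b) : RunsWithin M (.seq p p') (q + q'.comp q + 1) v b := by
  obtain ⟨t, ht, htq⟩ := h
  obtain ⟨t', ht', htq'⟩ := h'
  refine ⟨_, ht.seq ht', ?_⟩
  have := q'.eval_nat_mono (ht.size_le.trans htq)
  simp only [eval_add, eval_comp, eval_one]
  simp only at this
  omega

/-- The data during the rounds: the variables, the current state and the records of the rounds. -/
abbrev Descent (F : FunFamily) (strict : Bool) :=
  List ℕ × State F strict × List (List (Record F strict))

/-- The data while values are chosen: whether there is a feasible point, the supremum and the variables; the
values chosen so far; the records of the rounds that are still to be undone. -/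
abbrev Ascent (F : FunFamily) (strict : Bool) :=
  (Bool × ℝ × List ℕ) × List (ℕ × ℝ) × List (List (Record F strict))

/-- The data before the first round. -/
def Descent.start (strict : Bool) (I : RawProblem F) : Descent F strict :=
  (List.range I.2.2.1.length, State.initial strict I, [])

/-- Some variable remains. -/
def Descent.busy (s : Descent F strict) : Bool := !s.2.1.act.isEmpty

/-- One round, with its records on top of the earlier ones. -/
def Descent.step (K : Bool → Toolkit M F strict) (s : Descent F strict) : Descent F strict :=
  (s.1, s.2.1.round K, s.2.1.records K :: s.2.2)

/-- The evaluation of the last state; no value is chosen yet, so the auxiliary variable counts as `0`. -/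
def Descent.turn (K : Bool → Toolkit M F strict) (s : Descent F strict) : Ascent F strict :=
  ((s.2.1.finalFeas, s.2.1.finalValue (K true), s.1), [], s.2.2)

/-- Some round is still to be undone. -/
def Ascent.busy (s : Ascent F strict) : Bool := !s.2.2.isEmpty

/-- The choice of values for the leaves of the last round that is still to be undone. -/
def Ascent.step (K : Bool → Toolkit M F strict) (s : Ascent F strict) : Ascent F strict :=
  (s.1, assignLeaves K (s.2.2.headD []) s.2.1, s.2.2.tail)

/-- The supremum and the chosen values, or nothing if there is no feasible point. -/
def Ascent.result (s : Ascent F strict) : Option (ℝ × List ℝ) :=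
  bif s.1.1 then some (s.1.2.1, s.1.2.2.map fun i => lookupVar i s.2.1) else none

namespace PolyTime

@[fun_prop]
theorem listTail {l : α → List β} (hl : PolyTime M l) : PolyTime M fun a => (l a).tail := by
  have h := listCases (f := fun _ => ([] : List β)) (g := fun _ _ t => t) hl (by fun_prop)
    (by fun_prop)
  convert h using 2 with a
  cases l a <;> rfl

theorem descentStart : PolyTime M (Descent.start (F := F) strict) := by
  unfold Descent.start; fun_prop

theorem descentBusy : PolyTime M (Descent.busy (F := F) (strict := strict)) := by
  unfold Descent.busy; fun_prop

theorem descentStep (K : Bool → Toolkit M F strict) : PolyTime M (Descent.step K) := by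
  unfold Descent.step; fun_prop

theorem descentTurn (K : Bool → Toolkit M F strict) : PolyTime M (Descent.turn K) := by
  have h := toolkitUni (K true) (f := fun p : (Descent F strict × ℕ × Msg F strict) × F.Uni => p.2)
    (x := fun _ => 0) (by fun_prop) (by fun_prop)
  unfold Descent.turn State.finalFeas State.finalValue
  fun_prop

theorem ascentBusy : PolyTime M (Ascent.busy (F := F) (strict := strict)) := by
  unfold Ascent.busy; fun_prop

theorem ascentStep (K : Bool → Toolkit M F strict) : PolyTime M (Ascent.step K) := by
  unfold Ascent.step; fun_prop

theorem ascentResult : PolyTime M (Ascent.result (F := F) (strict := strict)) := by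
  unfold Ascent.result; fun_prop

end PolyTime

theorem Descent.iterate_step (K : Bool → Toolkit M F strict) (k : ℕ) (s : Descent F strict) :
    (Descent.step K)^[k] s = (s.1, (State.round K)^[k] s.2.1, s.2.1.trail K k ++ s.2.2) := by
  induction k generalizing s with
  | zero => rfl
  | succ k ih =>
    rw [Function.iterate_succ_apply, ih]
    simp [Descent.step, State.trail]

theorem Ascent.iterate_step (K : Bool → Toolkit M F strict) (c : Bool × ℝ × List ℕ)
    (L L' : List (List (Record F strict))) (a : List (ℕ × ℝ)) :
    (Ascent.step K)^[L.length] (c, a, L ++ L') =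
      (c, L.foldl (fun a R => assignLeaves K R a) a, L') := by
  induction L generalizing a with
  | nil => rfl
  | cons R L ih =>
    rw [List.length_cons, Function.iterate_succ_apply]
    exact ih _

theorem State.length_trail (K : Bool → Toolkit M F strict) (k : ℕ) (S : State F strict) :
    (S.trail K k).length = k := by
  induction k generalizing S with
  | zero => rfl
  | succ k ih => rw [trail, List.length_append, ih]; rfl

/-- The output after `k` rounds. -/
def State.output (K : Bool → Toolkit M F strict) (k : ℕ) (S : State F strict) (n : ℕ) :
    Option (ℝ × List ℝ) :=
  bif ((State.round K)^[k] S).finalFeas then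
    some (((State.round K)^[k] S).finalValue (K true),
      (List.range n).map (assignment (S.backtrack K k)))
  else none

/-- One program computes the outputs, in polynomial time if the number of rounds is bounded. -/
theorem exists_program (K : Bool → Toolkit M F strict) : ∃ p : Prog ι, ∀ B : ℕ, ∃ q : ℕ[X],
    ∀ (P : MapProblem F) (k : ℕ), k ≤ B →
      (∀ j < k, ((State.round K)^[j] (State.initial strict P.raw)).act ≠ []) →
      ((State.round K)^[k] (State.initial strict P.raw)).act = [] →
      RunsWithin M p q P.code (enc ((State.initial strict P.raw).output K k P.n)) := by
  obtain ⟨p₁, q₁, h₁⟩ := PolyTime.descentStart (M := M) (F := F) (strict := strict)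
  obtain ⟨p₂, h₂⟩ := PolyTime.loop PolyTime.descentBusy (PolyTime.descentStep K)
  obtain ⟨p₃, q₃, h₃⟩ := PolyTime.descentTurn K
  obtain ⟨p₄, h₄⟩ := PolyTime.loop PolyTime.ascentBusy (PolyTime.ascentStep K)
  obtain ⟨p₅, q₅, h₅⟩ := PolyTime.ascentResult (M := M) (F := F) (strict := strict)
  refine ⟨.seq p₁ (.seq p₂ (.seq p₃ (.seq p₄ p₅))), fun B => ?_⟩
  obtain ⟨q₂, h₂⟩ := h₂ B
  obtain ⟨q₄, h₄⟩ := h₄ B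
  refine ⟨?q, fun P k hkB hlt hk => ?run⟩
  case run =>
    set S := State.initial strict P.raw with hS
    have hstart : Descent.start strict P.raw = (List.range P.n, S, []) := by
      simp [Descent.start, MapProblem.raw, hS]
    have r₁ : RunsWithin M p₁ q₁ P.code (enc (Descent.start strict P.raw)) := by
      rw [← MapProblem.enc_raw]
      exact h₁ P.raw
    have r₂ : RunsWithin M p₂ q₂ _ _ := h₂ (Descent.start strict P.raw) k hkB
      (fun j hj => by
        rw [Descent.iterate_step, hstart, Descent.busy]
        simpa using hlt j hj)
      (by
        rw [Descent.iterate_step, hstart, Descent.busy]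
        simpa using hk)
    have r₃ : RunsWithin M p₃ q₃ _ _ := h₃ ((Descent.step K)^[k] (Descent.start strict P.raw))
    have hdrop : ∀ j ≤ k, (Ascent.step K)^[j]
        (Descent.turn K ((Descent.step K)^[k] (Descent.start strict P.raw))) =
        ((((State.round K)^[k] S).finalFeas, ((State.round K)^[k] S).finalValue (K true),
          List.range P.n),
          ((S.trail K k).take j).foldl (fun a R => assignLeaves K R a) [],
          (S.trail K k).drop j) := by
      intro j hj
      have := Ascent.iterate_step K (((State.round K)^[k] S).finalFeas,
        ((State.round K)^[k] S).finalValue (K true), List.range P.n) ((S.trail K k).take j)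
        ((S.trail K k).drop j) []
      rw [List.take_append_drop, List.length_take, State.length_trail, min_eq_left hj] at this
      rw [← this, Descent.iterate_step, hstart, Descent.turn]
      simp
    have hlen := State.length_trail K k S
    have r₄ : RunsWithin M p₄ q₄ _ _ := h₄
      (Descent.turn K ((Descent.step K)^[k] (Descent.start strict P.raw))) k hkB
      (fun j hj => by
        rw [hdrop j hj.le, Ascent.busy, Bool.not_eq_true', ← Bool.not_eq_true, List.isEmpty_iff,
          List.drop_eq_nil_iff]
        omega)
      (by
        rw [hdrop k le_rfl, Ascent.busy, Bool.not_eq_false', List.isEmpty_iff,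
          List.drop_eq_nil_iff]
        omega)
    have r₅ : RunsWithin M p₅ q₅ _ _ := h₅ ((Ascent.step K)^[k]
      (Descent.turn K ((Descent.step K)^[k] (Descent.start strict P.raw))))
    have hres : ((Ascent.step K)^[k]
        (Descent.turn K ((Descent.step K)^[k] (Descent.start strict P.raw)))).result =
        S.output K k P.n := by
      rw [hdrop k le_rfl, Ascent.result, State.output, State.backtrack,
        List.take_of_length_le hlen.le]
      rfl
    rw [← hres]
    exact r₁.seq (r₂.seq (r₃.seq (r₄.seq r₅)))

/-! ### Correctness of the output -/

namespace MapProblem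

variable {P : MapProblem F} {K : Bool → Toolkit M F strict}

/-- An assignment to the variables of the problem as one to all numbers. -/
def extendBy {n : ℕ} (x : Fin n → ℝ) (x₀ : ℕ → ℝ) (k : ℕ) : ℝ :=
  if h : k < n then x ⟨k, h⟩ else x₀ k

theorem extendBy_apply {n : ℕ} (x : Fin n → ℝ) (x₀ : ℕ → ℝ) :
    (fun i : Fin n => extendBy x x₀ i) = x := by
  funext i
  rw [extendBy, dif_pos i.2]

open Classical in
theorem total_initial (z : ℕ → ℝ) : (State.initial strict P.raw).total z =
    if (fun i : Fin P.n => z i) ∈ P.feasible then ENNReal.ofReal (P.density fun i => z i) else 0 := by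
  rw [State.total, weight_initial]
  exact if_congr (feas_initial z) rfl rfl

theorem enc_output (x : ℕ → ℝ) (v : ℝ) :
    enc (some (v, (List.range P.n).map x)) = .pair (.real v) (Val.ofVec fun i : Fin P.n => x i) := by
  simp only [enc, Option.elim, Val.ofVec, List.map_map]
  congr 2
  refine List.ext_getElem (by simp) fun i h1 h2 => by simp

/-- The supremum of the totals is that of the density. -/
theorem iSup_total_eq_of_isLUB {D : Set (Fin P.n → ℝ)} {s : ℝ}
    (hs : IsLUB (P.density '' D) s) : ⨆ x ∈ D, ENNReal.ofReal (P.density x) = ENNReal.ofReal s := by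
  refine le_antisymm (iSup₂_le fun x hx => ENNReal.ofReal_le_ofReal (hs.1 ⟨x, hx, rfl⟩)) ?_
  by_cases htop : ⨆ x ∈ D, ENNReal.ofReal (P.density x) = ∞
  · rw [htop]; exact le_top
  refine ENNReal.ofReal_le_of_le_toReal (hs.2 ?_)
  rintro _ ⟨x, hx, rfl⟩
  rw [← ENNReal.ofReal_le_iff_le_toReal htop]
  exact le_iSup₂ (f := fun x (_ : x ∈ D) => ENNReal.ofReal (P.density x)) x hx

/-- A supremum in a state in terms of the density. -/
theorem total_eq_iSup {S : State F strict} (hS : S.Extends (State.initial strict P.raw))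
    (hroot : S.root = P.n) (x : ℕ → ℝ) : S.total x =
      ⨆ y ∈ {y ∈ P.feasible | ∀ i : Fin P.n, (i : ℕ) ∈ S.act → y i = x i},
        ENNReal.ofReal (P.density y) := by
  classical
  rw [hS x]
  refine le_antisymm (iSup₂_le fun z hz => ?_) (iSup₂_le fun y hy => ?_)
  · rw [total_initial]
    split_ifs with h
    · exact le_iSup₂ (f := fun y (_ : y ∈ {y ∈ P.feasible | ∀ i : Fin P.n, (i : ℕ) ∈ S.act →
        y i = x i}) => ENNReal.ofReal (P.density y)) (fun i => z i)
        ⟨h, fun i hi => hz i (.inl hi)⟩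
    · exact zero_le
  · refine le_trans (le_of_eq ?_) (le_iSup₂ (f := fun (z : ℕ → ℝ)
      (_ : ∀ k, k ∈ S.act ∨ k = S.root → z k = x k) => (State.initial strict P.raw).total z)
      (extendBy y x) fun k hk => ?_)
    · rw [total_initial, extendBy_apply, if_pos hy.1]
    · by_cases hkn : k < P.n
      · rw [extendBy, dif_pos hkn]
        refine hy.2 ⟨k, hkn⟩ (hk.resolve_right fun h => ?_)
        omega
      · rw [extendBy, dif_neg hkn]

/-- If optimal partial assignments extend to maximisers, the suprema in the messages are attained. -/
theorem OptimaExtend.attains (hK : Oriented K) (hP : P.OptimaExtend) {S : State F strict}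
    (h : S.Valid) (hS : S.Extends (State.initial strict P.raw)) (hroot : S.root = P.n) {s : ℝ}
    (hs : IsLUB (P.density '' P.feasible) s) (h0 : ENNReal.ofReal s ≠ 0) :
    S.Attains K (ENNReal.ofReal s) := by
  obtain ⟨s', hs', hP⟩ := hP
  obtain rfl := hs.unique hs'
  refine State.attains_of_extends hK h hS h0 ENNReal.ofReal_ne_top fun x hx => ?_
  rw [total_eq_iSup (hS.round hK h) hroot] at hx
  obtain ⟨y, hy, hyx, hys⟩ := hP {i | (i : ℕ) ∈ (S.round K).act} (fun i => x i) (by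
    refine ⟨?_, fun b hb => ?_⟩
    · rintro _ ⟨y, hy, rfl⟩
      exact hs.1 ⟨y, hy.1, rfl⟩
    · have h1 : ENNReal.ofReal s ≤ ENNReal.ofReal b := by
        rw [← hx]
        exact iSup₂_le fun y hy => ENNReal.ofReal_le_ofReal (hb ⟨y, hy, rfl⟩)
      exact (ENNReal.ofReal_le_ofReal_iff'.1 h1).resolve_right fun h => h0 (by simpa using h))
  refine ⟨extendBy y x, fun k hk => ?_, ?_⟩
  · by_cases hkn : k < P.n
    · rw [extendBy, dif_pos hkn]
      refine hyx ⟨k, hkn⟩ (hk.resolve_right fun h => ?_)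
      rw [show (S.round K).root = P.n from hroot] at h
      omega
    · rw [extendBy, dif_neg hkn]
  · rw [total_initial, extendBy_apply, if_pos hy, hys]

/-- The output after rounds that leave no variable solves the problem. -/
theorem output_correct (hK : Oriented K) (hs : strict = false → P.NonStrict) {k : ℕ}
    (hk : ((State.round K)^[k] (State.initial strict P.raw)).act = []) :
    P.Solution (enc ((State.initial strict P.raw).output K k P.n)) ∧
      (F.AttainsSup strict ∨ P.OptimaExtend →
        P.ExactSolution (enc ((State.initial strict P.raw).output K k P.n))) := by
  have hV : (State.initial strict P.raw).Valid := initial_valid hs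
  have hVk := State.iterate_valid hK hV k
  have hEk := State.iterate_extends hK hV k
  have hrootj : ∀ j, ((State.round K)^[j] (State.initial strict P.raw)).root = P.n :=
    State.iterate_root
  have hfeas : P.feasible.Nonempty →
      ((State.round K)^[k] (State.initial strict P.raw)).Feas 0 := by
    rintro ⟨x, hx⟩
    have h1 := State.iterate_feas hK hV
      (z := extendBy x 0) ((feas_initial _).2 (by rwa [extendBy_apply])) k
    refine (hVk.total_congr fun i hi => ?_).1.1 h1
    rw [hk, hrootj] at hi
    rw [extendBy, dif_neg (by simp at hi; omega)]
  have hpoint := fun h0 => (feas_initial _).1 (State.backtrack_feas hK k hV h0)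
  set x : ℕ → ℝ := assignment ((State.initial strict P.raw).backtrack K k) with hx
  set E := (State.round K)^[k] (State.initial strict P.raw) with hE
  have hout : E.Feas 0 → enc ((State.initial strict P.raw).output K k P.n) =
      .pair (.real (E.finalValue (K true))) (Val.ofVec fun i : Fin P.n => x i) := by
    intro h0
    rw [State.output, ← hE, (State.finalFeas_iff hVk).2 h0, cond_true, ← hx, enc_output]
  have hval : ∀ s, P.feasible.Nonempty → IsLUB (P.density '' P.feasible) s →
      0 ≤ s ∧ E.finalValue (K true) = s ∧ E.total 0 = ENNReal.ofReal s := by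
    intro s hne hlub
    have h0 := hfeas hne
    obtain ⟨y, hy⟩ := hne
    have hs0 : 0 ≤ s := (density_nonneg y).trans (hlub.1 ⟨y, hy, rfl⟩)
    have h1 : E.total 0 = ENNReal.ofReal s := by
      rw [total_eq_iSup hEk (hrootj k), hk]
      exact iSup_total_eq_of_isLUB (by simpa using hlub)
    obtain ⟨h2, h3⟩ := State.finalValue_exact (K true) hVk hk h0 (by rw [h1]; simp)
    rw [h1] at h3
    exact ⟨hs0, (ENNReal.ofReal_eq_ofReal_iff h2 hs0).1 h3, h1⟩
  refine ⟨⟨fun hemp => ?_, fun hne => ?_⟩, fun hatt hne => ?_⟩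
  · have h0 : ¬ E.Feas 0 := fun h0 => by
      have := hpoint h0
      rw [hemp] at this
      exact this
    rw [← State.finalFeas_iff hVk, Bool.not_eq_true] at h0
    rw [State.output, ← hE, h0]
    rfl
  · have h0 := hfeas hne
    exact ⟨_, _, hout h0, fun s hlub => (hval s hne hlub).2.1, hpoint h0⟩
  · have h0 := hfeas hne
    have hxf := hpoint h0
    have hfin : ∀ j, F.AttainsSup strict →
        ((State.round K)^[j] (State.initial strict P.raw)).FiniteMsgs := by
      intro j hF
      induction j with
      | zero =>
        intro m hm
        obtain ⟨i, rfl⟩ := mem_msgs_initial.1 hm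
        exact fun _ => ENNReal.ofReal_ne_top
      | succ j ih =>
        rw [Function.iterate_succ_apply']
        exact ih.round hK hF (State.iterate_valid hK hV j)
    obtain ⟨s, hlub⟩ : ∃ s, IsLUB (P.density '' P.feasible) s := by
      rcases hatt with hF | ⟨s, hlub, -⟩
      · have htop : E.total 0 ≠ ∞ := by
          rw [State.total, if_pos h0]
          exact ENNReal.mul_ne_top (ENNReal.list_prod_ne_top fun _ _ => ENNReal.ofReal_ne_top)
            (ENNReal.list_prod_ne_top fun m hm => hfin k hF m hm _)
        refine Real.exists_isLUB (hne.image _) ⟨(E.total 0).toReal, ?_⟩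
        rintro _ ⟨y, hy, rfl⟩
        rw [← ENNReal.ofReal_le_iff_le_toReal htop, total_eq_iSup hEk (hrootj k), hk]
        exact le_iSup₂ (f := fun y (_ : y ∈ {y ∈ P.feasible | ∀ i : Fin P.n,
          (i : ℕ) ∈ ([] : List ℕ) → y i = (0 : ℕ → ℝ) i}) => ENNReal.ofReal (P.density y)) y
          ⟨hy, by simp⟩
      · exact ⟨s, hlub⟩
    obtain ⟨hs0, hv, htot0⟩ := hval s hne hlub
    have htot := State.backtrack_total hK k hV h0 fun hne0 j => by
      rw [htot0] at hne0 ⊢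
      rcases hatt with hF | hP
      · exact (hfin j hF).attains hK hF (State.iterate_valid hK hV j) hne0
      · exact hP.attains hK (State.iterate_valid hK hV j) (State.iterate_extends hK hV j)
          (hrootj j) hlub hne0
    rw [htot0, total_initial, if_pos hxf,
      ENNReal.ofReal_eq_ofReal_iff (density_nonneg _) hs0] at htot
    refine ⟨_, (hout h0).trans ?_, hxf, fun y hy => ?_⟩
    · rw [hv, htot]
    · rw [htot]
      exact hlub.1 ⟨y, hy, rfl⟩

end MapProblem

end

theorem mainTheorem1 {ι : Type} (prim : ι → List ℝ → ℝ) (F : FunFamily) (strict : Bool)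
    (hTMC : TractableMAP prim F strict) :
    ∃ p : Prog ι, ∀ d : ℕ, ∃ q : Polynomial ℕ, ∀ P : MapProblem F,
      TreewidthAtMost P.globalGraph 1 → P.DiameterAtMost d → (strict = false → P.NonStrict) →
      ∃ (w : Val) (t : ℕ), Runs prim p P.code w t ∧ t ≤ q.eval P.code.size ∧
        P.Solution w ∧
        (F.AttainsSup strict ∨ P.OptimaExtend → P.ExactSolution w) := by
  have h : TractableMAP (Machine.mk prim).prim F strict := hTMC
  obtain ⟨K₁, hK₁⟩ := h.exists_toolkit_fst
  obtain ⟨K₂, hK₂⟩ := h.exists_toolkit_snd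
  let K : Bool → Toolkit ⟨prim⟩ F strict := fun b => bif b then K₁ else K₂
  have hK : Oriented K := fun f y x => ⟨hK₁ f y x, hK₂ f y x⟩
  obtain ⟨p, hp⟩ := exists_program K
  refine ⟨p, fun d => ?_⟩
  obtain ⟨q, hq⟩ := hp (d + 2)
  refine ⟨q, fun P htw hd hs => ?_⟩
  have hend : ((State.round K)^[d + 2] (State.initial strict P.raw)).act = [] :=
    State.act_eq_nil htw.isAcyclic hd (fun i hi => MapProblem.mem_act_initial.1 hi)
      fun i j => MapProblem.adj_initial
  classical
  have hex : ∃ k, ((State.round K)^[k] (State.initial strict P.raw)).act = [] := ⟨_, hend⟩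
  obtain ⟨t, ht, htq⟩ := hq P (Nat.find hex) (Nat.find_min' hex hend)
    (fun j hj => Nat.find_min hex hj) (Nat.find_spec hex)
  exact ⟨_, t, ht, htq, MapProblem.output_correct hK hs (Nat.find_spec hex)⟩
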